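/- Vector fields. On $M=\{z\in\mathbb R^4: z_1>0,\ z_2>0,\ z_3\neq 0\}$ put $R_1=z_1\partial_{z_1}-z_2\partial_{z_2}-2z_3\partial_{z_3}$, $R_2=\frac{1+z_1z_2}{z_1z_3}\partial_{z_2}+\partial_{z_3}-\frac{z_4}{z_1z_2z_3}\partial_{z_4}$, $R_3=z_1z_3\partial_{z_1}-z_3^2\partial_{z_3}$, $R_4=-\frac14(z_1\partial_{z_1}-z_2\partial_{z_2})$. They satisfy $[R_1,R_2]=2R_2$, $[R_1,R_3]=-2R_3$, $[R_2,R_3]=R_1$, with $R_4$ central. Where $z_4\ne0$ they form a frame and commute with all the fields $\frac{a_1(1+z_1z_2)}{2z_2z_4}\partial_{z_1}+\frac{z_2z_4}{2}\partial_{z_2}-\frac{a_1z_3}{2z_1z_2z_4}\partial_{z_3}+\frac12(a_3z_4+a_1-z_4^2)\partial_{z_4}$, $a_1,a_3\in\mathbb R$. Their real span is the Vessiot algebra ($\cong\mathfrak{sl}(2)\oplus\mathbb R$). There is a smooth local left action of $\mathrm{SL}(2,\mathbb R)$ on $M\subset\mathbb R^4$ in which each $A=(A_{ij})\in\mathfrak{sl}(2,\mathbb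 R)$ has infinitesimal generator $A_{12}R_2-A_{11}R_1+A_{21}R_3$. Cauchy problem. Let $\gamma(t)=(p(t),q(t))$, $t\in I$ ($I$ an open interval), be a smooth plane curve with $p'$ and $q'$ nowhere zero, let $\boldsymbol n$ be a smooth (Euclidean) unit normal field along $\gamma$, and let $\phi_1,\phi_2,\psi_1,\psi_2$ be smooth functions along $\gamma$. Consider $$u_{xy}+\frac{u_xu_y}{2(1+e^{u/2+v/2})}=0,\qquad v_{xy}+\frac{v_xv_y}{2(1+e^{u/2+v/2})}=0,$$ $$u|_\gamma=\phi_1,\quad v|_\gamma=\phi_2,\quad \frac{\partial u}{\partial\boldsymbol n}\Big|_\gamma=\psi_1,\quad \frac{\partial v}{\partial\boldsymbol n}\Big|_\gamma=\psi_2 .$$ Theorem. Every open set containing $\gamma$ contains an open neighbourhood $W$ of $\gamma$, each of whose points is joined to $\gamma$ by a segment $x=\mathrm{const}$ in $W$ and has second coordinate in $q(I)$, such that the following hold. 1. (a) The problem has exactly one smooth solution $(u,v)$ on $W$. (b) Suppose moreover that the value of $u_y$ on $\gamma$ determined by the data has no zero. Then there are smooth functions $k_1,k_2$ on $q(I)$,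 determined by the Cauchy data, with $k_1(y)=\frac{u_yv_y}{1+e^{-(u+v)/2}}$ and $k_2(y)=\frac{2u_{yy}+u_y^2-k_1(y)}{u_y}$ along $\gamma$, where the derivatives are computed from the data and the equations. With these, $Z=(e^{u/2},e^{v/2},u_y,v_x)$ on $W$ is the flow, starting from the initial values of $Z$ along $\gamma$, of the Cauchy vector field $$\xi_{k_1,k_2}=\partial_y-\frac{k_2(y)}4(R_1+4R_4)+\frac{k_1(y)}2R_2+\frac12R_3 ;$$ that is, $Z$ is the unique $M$-valued map on $W$ with these initial values such that every $y\mapsto Z(x,y)$ is an integral curve. The field is $\partial_y$ plus a curve in the Vessiot algebra. Furthermore, for some $g$ on $q(I)$ with $g'=-k_2/4$, the map $w=(e^{g(y)}z_1,e^{-g(y)}z_2,z_3,z_4)$, where $Z=(z_1,z_2,z_3,z_4)$, satisfies the ordinary differential equation of Lie type, for the above local $\mathrm{SL}(2,\mathbb R)$-action, $$\frac{\partial w}{\partial y}=\Big(-\frac{k_2(y)}4R_1+\frac{k_1(y)}2R_2+\frac12R_3\Big)(w),$$ given by the curve $A(y)=\begin{pmatrix}k_2/4&k_1/2\\1/2&-k_2/4\end{pmatrix}$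 in $\mathfrak{sl}(2,\mathbb R)$. 2. $u_1=\frac{u+v}2$, $u_2=\frac{u-v}2$ is the unique smooth solution on $W$ of the Cauchy problem for wave maps (critical points of the energy) from $(\mathbb R^{1,1},dx\,dy)$ to $\big(\mathbb R^2,\frac{du_1^2-du_2^2}{1+e^{-u_1}}\big)$ with data $u_1|_\gamma=\frac{\phi_1+\phi_2}2$, $u_2|_\gamma=\frac{\phi_1-\phi_2}2$, $\frac{\partial u_1}{\partial\boldsymbol n}|_\gamma=\frac{\psi_1+\psi_2}2$, $\frac{\partial u_2}{\partial\boldsymbol n}|_\gamma=\frac{\psi_1-\psi_2}2$. -/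

import Mathlib

open Set
open scoped ContDiff

namespace WaveLie

/-! ### Partial derivatives and the hyperbolic system -/

/-- Partial derivative in the first variable. -/
noncomputable def dx (f : ℝ × ℝ → ℝ) (p : ℝ × ℝ) : ℝ := fderiv ℝ f p (1, 0)

/-- Partial derivative in the second variable. -/
noncomputable def dy (f : ℝ × ℝ → ℝ) (p : ℝ × ℝ) : ℝ := fderiv ℝ f p (0, 1)

/-- `(u, v)` satisfies on `W` the system
`u_xy + u_x u_y / (2 (1 + e^{u/2+v/2})) = 0`, `v_xy + v_x v_y / (2 (1 + e^{u/2+v/2})) = 0`. -/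
def SolvesSystem (W : Set (ℝ × ℝ)) (u v : ℝ × ℝ → ℝ) : Prop :=
  ∀ p ∈ W,
    dy (dx u) p + dx u p * dy u p / (2 * (1 + Real.exp (u p / 2 + v p / 2))) = 0 ∧
    dy (dx v) p + dx v p * dy v p / (2 * (1 + Real.exp (u p / 2 + v p / 2))) = 0

/-! ### Wave maps: critical points of the energy -/

/-- The two coordinate derivatives on the source. -/
noncomputable def pd (i : Fin 2) : (ℝ × ℝ → ℝ) → ℝ × ℝ → ℝ := ![dx, dy] i

/-- Energy density (with respect to Lebesgue measure `dx dy`) of a map `Φ` from the plane with the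
constant metric `g` to the plane with metric `h`:
`(1/2) g^{ij} h_{ab}(Φ) ∂_i Φ^a ∂_j Φ^b √|det g|`. -/
noncomputable def energyDensity (g : Matrix (Fin 2) (Fin 2) ℝ)
    (h : (Fin 2 → ℝ) → Matrix (Fin 2) (Fin 2) ℝ) (Φ : ℝ × ℝ → Fin 2 → ℝ) (p : ℝ × ℝ) : ℝ :=
  1 / 2 * (∑ i, ∑ j, ∑ a, ∑ b,
    g⁻¹ i j * h (Φ p) a b * pd i (fun r => Φ r a) p * pd j (fun r => Φ r b) p) * √|g.det|

/-- The energy of `Φ` over the domain `K`. -/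
noncomputable def energy (g : Matrix (Fin 2) (Fin 2) ℝ)
    (h : (Fin 2 → ℝ) → Matrix (Fin 2) (Fin 2) ℝ) (K : Set (ℝ × ℝ)) (Φ : ℝ × ℝ → Fin 2 → ℝ) : ℝ :=
  ∫ p in K, energyDensity g h Φ p

/-- `Φ` is harmonic on the open set `W`: it is smooth there and, for every compact domain `K ⊆ W`,
it is critical for the energy over `K` under smooth variations supported in `K`. -/
def IsHarmonicOn (g : Matrix (Fin 2) (Fin 2) ℝ)
    (h : (Fin 2 → ℝ) → Matrix (Fin 2) (Fin 2) ℝ) (W : Set (ℝ × ℝ)) (Φ : ℝ × ℝ → Fin 2 → ℝ) : Prop :=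
  ContDiffOn ℝ ∞ Φ W ∧
    ∀ K : Set (ℝ × ℝ), IsCompact K → K ⊆ W →
      ∀ η : ℝ × ℝ → Fin 2 → ℝ, ContDiff ℝ ∞ η → tsupport η ⊆ K →
        HasDerivAt (fun ε : ℝ => energy g h K (fun p => Φ p + ε • η p)) 0 0

/-- The flat metric `dx dy` of the Minkowski plane in characteristic coordinates. -/
noncomputable def minkowski : Matrix (Fin 2) (Fin 2) ℝ := !![0, 1 / 2; 1 / 2, 0]

/-- The target metric `(du₁² - du₂²) / (1 + e^{-u₁})`. -/
noncomputable def targetMetric (w : Fin 2 → ℝ) : Matrix (Fin 2) (Fin 2) ℝ :=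
  (1 / (1 + Real.exp (-w 0))) • !![1, 0; 0, -1]

/-! ### Cauchy data -/

/-- Smooth Cauchy data along a smooth curve `t ↦ (p t, q t)`, `t ∈ I`, whose tangent is nowhere
parallel to a coordinate axis; `(n₁, n₂)` is a smooth unit normal field along the curve. -/
structure CauchyData where
  /-- parameter interval -/
  I : Set ℝ
  isOpen_I : IsOpen I
  interval_I : I.OrdConnected
  /-- first coordinate of the curve -/
  p : ℝ → ℝ
  /-- second coordinate of the curve -/
  q : ℝ → ℝ
  smooth_p : ContDiffOn ℝ ∞ p I
  smooth_q : ContDiffOn ℝ ∞ q I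
  p_deriv : ∀ t ∈ I, deriv p t ≠ 0
  q_deriv : ∀ t ∈ I, deriv q t ≠ 0
  /-- first component of the normal -/
  n₁ : ℝ → ℝ
  /-- second component of the normal -/
  n₂ : ℝ → ℝ
  smooth_n₁ : ContDiffOn ℝ ∞ n₁ I
  smooth_n₂ : ContDiffOn ℝ ∞ n₂ I
  unit_n : ∀ t ∈ I, n₁ t ^ 2 + n₂ t ^ 2 = 1
  normal_n : ∀ t ∈ I, n₁ t * deriv p t + n₂ t * deriv q t = 0
  /-- prescribed value of `u` -/
  φ₁ : ℝ → ℝ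
  /-- prescribed value of `v` -/
  φ₂ : ℝ → ℝ
  /-- prescribed normal derivative of `u` -/
  ψ₁ : ℝ → ℝ
  /-- prescribed normal derivative of `v` -/
  ψ₂ : ℝ → ℝ
  smooth_φ₁ : ContDiffOn ℝ ∞ φ₁ I
  smooth_φ₂ : ContDiffOn ℝ ∞ φ₂ I
  smooth_ψ₁ : ContDiffOn ℝ ∞ ψ₁ I
  smooth_ψ₂ : ContDiffOn ℝ ∞ ψ₂ I

/-- Position space `ℝ⁴` of the adapted coordinates `(z₁, z₂, z₃, z₄)`. -/
abbrev E4 : Type := Fin 4 → ℝ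

namespace CauchyData

variable (C : CauchyData)

/-- The point of the curve with parameter `t`. -/
def pt (t : ℝ) : ℝ × ℝ := (C.p t, C.q t)

/-- The curve `γ` as a subset of the plane. -/
def curve : Set (ℝ × ℝ) := C.pt '' C.I

/-- `f` takes along `γ` the value `φ` and the normal derivative `ψ`. -/
def Attains (f : ℝ × ℝ → ℝ) (φ ψ : ℝ → ℝ) : Prop :=
  ∀ t ∈ C.I, f (C.pt t) = φ t ∧ fderiv ℝ f (C.pt t) (C.n₁ t, C.n₂ t) = ψ t

/-- `(u, v)` is a smooth solution on `W` of the Cauchy problem for the hyperbolic system. -/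
def IsSolution (W : Set (ℝ × ℝ)) (u v : ℝ × ℝ → ℝ) : Prop :=
  ContDiffOn ℝ ∞ u W ∧ ContDiffOn ℝ ∞ v W ∧ SolvesSystem W u v ∧
    C.Attains u C.φ₁ C.ψ₁ ∧ C.Attains v C.φ₂ C.ψ₂

/-- `Φ = (u₁, u₂)` is a solution on `W` of the Cauchy problem for wave maps into the metric
`(du₁² - du₂²) / (1 + e^{-u₁})`, with data `(φ₁ ± φ₂) / 2`, `(ψ₁ ± ψ₂) / 2`. -/
def IsWaveMapSolution (W : Set (ℝ × ℝ)) (Φ : ℝ × ℝ → Fin 2 → ℝ) : Prop :=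
  IsHarmonicOn minkowski targetMetric W Φ ∧
    C.Attains (fun r => Φ r 0) (fun t => (C.φ₁ t + C.φ₂ t) / 2) (fun t => (C.ψ₁ t + C.ψ₂ t) / 2) ∧
    C.Attains (fun r => Φ r 1) (fun t => (C.φ₁ t - C.φ₂ t) / 2) (fun t => (C.ψ₁ t - C.ψ₂ t) / 2)

/-! The lift of the data to the second jets: everything below is computed from the data alone. -/

/-- Along `γ`, the `x`-derivative of a function with value `φ` and normal derivative `ψ`. -/
noncomputable def liftX (φ ψ : ℝ → ℝ) (t : ℝ) : ℝ :=
  (deriv φ t * C.n₂ t - deriv C.q t * ψ t) / (deriv C.p t * C.n₂ t - deriv C.q t * C.n₁ t)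

/-- Along `γ`, the `y`-derivative of a function with value `φ` and normal derivative `ψ`. -/
noncomputable def liftY (φ ψ : ℝ → ℝ) (t : ℝ) : ℝ :=
  (deriv C.p t * ψ t - C.n₁ t * deriv φ t) / (deriv C.p t * C.n₂ t - deriv C.q t * C.n₁ t)

/-- `u_x` along `γ`. -/
noncomputable def ux : ℝ → ℝ := C.liftX C.φ₁ C.ψ₁
/-- `u_y` along `γ`. -/
noncomputable def uy : ℝ → ℝ := C.liftY C.φ₁ C.ψ₁
/-- `v_x` along `γ`. -/
noncomputable def vx : ℝ → ℝ := C.liftX C.φ₂ C.ψ₂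
/-- `v_y` along `γ`. -/
noncomputable def vy : ℝ → ℝ := C.liftY C.φ₂ C.ψ₂

/-- `u_xy` along `γ`, from the differential equation. -/
noncomputable def uxy (t : ℝ) : ℝ :=
  -(C.ux t * C.uy t) / (2 * (1 + Real.exp (C.φ₁ t / 2 + C.φ₂ t / 2)))

/-- `u_yy` along `γ`, from `(u_y ∘ γ)' = u_xy p' + u_yy q'`. -/
noncomputable def uyy (t : ℝ) : ℝ := (deriv C.uy t - C.uxy t * deriv C.p t) / deriv C.q t

/-- The value along `γ` of the first order invariant `β₁ = u_y v_y / (1 + e^{-(u+v)/2})`. -/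
noncomputable def inv₁ (t : ℝ) : ℝ :=
  C.uy t * C.vy t / (1 + Real.exp (-((C.φ₁ t + C.φ₂ t) / 2)))

/-- The value along `γ` of the second order invariant `(2 u_yy + u_y² - β₁) / u_y`. -/
noncomputable def inv₂ (t : ℝ) : ℝ := (2 * C.uyy t + C.uy t ^ 2 - C.inv₁ t) / C.uy t

/-- The data are nondegenerate: the value of `u_y` along `γ` has no zero. -/
def Nondegenerate : Prop := ∀ t ∈ C.I, C.uy t ≠ 0

/-- `k₁(y)`, `k₂(y)` are the smooth functions on the `y`-projection of `γ` that the data determine: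
the two invariants, written as functions of `y`. -/
def AreCoefficients (k₁ k₂ : ℝ → ℝ) : Prop :=
  ContDiffOn ℝ ∞ k₁ (C.q '' C.I) ∧ ContDiffOn ℝ ∞ k₂ (C.q '' C.I) ∧
    ∀ t ∈ C.I, k₁ (C.q t) = C.inv₁ t ∧ k₂ (C.q t) = C.inv₂ t

/-- The initial point `(e^{u/2}, e^{v/2}, u_y, v_x)` over `γ t`, from the data. -/
noncomputable def initial (t : ℝ) : E4 :=
  ![Real.exp (C.φ₁ t / 2), Real.exp (C.φ₂ t / 2), C.uy t, C.vx t]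

/-- Every point of `W` is joined to a point of `γ` by a segment `x = const` inside `W`, and its
second coordinate is attained on `γ`. -/
def VerticallyJoined (W : Set (ℝ × ℝ)) : Prop :=
  ∀ r ∈ W, r.2 ∈ C.q '' C.I ∧
    ∃ t ∈ C.I, C.p t = r.1 ∧ ∀ s ∈ uIcc (C.q t) r.2, (r.1, s) ∈ W

end CauchyData

/-! ### Vector fields on `ℝ⁴` -/

/-- The part `z₁ > 0`, `z₂ > 0`, `z₃ ≠ 0` of `ℝ⁴` on which the vector fields live. -/
def chart : Set E4 := {z | 0 < z 0 ∧ 0 < z 1 ∧ z 2 ≠ 0}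

/-- `z₁ ∂₁ - z₂ ∂₂ - 2 z₃ ∂₃` -/
def R₁ (z : E4) : E4 := ![z 0, -z 1, -2 * z 2, 0]

/-- `(1 + z₁ z₂) / (z₁ z₃) ∂₂ + ∂₃ - z₄ / (z₁ z₂ z₃) ∂₄` -/
noncomputable def R₂ (z : E4) : E4 :=
  ![0, (1 + z 0 * z 1) / (z 0 * z 2), 1, -(z 3 / (z 0 * z 1 * z 2))]

/-- `z₁ z₃ ∂₁ - z₃² ∂₃` -/
def R₃ (z : E4) : E4 := ![z 0 * z 2, 0, -(z 2) ^ 2, 0]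

/-- `-(1/4) (z₁ ∂₁ - z₂ ∂₂)` -/
noncomputable def R₄ (z : E4) : E4 := ![-(1 / 4) * z 0, 1 / 4 * z 1, 0, 0]

/-- The Vessiot algebra: the four-dimensional real vector space of vector fields spanned by
`R₁, R₂, R₃, R₄`. -/
noncomputable def vessiotAlgebra : Submodule ℝ (E4 → E4) := Submodule.span ℝ {R₁, R₂, R₃, R₄}

/-- The `z`-part of the total `x`-derivative along solutions (with `z₁ = e^{u/2}`, `z₂ = e^{v/2}`,
`z₃ = u_y`, `z₄ = v_x`), where `a₁`, `a₃` are the invariants depending on `x` only. -/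
noncomputable def charField (a₁ a₃ : ℝ) (z : E4) : E4 :=
  ![a₁ * (1 + z 0 * z 1) / (2 * z 1 * z 3), z 1 * z 3 / 2,
    -(a₁ * z 2 / (2 * z 0 * z 1 * z 3)), (a₃ * z 3 + a₁ - z 3 ^ 2) / 2]

/-- The bracket relations `[R₁, R₂] = 2 R₂`, `[R₁, R₃] = -2 R₃`, `[R₂, R₃] = R₁`, with `R₄` central:
the Vessiot algebra is `sl(2) ⊕ ℝ`; moreover at points with `z₄ ≠ 0` the four fields form a frame
and commute with the characteristic fields (they are tangential characteristic symmetries). -/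
def VessiotStructure : Prop :=
  (∀ z ∈ chart,
    VectorField.lieBracket ℝ R₁ R₂ z = (2 : ℝ) • R₂ z ∧
    VectorField.lieBracket ℝ R₁ R₃ z = (-2 : ℝ) • R₃ z ∧
    VectorField.lieBracket ℝ R₂ R₃ z = R₁ z ∧
    VectorField.lieBracket ℝ R₄ R₁ z = 0 ∧
    VectorField.lieBracket ℝ R₄ R₂ z = 0 ∧
    VectorField.lieBracket ℝ R₄ R₃ z = 0) ∧
  ∀ z ∈ chart, z 3 ≠ 0 →
    LinearIndependent ℝ ![R₁ z, R₂ z, R₃ z, R₄ z] ∧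
    ∀ V ∈ vessiotAlgebra, ∀ a₁ a₃ : ℝ, VectorField.lieBracket ℝ V (charField a₁ a₃) z = 0

/-- The component along `ℝ⁴`, at the value `y` of the independent variable, of the Cauchy vector
field `ξ = ∂_y - (k₂(y)/4) (R₁ + 4 R₄) + (k₁(y)/2) R₂ + (1/2) R₃`. -/
noncomputable def cauchyField (k₁ k₂ : ℝ → ℝ) (y : ℝ) : E4 → E4 :=
  -(k₂ y / 4) • (R₁ + (4 : ℝ) • R₄) + (k₁ y / 2) • R₂ + (1 / 2 : ℝ) • R₃

/-- The lift `(e^{u/2}, e^{v/2}, u_y, v_x)` of a pair of functions to the adapted coordinates. -/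
noncomputable def lift (u v : ℝ × ℝ → ℝ) (r : ℝ × ℝ) : E4 :=
  ![Real.exp (u r / 2), Real.exp (v r / 2), dy u r, dx v r]

/-- On `W`, the map `Z` is the flow of `cauchyField k₁ k₂` out of the initial curve: each
`y ↦ Z (x, y)` is an integral curve of the field inside `chart`, and `Z` takes the initial values
given by the data along `γ`. -/
def CauchyData.IsFlow (C : CauchyData) (k₁ k₂ : ℝ → ℝ) (W : Set (ℝ × ℝ)) (Z : ℝ × ℝ → E4) : Prop :=
  (∀ r ∈ W, Z r ∈ chart ∧ HasDerivAt (fun s => Z (r.1, s)) (cauchyField k₁ k₂ r.2 (Z r)) r.2) ∧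
    ∀ t ∈ C.I, Z (C.pt t) = C.initial t

/-! ### Local actions of `SL(2, ℝ)` and equations of Lie type -/

/-- The group `SL(2, ℝ)`. -/
abbrev SL2 : Type := Matrix.SpecialLinearGroup (Fin 2) ℝ

/-- The Lie algebra `sl(2, ℝ)` of trace-free matrices. -/
abbrev sl2 : Type := LieAlgebra.SpecialLinear.sl (Fin 2) ℝ

/-- The matrix entries of an element of `SL(2, ℝ)`. -/
def entries (g : SL2) : Fin 2 → Fin 2 → ℝ := fun i j => g.1 i j

/-- `μ`, with domain `D`, is a smooth local left action of `SL(2, ℝ)` on the open set `M ⊆ ℝ⁴`.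
Smoothness on the submanifold `SL(2, ℝ)` of the space of matrices is expressed by a smooth
extension to an open set. -/
structure IsLocalAction (M : Set E4) (D : Set (SL2 × E4)) (μ : SL2 → E4 → E4) : Prop where
  isOpen_space : IsOpen M
  isOpen_domain : IsOpen D
  base_mem : ∀ g z, (g, z) ∈ D → z ∈ M
  maps_to : ∀ g z, (g, z) ∈ D → μ g z ∈ M
  one_mem : ∀ z ∈ M, (1, z) ∈ D
  one_act : ∀ z ∈ M, μ 1 z = z
  inv_mem : ∀ g z, (g, z) ∈ D → (g⁻¹, μ g z) ∈ D
  mul_act : ∀ g h z, (h, z) ∈ D → (g, μ h z) ∈ D → (g * h, z) ∈ D → μ (g * h) z = μ g (μ h z)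
  smooth : ∃ (U : Set ((Fin 2 → Fin 2 → ℝ) × E4)) (F : (Fin 2 → Fin 2 → ℝ) × E4 → E4),
    IsOpen U ∧ ContDiffOn ℝ ∞ F U ∧
      ∀ g z, (g, z) ∈ D → (entries g, z) ∈ U ∧ μ g z = F (entries g, z)

/-- `X` is the infinitesimal generator on `M` of the local action `μ` in the direction `A`: for
every curve `c` in `SL(2, ℝ)` with `c 0 = 1` and velocity `A` at `0` (for instance `ε ↦ exp (ε A)`),
the derivative of `ε ↦ μ (c ε) z` at `0` is `X z`. -/
def IsGenerator (M : Set E4) (μ : SL2 → E4 → E4) (A : sl2) (X : E4 → E4) : Prop :=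
  ∀ c : ℝ → SL2, c 0 = 1 → HasDerivAt (fun ε => entries (c ε)) (fun i j => A.1 i j) 0 →
    ∀ z ∈ M, HasDerivAt (fun ε => μ (c ε) z) (X z) 0

/-- The rescaling `(z₁, z₂, z₃, z₄) ↦ (e^s z₁, e^{-s} z₂, z₃, z₄)`: the flow of `-4 R₄`. -/
noncomputable def rescale (s : ℝ) (z : E4) : E4 :=
  ![Real.exp s * z 0, Real.exp (-s) * z 1, z 2, z 3]

/-- The vector field on `ℝ⁴` attached to `A ∈ sl(2, ℝ)`: `A₁₂ R₂ - A₁₁ R₁ + A₂₁ R₃`. -/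
noncomputable def fieldOf (A : sl2) : E4 → E4 :=
  A.1 0 1 • R₂ - A.1 0 0 • R₁ + A.1 1 0 • R₃

/-- The curve `y ↦ [[k₂(y)/4, k₁(y)/2], [1/2, -k₂(y)/4]]` in `sl(2, ℝ)`. -/
noncomputable def lieCurve (k₁ k₂ : ℝ → ℝ) (y : ℝ) : sl2 :=
  ⟨!![k₂ y / 4, k₁ y / 2; 1 / 2, -(k₂ y / 4)], by
    simp [LieAlgebra.SpecialLinear.sl, Matrix.trace_fin_two]⟩

/-- On `W`, the map `w` satisfies the ordinary differential equation (in `y ∈ J`) of Lie type given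
by the local action `μ` of `SL(2, ℝ)` on `M` and the smooth curve `A` in `sl(2, ℝ)`: `∂w/∂y` at
`(x, y)` is the value at `w (x, y)` of the infinitesimal generator of `A y`. -/
def SolvesLieEquation (M : Set E4) (μ : SL2 → E4 → E4) (A : ℝ → sl2) (J : Set ℝ)
    (W : Set (ℝ × ℝ)) (w : ℝ × ℝ → E4) : Prop :=
  ContDiffOn ℝ ∞ (fun y i j => (A y).1 i j : ℝ → Fin 2 → Fin 2 → ℝ) J ∧
    ∀ r ∈ W, r.2 ∈ J ∧ w r ∈ M ∧
      ∃ X : E4 → E4, IsGenerator M μ (A r.2) X ∧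
        HasDerivAt (fun s => w (r.1, s)) (X (w r)) r.2

end WaveLie

namespace WaveLie

/-! ### Brackets of the coordinate vector fields -/

/-! The system is integrable through `SL(2, ℝ)`. Suppose a matrix `g = !![A, P; Q, B]` of
determinant one satisfies `g_x = !![0, l₁; l₂, 0] * g` with `l₁, l₂` functions of `x`, and `g_y = g
* !![0, m₁; m₂, 0]` with `m₁, m₂` functions of `y`. Put `u = 2 log P`, `v = 2 log Q`. Then `u_x = 2
l₁ B / P`, `u_y = 2 m₁ A / P`, `u_xy = -2 l₁ m₁ / P²`, and `1 + e^{(u+v)/2} = 1 + P Q = A B`, so the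
first equation holds identically; the second is symmetric (`IsLoopSolution.logs`).

Existence. Such a `g` is a product `L(x) M(y)` of solutions of linear one-variable equations, and
these exist on whole open intervals by the Dyson series. The Cauchy data prescribe `P` and `Q` along
`γ`; the missing diagonal entries come from one quadrature, after which `l₁, l₂, m₁, m₂` can be read
off. The product agrees with the prescribed matrix on all of `γ`, because both solve the same linear
equation along it (`exists_loopSolution`). Near `γ` the entries `A, P, Q` stay positive, so the
logarithms exist.

Uniqueness. In the characteristic coordinates `(s, t) ↦ (p s, q t)` the curve is the diagonal. The
difference of two solutions satisfies a linear hyperbolic inequality with zero data there, which an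
exponentially weighted maximum excludes (`eq_zero_of_hyperbolic_le`). The neighbourhood `W` is
therefore built as a union of characteristic squares (`exists_nhds`).

Flow. The invariants become `k₁ = 4 m₁ m₂` and `k₂ = 2 m₁' / m₁`, functions of `y` alone, so
identities known on `γ` hold throughout `W`. With them the `y`-derivative of the lift is the Cauchy
field. Its integral curves are unique because the field is triangular and linear in suitable
variables (`integralCurve_unique`). The central part `-k₂ R₄` is removed by the flow of `R₄`; what
remains is generated by left multiplication of `SL(2, ℝ)` on determinant-one matrices.

Wave maps. The first variation of the energy (`hasDerivAt_energy`) yields two Euler-Lagrange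
equations whose sum and difference are the two equations of the system, so both existence and
uniqueness transfer. -/

theorem fderiv_eq_of_hasDerivAt {f : E4 → E4} {z v w : E4} (hf : DifferentiableAt ℝ f z)
    (h : ∀ i, HasDerivAt (fun ε : ℝ => f (z + ε • v) i) (w i) 0) : fderiv ℝ f z v = w := by
  have h1 : HasDerivAt (fun ε : ℝ => f (z + ε • v)) w 0 := hasDerivAt_pi.2 h
  have h2 : HasDerivAt (fun ε : ℝ => z + ε • v) v 0 := by
    simpa using ((hasDerivAt_id (0 : ℝ)).smul_const v).const_add z
  have h3 : HasFDerivAt f (fderiv ℝ f z) (z + (0 : ℝ) • v) := by simpa using hf.hasFDerivAt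
  exact (h3.comp_hasDerivAt (0 : ℝ) h2).unique h1

theorem differentiableAt_R₁ (z : E4) : DifferentiableAt ℝ R₁ z := by
  rw [differentiableAt_pi]
  intro i
  fin_cases i <;> simp [R₁] <;> fun_prop

theorem differentiableAt_R₂ {z : E4} (hz : z ∈ chart) : DifferentiableAt ℝ R₂ z := by
  obtain ⟨h0, h1, h2⟩ := hz
  rw [differentiableAt_pi]
  intro i
  fin_cases i <;> simp [R₂] <;> fun_prop (disch := positivity)

theorem differentiableAt_R₃ (z : E4) : DifferentiableAt ℝ R₃ z := by
  rw [differentiableAt_pi]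
  intro i
  fin_cases i <;> simp [R₃] <;> fun_prop

theorem differentiableAt_R₄ (z : E4) : DifferentiableAt ℝ R₄ z := by
  rw [differentiableAt_pi]
  intro i
  fin_cases i <;> simp [R₄] <;> fun_prop

theorem differentiableAt_charField {z : E4} (hz : z ∈ chart) (h3 : z 3 ≠ 0) (a₁ a₃ : ℝ) :
    DifferentiableAt ℝ (charField a₁ a₃) z := by
  obtain ⟨h0, h1, h2⟩ := hz
  rw [differentiableAt_pi]
  intro i
  fin_cases i <;> simp [charField]
  all_goals fun_prop (disch := positivity)

theorem fderiv_R₁ (z v : E4) : fderiv ℝ R₁ z v = ![v 0, -v 1, -2 * v 2, 0] := by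
  apply fderiv_eq_of_hasDerivAt (differentiableAt_R₁ z)
  have hl : ∀ i, HasDerivAt (fun ε : ℝ => z i + ε * v i) (v i) 0 := fun i => by
    simpa using ((hasDerivAt_id (0 : ℝ)).mul_const (v i)).const_add (z i)
  intro i
  fin_cases i <;> simp [R₁]
  · simpa using hl 0
  · simpa using (hl 1).fun_neg
  · exact ((hl 2).const_mul 2).fun_neg
  · exact hasDerivAt_const _ _

theorem fderiv_R₃ (z v : E4) :
    fderiv ℝ R₃ z v = ![v 0 * z 2 + z 0 * v 2, 0, -(2 * z 2 * v 2), 0] := by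
  apply fderiv_eq_of_hasDerivAt (differentiableAt_R₃ z)
  have hl : ∀ i, HasDerivAt (fun ε : ℝ => z i + ε * v i) (v i) 0 := fun i => by
    simpa using ((hasDerivAt_id (0 : ℝ)).mul_const (v i)).const_add (z i)
  intro i
  fin_cases i <;> simp [R₃]
  · simpa using (hl 0).fun_mul (hl 2)
  · exact hasDerivAt_const _ _
  · simpa using ((hl 2).fun_pow 2).fun_neg
  · exact hasDerivAt_const _ _

theorem fderiv_R₄ (z v : E4) : fderiv ℝ R₄ z v = ![-(1 / 4) * v 0, 1 / 4 * v 1, 0, 0] := by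
  apply fderiv_eq_of_hasDerivAt (differentiableAt_R₄ z)
  have hl : ∀ i, HasDerivAt (fun ε : ℝ => z i + ε * v i) (v i) 0 := fun i => by
    simpa using ((hasDerivAt_id (0 : ℝ)).mul_const (v i)).const_add (z i)
  intro i
  fin_cases i <;> simp [R₄]
  · simpa using ((hl 0).const_mul (4⁻¹ : ℝ)).fun_neg
  · simpa using (hl 1).const_mul (4⁻¹ : ℝ)
  · exact hasDerivAt_const _ _
  · exact hasDerivAt_const _ _

theorem fderiv_R₂ {z : E4} (hz : z ∈ chart) (v : E4) :
    fderiv ℝ R₂ z v =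
      ![0, ((v 0 * z 1 + z 0 * v 1) * (z 0 * z 2) - (1 + z 0 * z 1) * (v 0 * z 2 + z 0 * v 2)) /
          (z 0 * z 2) ^ 2, 0,
        -((v 3 * (z 0 * z 1 * z 2) -
          z 3 * ((v 0 * z 1 + z 0 * v 1) * z 2 + z 0 * z 1 * v 2)) / (z 0 * z 1 * z 2) ^ 2)] := by
  apply fderiv_eq_of_hasDerivAt (differentiableAt_R₂ hz)
  obtain ⟨h0, h1, h2⟩ := hz
  have hl : ∀ i, HasDerivAt (fun ε : ℝ => z i + ε * v i) (v i) 0 := fun i => by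
    simpa using ((hasDerivAt_id (0 : ℝ)).mul_const (v i)).const_add (z i)
  intro i
  fin_cases i <;> simp [R₂]
  · exact hasDerivAt_const _ _
  · simpa using (((hl 0).fun_mul (hl 1)).const_add 1).fun_div ((hl 0).fun_mul (hl 2))
      (by simp; exact ⟨h0.ne', h2⟩)
  · exact hasDerivAt_const _ _
  · simpa using ((hl 3).fun_div (((hl 0).fun_mul (hl 1)).fun_mul (hl 2))
      (by simp; exact ⟨⟨h0.ne', h1.ne'⟩, h2⟩)).fun_neg

theorem fderiv_charField {z : E4} (hz : z ∈ chart) (h3 : z 3 ≠ 0) (a₁ a₃ : ℝ) (v : E4) :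
    fderiv ℝ (charField a₁ a₃) z v =
      ![(a₁ * (v 0 * z 1 + z 0 * v 1) * (2 * z 1 * z 3) -
            a₁ * (1 + z 0 * z 1) * (2 * v 1 * z 3 + 2 * z 1 * v 3)) / (2 * z 1 * z 3) ^ 2,
        (v 1 * z 3 + z 1 * v 3) / 2,
        -((a₁ * v 2 * (2 * z 0 * z 1 * z 3) - a₁ * z 2 *
            ((2 * v 0 * z 1 + 2 * z 0 * v 1) * z 3 + 2 * z 0 * z 1 * v 3)) /
            (2 * z 0 * z 1 * z 3) ^ 2),
        (a₃ * v 3 - 2 * z 3 * v 3) / 2] := by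
  apply fderiv_eq_of_hasDerivAt (differentiableAt_charField hz h3 a₁ a₃)
  obtain ⟨h0, h1, h2⟩ := hz
  have hl : ∀ i, HasDerivAt (fun ε : ℝ => z i + ε * v i) (v i) 0 := fun i => by
    simpa using ((hasDerivAt_id (0 : ℝ)).mul_const (v i)).const_add (z i)
  intro i
  fin_cases i <;> simp [charField]
  · simpa using ((((hl 0).fun_mul (hl 1)).const_add 1).const_mul a₁).fun_div
      (((hl 1).const_mul 2).fun_mul (hl 3)) (by simp; exact ⟨h1.ne', h3⟩)
  · simpa using ((hl 1).fun_mul (hl 3)).div_const 2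
  · simpa using (((hl 2).const_mul a₁).fun_div ((((hl 0).const_mul 2).fun_mul (hl 1)).fun_mul (hl 3))
      (by simp; exact ⟨⟨h0.ne', h1.ne'⟩, h3⟩)).fun_neg
  · simpa using ((((hl 3).const_mul a₃).add_const a₁).sub ((hl 3).pow 2)).div_const 2

theorem lieBracket_R₁_R₂ {z : E4} (hz : z ∈ chart) :
    VectorField.lieBracket ℝ R₁ R₂ z = (2 : ℝ) • R₂ z := by
  rw [VectorField.lieBracket, fderiv_R₁, fderiv_R₂ hz]
  obtain ⟨h0, h1, h2⟩ := hz
  ext i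
  fin_cases i <;> simp [R₁, R₂] <;> field_simp <;> ring

theorem lieBracket_R₁_R₃ (z : E4) : VectorField.lieBracket ℝ R₁ R₃ z = (-2 : ℝ) • R₃ z := by
  rw [VectorField.lieBracket, fderiv_R₁, fderiv_R₃]
  ext i
  fin_cases i <;> simp [R₁, R₃] <;> ring

theorem lieBracket_R₂_R₃ {z : E4} (hz : z ∈ chart) :
    VectorField.lieBracket ℝ R₂ R₃ z = R₁ z := by
  rw [VectorField.lieBracket, fderiv_R₂ hz, fderiv_R₃]
  obtain ⟨h0, h1, h2⟩ := hz
  ext i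
  fin_cases i <;> simp [R₁, R₂, R₃] <;> field_simp <;> ring_nf <;> simp

theorem lieBracket_R₄_R₁ (z : E4) : VectorField.lieBracket ℝ R₄ R₁ z = 0 := by
  rw [VectorField.lieBracket, fderiv_R₁, fderiv_R₄]
  ext i
  fin_cases i <;> simp [R₁, R₄]

theorem lieBracket_R₄_R₂ {z : E4} (hz : z ∈ chart) : VectorField.lieBracket ℝ R₄ R₂ z = 0 := by
  rw [VectorField.lieBracket, fderiv_R₂ hz, fderiv_R₄]
  obtain ⟨h0, h1, h2⟩ := hz
  ext i
  fin_cases i <;> simp [R₂, R₄] <;> field_simp <;> ring_nf <;> simp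

theorem lieBracket_R₄_R₃ (z : E4) : VectorField.lieBracket ℝ R₄ R₃ z = 0 := by
  rw [VectorField.lieBracket, fderiv_R₃, fderiv_R₄]
  ext i
  fin_cases i <;> simp [R₃, R₄] <;> ring

/-- Only `R₂` has a `∂₄` component, and it is nonzero when `z₄ ≠ 0`. Of the remaining three fields,
`R₁` and `R₄` have opposite logarithmic components along `∂₁, ∂₂`, so adding these two relations
isolates the `R₃` coefficient; the `∂₃` relation then gives the `R₁` coefficient. -/
theorem linearIndependent_frame {z : E4} (hz : z ∈ chart) (h3 : z 3 ≠ 0) :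
    LinearIndependent ℝ ![R₁ z, R₂ z, R₃ z, R₄ z] := by
  obtain ⟨h0, h1, h2⟩ := hz
  rw [Fintype.linearIndependent_iff]
  intro g hg
  have hg' := fun i => congrFun hg i
  simp only [Fin.sum_univ_four, Pi.add_apply, Pi.smul_apply, Pi.zero_apply, smul_eq_mul] at hg'
  have e0 := hg' 0
  have e1 := hg' 1
  have e2 := hg' 2
  have e3 : g 1 * (z 3 / (z 0 * z 1 * z 2)) = 0 := by simpa [R₁, R₂, R₃, R₄] using hg' 3
  simp [R₁, R₂, R₃, R₄] at e0 e1 e2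
  have g1 : g 1 = 0 := (mul_eq_zero.1 e3).resolve_right (by positivity)
  simp only [g1, zero_mul, add_zero] at e0 e1 e2
  have k0 : g 0 + g 2 * z 2 - g 3 / 4 = 0 := by
    have : z 0 * (g 0 + g 2 * z 2 - g 3 / 4) = 0 := by linear_combination e0
    simpa [h0.ne'] using this
  have k1 : -g 0 + g 3 / 4 = 0 := by
    have : z 1 * (-g 0 + g 3 / 4) = 0 := by linear_combination e1
    simpa [h1.ne'] using this
  have g2 : g 2 = 0 := by
    have : g 2 * z 2 = 0 := by linear_combination k0 + k1
    simpa [h2] using this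
  have g0 : g 0 = 0 := by
    have : g 0 * z 2 = 0 := by rw [g2] at e2; linear_combination -e2 / 2
    simpa [h2] using this
  have g3 : g 3 = 0 := by linear_combination 4 * k1 + 4 * g0
  intro i
  fin_cases i
  exacts [g0, g1, g2, g3]

theorem exists_coeff_of_mem_vessiotAlgebra {V : E4 → E4} (hV : V ∈ vessiotAlgebra) :
    ∃ a b c d : ℝ, V = a • R₁ + b • R₂ + c • R₃ + d • R₄ := by
  rw [vessiotAlgebra] at hV
  obtain ⟨a, V₁, hV₁, rfl⟩ := Submodule.mem_span_insert.1 hV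
  obtain ⟨b, V₂, hV₂, rfl⟩ := Submodule.mem_span_insert.1 hV₁
  obtain ⟨c, V₃, hV₃, rfl⟩ := Submodule.mem_span_insert.1 hV₂
  obtain ⟨d, rfl⟩ := Submodule.mem_span_singleton.1 hV₃
  exact ⟨a, b, c, d, by abel⟩

theorem lieBracket_charField {z : E4} (hz : z ∈ chart) (h3 : z 3 ≠ 0) {V : E4 → E4}
    (hV : V ∈ vessiotAlgebra) (a₁ a₃ : ℝ) :
    VectorField.lieBracket ℝ V (charField a₁ a₃) z = 0 := by
  obtain ⟨a, b, c, d, rfl⟩ := exists_coeff_of_mem_vessiotAlgebra hV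
  have d1 := (differentiableAt_R₁ z).const_smul a
  have d2 := (differentiableAt_R₂ hz).const_smul b
  have d3 := (differentiableAt_R₃ z).const_smul c
  have d4 := (differentiableAt_R₄ z).const_smul d
  have e : ∀ w, fderiv ℝ (a • R₁ + b • R₂ + c • R₃ + d • R₄) z w =
      a • fderiv ℝ R₁ z w + b • fderiv ℝ R₂ z w + c • fderiv ℝ R₃ z w + d • fderiv ℝ R₄ z w := by
    intro w
    rw [fderiv_add ((d1.add d2).add d3) d4, fderiv_add (d1.add d2) d3, fderiv_add d1 d2,
      fderiv_const_smul (differentiableAt_R₁ z), fderiv_const_smul (differentiableAt_R₂ hz),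
      fderiv_const_smul (differentiableAt_R₃ z), fderiv_const_smul (differentiableAt_R₄ z)]
    rfl
  rw [VectorField.lieBracket, e, fderiv_R₁, fderiv_R₂ hz, fderiv_R₃, fderiv_R₄,
    fderiv_charField hz h3]
  obtain ⟨h0, h1, h2⟩ := hz
  ext i
  fin_cases i <;> simp [R₁, R₂, R₃, R₄, charField] <;> field_simp <;> ring

theorem vessiotStructure : VessiotStructure :=
  ⟨fun z hz => ⟨lieBracket_R₁_R₂ hz, lieBracket_R₁_R₃ z, lieBracket_R₂_R₃ hz, lieBracket_R₄_R₁ z,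
    lieBracket_R₄_R₂ hz, lieBracket_R₄_R₃ z⟩, fun _ hz h3 =>
    ⟨linearIndependent_frame hz h3, fun _ hV a₁ a₃ => lieBracket_charField hz h3 hV a₁ a₃⟩⟩

end WaveLie

namespace WaveLie

/-! ### The local action of `SL(2, ℝ)`

In the coordinates `(X, Y, q, b, c) = (z₁, z₁ z₃, z₂, (1 + z₁ z₂) / (z₁ z₃), z₄ z₂ / (z₁ z₃))` a point
of `chart` is a matrix `!![Y, q; X, b]` of determinant one together with the number `c`, and the
action is left multiplication on the matrix. -/

/-- The action of a matrix `m` on `ℝ⁴`. -/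
noncomputable def matAct (m : Fin 2 → Fin 2 → ℝ) (z : E4) : E4 :=
  ![m 1 0 * (z 0 * z 2) + m 1 1 * z 0,
    m 0 0 * z 1 + m 0 1 * ((1 + z 0 * z 1) / (z 0 * z 2)),
    (m 0 0 * (z 0 * z 2) + m 0 1 * z 0) / (m 1 0 * (z 0 * z 2) + m 1 1 * z 0),
    z 3 * z 1 / (z 0 * z 2) * (m 0 0 * (z 0 * z 2) + m 0 1 * z 0) /
      (m 0 0 * z 1 + m 0 1 * ((1 + z 0 * z 1) / (z 0 * z 2)))]

/-- The local action of `SL(2, ℝ)`. -/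
noncomputable def slAct (g : SL2) (z : E4) : E4 := matAct (entries g) z

/-- The domain of the local action. -/
def slDomain : Set (SL2 × E4) := {x | x.2 ∈ chart ∧ slAct x.1 x.2 ∈ chart}

theorem isOpen_chart : IsOpen chart := by
  have h0 : IsOpen {z : E4 | 0 < z 0} := isOpen_lt continuous_const (continuous_apply 0)
  have h1 : IsOpen {z : E4 | 0 < z 1} := isOpen_lt continuous_const (continuous_apply 1)
  have h2 : IsOpen {z : E4 | z 2 ≠ 0} := isOpen_ne_fun (continuous_apply 2) continuous_const
  exact h0.inter (h1.inter h2)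

theorem slAct_one {z : E4} (hz : z ∈ chart) : slAct 1 z = z := by
  obtain ⟨h0, h1, h2⟩ := hz
  ext i
  fin_cases i <;> simp [slAct, matAct, entries] <;> field_simp

/-- Associativity of matrix multiplication, once the transformed point is known to encode the
transformed matrix. Three of its entries are explicit; the fourth is recomputed from the others,
which is consistent because `h` has determinant one. -/
theorem slAct_mul {g h : SL2} {z : E4} (hz : z ∈ chart) (hhz : slAct h z ∈ chart) :
    slAct (g * h) z = slAct g (slAct h z) := by
  obtain ⟨h0, h1, h2⟩ := hz
  obtain ⟨k0, k1, k2⟩ := hhz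
  have hdet := h.det_coe
  rw [Matrix.det_fin_two] at hdet
  set X := entries h 1 0 * (z 0 * z 2) + entries h 1 1 * z 0 with hX
  set Y := entries h 0 0 * (z 0 * z 2) + entries h 0 1 * z 0 with hY
  set q := entries h 0 0 * z 1 + entries h 0 1 * ((1 + z 0 * z 1) / (z 0 * z 2)) with hq
  set b := entries h 1 0 * z 1 + entries h 1 1 * ((1 + z 0 * z 1) / (z 0 * z 2)) with hb
  have e : slAct h z = ![X, q, Y / X, z 3 * z 1 / (z 0 * z 2) * Y / q] := rfl
  have hX0 : 0 < X := by simpa [e] using k0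
  have hq0 : 0 < q := by simpa [e] using k1
  have hY0 : Y ≠ 0 := by
    have : Y / X ≠ 0 := by simpa [e] using k2
    rintro h
    simp [h] at this
  -- The image of a determinant-one matrix under `h` again has determinant one.
  have hYb : Y * b = 1 + X * q := by
    have : entries h 0 0 * entries h 1 1 - entries h 0 1 * entries h 1 0 = 1 := hdet
    rw [hX, hY, hq, hb]
    field_simp
    linear_combination z 2 * this
  have hb' : b = (1 + X * q) / Y := by field_simp; linarith
  have m : ∀ i j, entries (g * h) i j =
      entries g i 0 * entries h 0 j + entries g i 1 * entries h 1 j := by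
    intro i j
    simp [entries, Matrix.mul_apply]
  have eX : entries (g * h) 1 0 * (z 0 * z 2) + entries (g * h) 1 1 * z 0 =
      entries g 1 0 * Y + entries g 1 1 * X := by rw [m, m, hX, hY]; ring
  have eY : entries (g * h) 0 0 * (z 0 * z 2) + entries (g * h) 0 1 * z 0 =
      entries g 0 0 * Y + entries g 0 1 * X := by rw [m, m, hX, hY]; ring
  have eq : entries (g * h) 0 0 * z 1 + entries (g * h) 0 1 * ((1 + z 0 * z 1) / (z 0 * z 2)) =
      entries g 0 0 * q + entries g 0 1 * b := by rw [m, m, hq, hb]; ring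
  have hXY : X * (Y / X) = Y := by field_simp
  -- The number `c` is unchanged by the action of `h`.
  have hc : z 3 * z 1 / (z 0 * z 2) * Y / q * q / Y = z 3 * z 1 / (z 0 * z 2) := by field_simp
  have e1 : slAct (g * h) z = ![entries g 1 0 * Y + entries g 1 1 * X,
      entries g 0 0 * q + entries g 0 1 * b,
      (entries g 0 0 * Y + entries g 0 1 * X) / (entries g 1 0 * Y + entries g 1 1 * X),
      z 3 * z 1 / (z 0 * z 2) * (entries g 0 0 * Y + entries g 0 1 * X) /
        (entries g 0 0 * q + entries g 0 1 * b)] := by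
    rw [slAct, matAct, eX, eY, eq]
  rw [e1, e, slAct, matAct]
  simp only [Matrix.cons_val_zero, Matrix.cons_val_one, Matrix.cons_val]
  rw [hXY, hc, ← hb']

/-- All matrices are admitted here, not only unimodular ones: this open set carries the smooth
extension required by `IsLocalAction.smooth`. -/
theorem isOpen_and_contDiffOn_matAct :
    IsOpen {x : (Fin 2 → Fin 2 → ℝ) × E4 | x.2 ∈ chart ∧ matAct x.1 x.2 ∈ chart} ∧
    ContDiffOn ℝ ∞ (fun x : (Fin 2 → Fin 2 → ℝ) × E4 => matAct x.1 x.2)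
      {x : (Fin 2 → Fin 2 → ℝ) × E4 | x.2 ∈ chart ∧ matAct x.1 x.2 ∈ chart} := by
  have hm : ∀ i j, ContDiff ℝ ∞ fun x : (Fin 2 → Fin 2 → ℝ) × E4 => x.1 i j := fun i j => by
    fun_prop
  have hz : ∀ i, ContDiff ℝ ∞ fun x : (Fin 2 → Fin 2 → ℝ) × E4 => x.2 i := fun i => by
    fun_prop
  set C : Set ((Fin 2 → Fin 2 → ℝ) × E4) := Prod.snd ⁻¹' chart with hC
  have hCo : IsOpen C := isOpen_chart.preimage continuous_snd
  have c0 : ContDiff ℝ ∞ fun x : (Fin 2 → Fin 2 → ℝ) × E4 => matAct x.1 x.2 0 := by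
    simp only [matAct, Matrix.cons_val]; fun_prop
  have cY : ContDiff ℝ ∞ fun x : (Fin 2 → Fin 2 → ℝ) × E4 =>
    x.1 0 0 * (x.2 0 * x.2 2) + x.1 0 1 * x.2 0 := by fun_prop
  have hY : ∀ x ∈ C, x.2 0 * x.2 2 ≠ 0 := fun x hx => mul_ne_zero hx.1.ne' hx.2.2
  have c1 : ContDiffOn ℝ ∞ (fun x : (Fin 2 → Fin 2 → ℝ) × E4 => matAct x.1 x.2 1) C := by
    simp only [matAct, Matrix.cons_val]
    exact ((hm 0 0).mul (hz 1)).contDiffOn.add ((hm 0 1).contDiffOn.mul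
      (ContDiffOn.div (by fun_prop) (by fun_prop) hY))
  -- Once the first coordinate of the image is positive, nonvanishing of the third is nonvanishing
  -- of its numerator. This removes the quotient from the openness argument.
  have hset : {x : (Fin 2 → Fin 2 → ℝ) × E4 | x.2 ∈ chart ∧ matAct x.1 x.2 ∈ chart} =
      (C ∩ (fun x => matAct x.1 x.2 1) ⁻¹' Ioi 0) ∩
        ({x | 0 < matAct x.1 x.2 0} ∩ {x | x.1 0 0 * (x.2 0 * x.2 2) + x.1 0 1 * x.2 0 ≠ 0}) := by
    ext x
    constructor
    · rintro ⟨h, k0, k1, k2⟩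
      refine ⟨⟨h, k1⟩, k0, ?_⟩
      intro h'
      apply k2
      simp [matAct, h']
    · rintro ⟨⟨h, k1⟩, k0, k2⟩
      exact ⟨h, k0, k1, div_ne_zero k2 k0.ne'⟩
  have hopen : IsOpen {x : (Fin 2 → Fin 2 → ℝ) × E4 | x.2 ∈ chart ∧ matAct x.1 x.2 ∈ chart} := by
    rw [hset]
    exact (c1.continuousOn.isOpen_inter_preimage hCo isOpen_Ioi).inter
      ((isOpen_lt continuous_const c0.continuous).inter
        (isOpen_ne_fun cY.continuous continuous_const))
  refine ⟨hopen, ?_⟩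
  rw [contDiffOn_pi]
  intro i
  fin_cases i
  · exact c0.contDiffOn
  · exact c1.mono fun x hx => hx.1
  · exact ContDiffOn.div cY.contDiffOn c0.contDiffOn fun x hx => hx.2.1.ne'
  · refine ContDiffOn.div (ContDiffOn.mul (ContDiffOn.div (by fun_prop) (by fun_prop)
      fun x hx => hY x hx.1) cY.contDiffOn) (c1.mono fun x hx => hx.1) fun x hx => hx.2.2.1.ne'

theorem continuous_entries : Continuous entries :=
  continuous_pi fun i => continuous_pi fun j => continuous_subtype_val.matrix_elem i j

theorem isLocalAction_slAct : IsLocalAction chart slDomain slAct where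
  isOpen_space := isOpen_chart
  isOpen_domain := isOpen_and_contDiffOn_matAct.1.preimage
    ((continuous_entries.comp continuous_fst).prodMk continuous_snd)
  base_mem _ _ h := h.1
  maps_to _ _ h := h.2
  one_mem z hz := ⟨hz, by rw [slAct_one hz]; exact hz⟩
  one_act _ hz := slAct_one hz
  inv_mem g z h := ⟨h.2, by
    -- Applying `g⁻¹` to the image returns `z`, which lies in the chart.
    have := slAct_mul (g := g⁻¹) h.1 h.2
    rw [inv_mul_cancel, slAct_one h.1] at this
    change slAct g⁻¹ (slAct g z) ∈ chart
    rw [← this]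
    exact h.1⟩
  mul_act _ _ _ hz _ _ := slAct_mul hz.1 hz.2
  smooth := ⟨_, fun x => matAct x.1 x.2, isOpen_and_contDiffOn_matAct.1, isOpen_and_contDiffOn_matAct.2,
    fun _ _ h => ⟨h, rfl⟩⟩

/-- The formula for the action is differentiated at the identity matrix; only the velocity of the
curve enters, and trace zero turns `A₁₁` into `-A₀₀`. -/
theorem isGenerator_fieldOf (A : sl2) : IsGenerator chart slAct A (fieldOf A) := by
  intro c hc0 hc z hz
  obtain ⟨h0, h1, h2⟩ := hz
  have hA : A.1 1 1 = -A.1 0 0 := by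
    have : Matrix.trace A.1 = 0 := by
      simpa [LieAlgebra.SpecialLinear.sl] using A.2
    rw [Matrix.trace_fin_two] at this
    linarith
  have he : ∀ i j, HasDerivAt (fun ε => entries (c ε) i j) (A.1 i j) 0 := fun i j =>
    hasDerivAt_pi.1 (hasDerivAt_pi.1 hc i) j
  have v00 : entries (c 0) 0 0 = 1 := by simp [hc0, entries]
  have v01 : entries (c 0) 0 1 = 0 := by simp [hc0, entries]
  have v10 : entries (c 0) 1 0 = 0 := by simp [hc0, entries]
  have v11 : entries (c 0) 1 1 = 1 := by simp [hc0, entries]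
  have dX := ((he 1 0).mul_const (z 0 * z 2)).fun_add ((he 1 1).mul_const (z 0))
  have dY := ((he 0 0).mul_const (z 0 * z 2)).fun_add ((he 0 1).mul_const (z 0))
  have dq := ((he 0 0).mul_const (z 1)).fun_add
    ((he 0 1).mul_const ((1 + z 0 * z 1) / (z 0 * z 2)))
  rw [hasDerivAt_pi]
  intro i
  fin_cases i
  · refine dX.congr_deriv ?_
    simp [fieldOf, R₁, R₂, R₃, hA]; ring
  · refine dq.congr_deriv ?_
    simp [fieldOf, R₁, R₂, R₃]; ring
  · refine (dY.fun_div dX (by simp [v10, v11, h0.ne'])).congr_deriv ?_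
    simp [fieldOf, R₁, R₂, R₃, hA, v00, v01, v10, v11]
    field_simp
    ring
  · refine ((dY.const_mul (z 3 * z 1 / (z 0 * z 2))).fun_div dq
      (by simp [v00, v01, h1.ne'])).congr_deriv ?_
    simp [fieldOf, R₁, R₂, R₃, v00, v01]
    field_simp
    ring

end WaveLie

namespace WaveLie

/-! ### Linear ordinary differential equations -/

theorem hasDerivAt_intervalIntegral_of_continuousOn {E : Type*} [NormedAddCommGroup E]
    [NormedSpace ℝ E] [CompleteSpace E] {I : Set ℝ} (hI : IsOpen I) (hc : I.OrdConnected)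
    {f : ℝ → E} (hf : ContinuousOn f I) {t₀ t : ℝ} (h₀ : t₀ ∈ I) (ht : t ∈ I) :
    HasDerivAt (fun t => ∫ s in t₀..t, f s) (f t) t :=
  intervalIntegral.integral_hasDerivAt_right
    ((hf.mono (hc.uIcc_subset h₀ ht)).intervalIntegrable)
    (hf.stronglyMeasurableAtFilter hI t ht) (hf.continuousAt (hI.mem_nhds ht))

/-- A solution of a linear differential inequality that vanishes at one end vanishes. -/
theorem eq_zero_of_norm_deriv_le {E : Type*} [NormedAddCommGroup E] [NormedSpace ℝ E]
    {f f' : ℝ → E} {K : ℝ → ℝ} {a b : ℝ} (hf : ∀ t ∈ uIcc a b, HasDerivAt f (f' t) t)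
    (hK : ContinuousOn K (uIcc a b)) (hb : ∀ t ∈ uIcc a b, ‖f' t‖ ≤ K t * ‖f t‖) (h0 : f a = 0) :
    f b = 0 := by
  obtain ⟨C, hC⟩ := isCompact_uIcc.exists_bound_of_continuousOn hK
  have hb' : ∀ t ∈ uIcc a b, ‖f' t‖ ≤ C * ‖f t‖ := fun t ht =>
    (hb t ht).trans (mul_le_mul_of_nonneg_right ((le_abs_self _).trans (hC t ht)) (norm_nonneg _))
  rcases le_total a b with hab | hab
  · rw [uIcc_of_le hab] at *
    exact eq_zero_of_abs_deriv_le_mul_abs_self_of_eq_zero_right (f := f) (f' := f')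
      (fun t ht => (hf t ht).continuousAt.continuousWithinAt)
      (fun t ht => (hf t (Ico_subset_Icc_self ht)).hasDerivWithinAt) h0
      (fun t ht => hb' t (Ico_subset_Icc_self ht)) b (right_mem_Icc.2 hab)
  -- When `b ≤ a`, time is reversed to reduce to the forward estimate.
  · rw [uIcc_of_ge hab] at *
    have hm : ∀ t ∈ Icc (-a) (-b), -t ∈ Icc b a := fun t ht => ⟨by linarith [ht.2], by
      linarith [ht.1]⟩
    have hg : ∀ t ∈ Icc (-a) (-b), HasDerivAt (fun t => f (-t)) (-f' (-t)) t := fun t ht => by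
      simpa [Function.comp_def] using (hf (-t) (hm t ht)).scomp t (hasDerivAt_neg t)
    have := eq_zero_of_abs_deriv_le_mul_abs_self_of_eq_zero_right (f := fun t => f (-t))
      (f' := fun t => -f' (-t)) (K := C) (a := -a) (b := -b)
      (fun t ht => (hg t ht).continuousAt.continuousWithinAt)
      (fun t ht => (hg t (Ico_subset_Icc_self ht)).hasDerivWithinAt) (by simpa using h0)
      (fun t ht => by simpa using hb' (-t) (hm t (Ico_subset_Icc_self ht))) (-b)
      (right_mem_Icc.2 (by linarith))
    simpa using this

section Dyson

variable {E : Type*} [NormedAddCommGroup E] [NormedSpace ℝ E]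

/-- The terms of the series solving the linear equation `x' = T t x`, `x t₀ = x₀`. -/
noncomputable def dysonTerm (T : ℝ → E →L[ℝ] E) (t₀ : ℝ) (x₀ : E) : ℕ → ℝ → E
  | 0 => fun _ => x₀
  | n + 1 => fun t => ∫ s in t₀..t, T s (dysonTerm T t₀ x₀ n s)

variable {T : ℝ → E →L[ℝ] E} {I : Set ℝ} {t₀ : ℝ}

theorem continuousOn_dysonTerm [CompleteSpace E] (hI : IsOpen I) (hc : I.OrdConnected) (hT : ContinuousOn T I)
    (h₀ : t₀ ∈ I) (x₀ : E) (n : ℕ) : ContinuousOn (dysonTerm T t₀ x₀ n) I := by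
  induction n with
  | zero => exact continuousOn_const
  | succ n ih =>
    exact fun t ht => (hasDerivAt_intervalIntegral_of_continuousOn hI hc (hT.clm_apply ih) h₀
      ht).continuousAt.continuousWithinAt

/-- Each iterated integration raises the power of `|t - t₀|` by one and divides by the new exponent,
producing the factorial that makes the series converge on every compact subinterval. -/
theorem norm_dysonTerm_le {a b C : ℝ} (h₀ : t₀ ∈ Icc a b) (hC : ∀ t ∈ Icc a b, ‖T t‖ ≤ C) (x₀ : E)
    (n : ℕ) : ∀ t ∈ Icc a b,
      ‖dysonTerm T t₀ x₀ n t‖ ≤ ‖x₀‖ * (C * |t - t₀|) ^ n / n.factorial := by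
  have hC0 : 0 ≤ C := (norm_nonneg _).trans (hC _ h₀)
  induction n with
  | zero => intro t _; simp [dysonTerm]
  | succ n ih =>
    intro t ht
    have hsub : uIoc t₀ t ⊆ Icc a b := uIoc_subset_uIcc.trans (ordConnected_Icc.uIcc_subset h₀ ht)
    have h1 : ∀ s ∈ uIoc t₀ t, ‖T s (dysonTerm T t₀ x₀ n s)‖ ≤
        (C * (‖x₀‖ * C ^ n / n.factorial)) * |s - t₀| ^ n := by
      intro s hs
      refine ((T s).le_opNorm _).trans ?_
      calc ‖T s‖ * ‖dysonTerm T t₀ x₀ n s‖ ≤ C * (‖x₀‖ * (C * |s - t₀|) ^ n / n.factorial) :=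
            mul_le_mul (hC s (hsub hs)) (ih s (hsub hs)) (norm_nonneg _) hC0
        _ = _ := by rw [mul_pow]; ring
    have h2 : ‖∫ s in t₀..t, T s (dysonTerm T t₀ x₀ n s)‖ ≤
        |∫ s in t₀..t, (C * (‖x₀‖ * C ^ n / n.factorial)) * |s - t₀| ^ n| := by
      refine intervalIntegral.norm_integral_le_abs_of_norm_le (Filter.eventually_of_mem
        (MeasureTheory.self_mem_ae_restrict measurableSet_uIoc) h1) ?_
      exact (by fun_prop : Continuous fun s => (C * (‖x₀‖ * C ^ n / n.factorial)) *
        |s - t₀| ^ n).intervalIntegrable _ _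
    refine h2.trans ?_
    rw [intervalIntegral.integral_const_mul, abs_mul, abs_of_nonneg (by positivity),
      intervalIntegral.integral_comp_sub_right (fun s => |s| ^ n) t₀, sub_self]
    have h3 : |∫ s in (0:ℝ)..(t - t₀), |s| ^ n| = |t - t₀| ^ (n + 1) / (n + 1) := by
      have key : ∀ r : ℝ, 0 ≤ r → ∫ s in (0:ℝ)..r, |s| ^ n = r ^ (n + 1) / (n + 1) := by
        intro r hr
        rw [intervalIntegral.integral_congr (g := fun s => s ^ n), integral_pow]
        · simp
        · intro s hs
          rw [uIcc_of_le hr] at hs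
          simp [abs_of_nonneg hs.1]
      rcases le_total 0 (t - t₀) with h | h
      · rw [key _ h, abs_of_nonneg h, abs_of_nonneg (by positivity)]
      · have := intervalIntegral.integral_comp_neg (a := 0) (b := -(t - t₀)) (fun s => |s| ^ n)
        simp only [abs_neg, neg_neg, neg_zero] at this
        rw [key _ (by linarith), intervalIntegral.integral_symm] at this
        have h4 : ∫ s in (0:ℝ)..(t - t₀), |s| ^ n = -((-(t - t₀)) ^ (n + 1) / (n + 1)) := by
          linarith
        rw [h4, abs_neg, abs_of_nonpos h, abs_of_nonneg]
        have : 0 ≤ -(t - t₀) := by linarith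
        positivity
    rw [h3, Nat.factorial_succ]
    push_cast
    apply le_of_eq
    have : (n.factorial : ℝ) ≠ 0 := by positivity
    field_simp
    ring

/-- Linear equations with continuous coefficients on an open interval have global solutions. -/
theorem exists_linear_ode_solution [CompleteSpace E] (hI : IsOpen I) (hc : I.OrdConnected) (hT : ContinuousOn T I)
    (h₀ : t₀ ∈ I) (x₀ : E) :
    ∃ f : ℝ → E, f t₀ = x₀ ∧ ∀ t ∈ I, HasDerivAt f (T t (f t)) t := by
  refine ⟨fun t => ∑' n, dysonTerm T t₀ x₀ n t, ?_, ?_⟩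
  · change ∑' n, dysonTerm T t₀ x₀ n t₀ = x₀
    rw [tsum_eq_single 0]
    · rfl
    · intro n hn
      obtain ⟨m, rfl⟩ := Nat.exists_eq_succ_of_ne_zero hn
      simp [dysonTerm]
  intro t ht
  obtain ⟨a, b, hmem, hab⟩ : ∃ a b, t₀ ∈ Ioo a b ∧ t ∈ Ioo a b ∧ Icc a b ⊆ I := by
    have hmin : min t₀ t ∈ I := by rcases min_choice t₀ t with h | h <;> rw [h] <;> assumption
    have hmax : max t₀ t ∈ I := by rcases max_choice t₀ t with h | h <;> rw [h] <;> assumption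
    obtain ⟨ε, hε, h1⟩ := Metric.isOpen_iff.1 hI _ hmin
    obtain ⟨δ, hδ, h2⟩ := Metric.isOpen_iff.1 hI _ hmax
    -- A compact subinterval of `I` containing both times in its interior, so that the coefficient
    -- is bounded on it.
    refine ⟨min t₀ t - ε / 2, max t₀ t + δ / 2, ⟨?_, ?_⟩, ⟨?_, ?_⟩, hc.out (h1 ?_) (h2 ?_)⟩
    · linarith [min_le_left t₀ t]
    · linarith [le_max_left t₀ t]
    · linarith [min_le_right t₀ t]
    · linarith [le_max_right t₀ t]
    · rw [Metric.mem_ball, Real.dist_eq, abs_lt]; constructor <;> linarith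
    · rw [Metric.mem_ball, Real.dist_eq, abs_lt]; constructor <;> linarith
  obtain ⟨htab, hab⟩ := hab
  obtain ⟨C, hC⟩ := isCompact_Icc.exists_bound_of_continuousOn (hT.mono hab)
  have hC0 : 0 ≤ C := (norm_nonneg _).trans (hC _ (Ioo_subset_Icc_self hmem))
  have hbd := norm_dysonTerm_le (Ioo_subset_Icc_self hmem) hC x₀
  have hle : ∀ s ∈ Ioo a b, |s - t₀| ≤ b - a := fun s hs => by
    rw [abs_le]; constructor <;> linarith [hs.1, hs.2, hmem.1, hmem.2]
  have hbd' : ∀ n, ∀ s ∈ Ioo a b,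
      ‖dysonTerm T t₀ x₀ n s‖ ≤ ‖x₀‖ * (((C * (b - a)) ^ n) / n.factorial) := by
    intro n s hs
    refine (hbd n s (Ioo_subset_Icc_self hs)).trans ?_
    rw [← mul_div_assoc]
    have := hle s hs
    gcongr
  have hsum : Summable fun n : ℕ => ‖x₀‖ * (((C * (b - a)) ^ n) / n.factorial) :=
    (Real.summable_pow_div_factorial _).mul_left _
  -- Termwise derivatives, shifted by one index: the constant zeroth term contributes nothing, so
  -- the derivative series is `T` applied to the original one.
  let D : ℕ → ℝ → E := fun n s => match n with
    | 0 => 0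
    | n + 1 => T s (dysonTerm T t₀ x₀ n s)
  let U : ℕ → ℝ := fun n => match n with
    | 0 => 0
    | n + 1 => C * (‖x₀‖ * (((C * (b - a)) ^ n) / n.factorial))
  have hU : Summable U := (summable_nat_add_iff 1).1 (hsum.mul_left C)
  have hD : ∀ n, ∀ s ∈ Ioo a b, HasDerivAt (dysonTerm T t₀ x₀ n) (D n s) s := by
    intro n s hs
    cases n with
    | zero => exact hasDerivAt_const _ _
    | succ n =>
      exact hasDerivAt_intervalIntegral_of_continuousOn hI hc
        (hT.clm_apply (continuousOn_dysonTerm hI hc hT h₀ x₀ n)) h₀ (hab (Ioo_subset_Icc_self hs))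
  have hDU : ∀ n, ∀ s ∈ Ioo a b, ‖D n s‖ ≤ U n := by
    intro n s hs
    cases n with
    | zero => simp [D, U]
    | succ n =>
      exact ((T s).le_opNorm _).trans
        (mul_le_mul (hC s (Ioo_subset_Icc_self hs)) (hbd' n s hs) (norm_nonneg _) hC0)
  have hs0 : Summable fun n => dysonTerm T t₀ x₀ n t :=
    Summable.of_norm_bounded hsum fun n => hbd' n t htab
  have := hasDerivAt_tsum_of_isPreconnected hU isOpen_Ioo isPreconnected_Ioo hD hDU htab hs0 htab
  convert this using 1
  have hsD : Summable fun n => D n t := Summable.of_norm_bounded hU fun n => hDU n t htab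
  rw [hsD.tsum_eq_zero_add, (T t).map_tsum hs0]
  simp [D]

end Dyson

/-- Solutions of linear equations with smooth coefficients are smooth. -/
theorem contDiffOn_of_linear_ode {E : Type*} [NormedAddCommGroup E] [NormedSpace ℝ E]
    {T : ℝ → E →L[ℝ] E} {I : Set ℝ} (hI : IsOpen I) (hT : ContDiffOn ℝ ∞ T I) {f : ℝ → E}
    (hf : ∀ t ∈ I, HasDerivAt f (T t (f t)) t) : ContDiffOn ℝ ∞ f I := by
  rw [contDiffOn_infty]
  intro n
  induction n with
  | zero => exact contDiffOn_zero.2 fun t ht => (hf t ht).continuousAt.continuousWithinAt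
  | succ n ih =>
    push_cast
    rw [contDiffOn_succ_iff_deriv_of_isOpen hI]
    refine ⟨fun t ht => (hf t ht).differentiableAt.differentiableWithinAt, by simp, ?_⟩
    refine ContDiffOn.congr (f := fun t => T t (f t)) ?_ fun t ht => (hf t ht).deriv
    exact (hT.of_le (by exact_mod_cast le_top)).clm_apply ih

/-- Planar off-diagonal systems. -/
theorem exists_offdiagonal_ode_solution {I : Set ℝ} (hI : IsOpen I) (hc : I.OrdConnected)
    {m n : ℝ → ℝ} (hm : ContDiffOn ℝ ∞ m I) (hn : ContDiffOn ℝ ∞ n I) {t₀ : ℝ} (h₀ : t₀ ∈ I)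
    (a b : ℝ) : ∃ α β : ℝ → ℝ, ContDiffOn ℝ ∞ α I ∧ ContDiffOn ℝ ∞ β I ∧ α t₀ = a ∧ β t₀ = b ∧
      ∀ t ∈ I, HasDerivAt α (n t * β t) t ∧ HasDerivAt β (m t * α t) t := by
  let S₁ : ℝ × ℝ →L[ℝ] ℝ × ℝ := (ContinuousLinearMap.snd ℝ ℝ ℝ).prod 0
  let S₂ : ℝ × ℝ →L[ℝ] ℝ × ℝ := (0 : ℝ × ℝ →L[ℝ] ℝ).prod (ContinuousLinearMap.fst ℝ ℝ ℝ)
  let T : ℝ → ℝ × ℝ →L[ℝ] ℝ × ℝ := fun t => n t • S₁ + m t • S₂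
  have hT : ContDiffOn ℝ ∞ T I := (hn.smul contDiffOn_const).add (hm.smul contDiffOn_const)
  obtain ⟨f, hf0, hf⟩ := exists_linear_ode_solution hI hc hT.continuousOn h₀ (a, b)
  have hs := contDiffOn_of_linear_ode hI hT hf
  have hTa : ∀ t, T t (f t) = (n t * (f t).2, m t * (f t).1) := fun t => by simp [T, S₁, S₂]
  refine ⟨fun t => (f t).1, fun t => (f t).2, hs.fst, hs.snd, by simp [hf0], by simp [hf0],
    fun t ht => ?_⟩
  have h := hf t ht
  rw [hTa] at h
  exact ⟨h.fst, h.snd⟩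

end WaveLie

namespace WaveLie

/-! ### Calculus of partial derivatives -/

theorem two_le_infty : (2 : WithTop ℕ∞) ≤ ∞ :=
  show ((2 : ℕ∞) : WithTop ℕ∞) ≤ ((⊤ : ℕ∞) : WithTop ℕ∞) from WithTop.coe_le_coe.2 le_top

section Partial

variable {W : Set (ℝ × ℝ)} {f g : ℝ × ℝ → ℝ}

theorem contDiffOn_dx (hW : IsOpen W) (hf : ContDiffOn ℝ ∞ f W) : ContDiffOn ℝ ∞ (dx f) W :=
  (hf.fderiv_of_isOpen hW (by simp)).clm_apply contDiffOn_const

theorem contDiffOn_dy (hW : IsOpen W) (hf : ContDiffOn ℝ ∞ f W) : ContDiffOn ℝ ∞ (dy f) W :=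
  (hf.fderiv_of_isOpen hW (by simp)).clm_apply contDiffOn_const

theorem differentiableAt_of_contDiffOn (hW : IsOpen W) (hf : ContDiffOn ℝ ∞ f W) {r : ℝ × ℝ}
    (hr : r ∈ W) : DifferentiableAt ℝ f r :=
  (hf.contDiffAt (hW.mem_nhds hr)).differentiableAt (by simp)

theorem fderiv_apply_eq (f : ℝ × ℝ → ℝ) (r : ℝ × ℝ) (a b : ℝ) :
    fderiv ℝ f r (a, b) = dx f r * a + dy f r * b := by
  have : ((a, b) : ℝ × ℝ) = a • ((1, 0) : ℝ × ℝ) + b • ((0, 1) : ℝ × ℝ) := by simp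
  rw [this, map_add, map_smul, map_smul, dx, dy, smul_eq_mul, smul_eq_mul]
  ring

theorem hasDerivAt_comp_curve {a b : ℝ → ℝ} {a' b' t : ℝ} (hf : DifferentiableAt ℝ f (a t, b t))
    (ha : HasDerivAt a a' t) (hb : HasDerivAt b b' t) :
    HasDerivAt (fun t => f (a t, b t)) (dx f (a t, b t) * a' + dy f (a t, b t) * b') t := by
  rw [← fderiv_apply_eq]
  exact hf.hasFDerivAt.comp_hasDerivAt t (ha.prodMk hb)

theorem hasDerivAt_fst {x y : ℝ} (hf : DifferentiableAt ℝ f (x, y)) :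
    HasDerivAt (fun s => f (s, y)) (dx f (x, y)) x := by
  simpa using hasDerivAt_comp_curve (a := id) (b := fun _ => y) hf (hasDerivAt_id x)
    (hasDerivAt_const x y)

theorem hasDerivAt_snd {x y : ℝ} (hf : DifferentiableAt ℝ f (x, y)) :
    HasDerivAt (fun s => f (x, s)) (dy f (x, y)) y := by
  simpa using hasDerivAt_comp_curve (a := fun _ => x) (b := id) hf (hasDerivAt_const y x)
    (hasDerivAt_id y)

theorem dx_dy_comm (hW : IsOpen W) (hf : ContDiffOn ℝ ∞ f W) {r : ℝ × ℝ} (hr : r ∈ W) :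
    dx (dy f) r = dy (dx f) r := by
  have hc := hf.contDiffAt (hW.mem_nhds hr)
  have hs : IsSymmSndFDerivAt ℝ f r := hc.isSymmSndFDerivAt (by simpa using two_le_infty)
  have hd : DifferentiableAt ℝ (fderiv ℝ f) r :=
    (hc.fderiv_right (m := 1) (by rw [one_add_one_eq_two]; exact two_le_infty)).differentiableAt (by simp)
  have h := hs.eq (1, 0) (0, 1)
  have e : ∀ v w : ℝ × ℝ, fderiv ℝ (fun p => fderiv ℝ f p v) r w =
      fderiv ℝ (fderiv ℝ f) r w v := by
    intro v w
    rw [fderiv_clm_apply hd (differentiableAt_const _)]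
    simp
  change fderiv ℝ (fun p => fderiv ℝ f p (0, 1)) r (1, 0) =
    fderiv ℝ (fun p => fderiv ℝ f p (1, 0)) r (0, 1)
  rw [e, e, h]

theorem dy_congr (hW : IsOpen W) (h : EqOn f g W) {r : ℝ × ℝ} (hr : r ∈ W) : dy f r = dy g r := by
  rw [dy, dy, (h.eventuallyEq_of_mem (hW.mem_nhds hr)).fderiv_eq]

end Partial

/-! ### Inverses of immersions of intervals -/

theorem injOn_of_deriv_ne_zero {I : Set ℝ} (hc : I.OrdConnected) {f : ℝ → ℝ}
    (hf : ContinuousOn f I) (hd : ∀ t ∈ I, deriv f t ≠ 0) : InjOn f I := by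
  have key : ∀ a ∈ I, ∀ b ∈ I, f a = f b → ¬ a < b := by
    intro a ha b hb hab hlt
    obtain ⟨c, hc1, hc2⟩ := exists_deriv_eq_zero hlt (hf.mono (hc.out ha hb)) hab
    exact hd c (hc.out ha hb (Ioo_subset_Icc_self hc1)) hc2
  intro a ha b hb hab
  rcases lt_trichotomy a b with h | h | h
  · exact (key a ha b hb hab h).elim
  · exact h
  · exact (key b hb a ha hab.symm h).elim

/-- The inverse function theorem gives openness of the image and a smooth local inverse;
injectivity, from Rolle's theorem, identifies this with the global inverse. -/
theorem exists_smooth_inverse {I : Set ℝ} (hI : IsOpen I) (hc : I.OrdConnected) {f : ℝ → ℝ}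
    (hf : ContDiffOn ℝ ∞ f I) (hd : ∀ t ∈ I, deriv f t ≠ 0) :
    IsOpen (f '' I) ∧ (f '' I).OrdConnected ∧
      ∃ g : ℝ → ℝ, ContDiffOn ℝ ∞ g (f '' I) ∧ ∀ t ∈ I, g (f t) = t := by
  have hinj := injOn_of_deriv_ne_zero hc hf.continuousOn hd
  have hstrict : ∀ t ∈ I, HasStrictDerivAt f (deriv f t) t := fun t ht =>
    (hf.contDiffAt (hI.mem_nhds ht)).hasStrictDerivAt (by simp)
  refine ⟨?_, ?_, Function.invFunOn f I, ?_, fun t ht => hinj.leftInvOn_invFunOn ht⟩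
  · rw [isOpen_iff_mem_nhds]
    rintro _ ⟨t, ht, rfl⟩
    rw [← (hstrict t ht).map_nhds_eq (hd t ht)]
    exact Filter.image_mem_map (hI.mem_nhds ht)
  · exact ((isPreconnected_iff_ordConnected.2 hc).image f hf.continuousOn).ordConnected
  · rintro _ ⟨t, ht, rfl⟩
    have hfd := (hstrict t ht).hasDerivAt.hasFDerivAt_equiv (hd t ht)
    have hcd := hf.contDiffAt (hI.mem_nhds ht)
    have hl := hcd.to_localInverse hfd (by simp)
    refine ContDiffAt.contDiffWithinAt (hl.congr_of_eventuallyEq ?_)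
    have hstrict' := hcd.hasStrictFDerivAt' hfd (by simp)
    have h1 := hstrict'.eventually_right_inverse
    have h2 := hstrict'.localInverse_tendsto.eventually_mem (hI.mem_nhds ht)
    filter_upwards [h1, h2] with y hy1 hy2
    change _ = hstrict'.localInverse f _ t y
    conv_lhs => rw [← hy1]
    exact hinj.leftInvOn_invFunOn hy2

/-! ### A uniqueness lemma in the plane -/

section Hyperbolic

variable {E F : Type*} [NormedAddCommGroup E] [NormedSpace ℝ E] [NormedAddCommGroup F]
  [NormedSpace ℝ F]

/-- A Gronwall argument in two variables. On the triangle `s ≤ t` let `M` be the maximum of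
`e^{-l(t-s)} (‖X‖ + ‖Y‖)`. Integrating from the diagonal, in `t` for `X` and in `s` for `Y`, bounds
each by `(K M / l) e^{l(t-s)}`, hence `M ≤ 2 K M / l`, which forces `M = 0` for large `l`. -/
theorem eq_zero_of_hyperbolic_le_of_le {a b K : ℝ} {X X' : ℝ → ℝ → E} {Y Y' : ℝ → ℝ → F}
    (hXc : ContinuousOn (Function.uncurry X) (Icc a b ×ˢ Icc a b))
    (hYc : ContinuousOn (Function.uncurry Y) (Icc a b ×ˢ Icc a b))
    (hX : ∀ s ∈ Icc a b, ∀ t ∈ Icc a b, HasDerivAt (fun t => X s t) (X' s t) t)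
    (hY : ∀ s ∈ Icc a b, ∀ t ∈ Icc a b, HasDerivAt (fun s => Y s t) (Y' s t) s)
    (hXb : ∀ s ∈ Icc a b, ∀ t ∈ Icc a b, ‖X' s t‖ ≤ K * (‖X s t‖ + ‖Y s t‖))
    (hYb : ∀ s ∈ Icc a b, ∀ t ∈ Icc a b, ‖Y' s t‖ ≤ K * (‖X s t‖ + ‖Y s t‖))
    (hX0 : ∀ s ∈ Icc a b, X s s = 0) (hY0 : ∀ s ∈ Icc a b, Y s s = 0) (hK : 0 ≤ K) :
    ∀ s ∈ Icc a b, ∀ t ∈ Icc a b, s ≤ t → X s t = 0 ∧ Y s t = 0 := by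
  intro s hs t ht hst
  -- Any `l > 2 K` closes the estimate; the added one keeps `l` positive when `K = 0`.
  set l : ℝ := 4 * K + 1 with hl
  have hl0 : 0 < l := by positivity
  let T : Set (ℝ × ℝ) := (Icc a b ×ˢ Icc a b) ∩ {x | x.1 ≤ x.2}
  have hT : IsCompact T := (isCompact_Icc.prod isCompact_Icc).inter_right
    (isClosed_le continuous_fst continuous_snd)
  let N : ℝ × ℝ → ℝ := fun x =>
    Real.exp (-(l * (x.2 - x.1))) * (‖Function.uncurry X x‖ + ‖Function.uncurry Y x‖)
  have hN : ContinuousOn N T := ContinuousOn.mul (by fun_prop)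
    ((hXc.norm.add hYc.norm).mono inter_subset_left)
  obtain ⟨x₁, hx₁, hmax⟩ := hT.exists_isMaxOn ⟨(s, t), ⟨hs, ht⟩, hst⟩ hN
  set M := N x₁ with hM
  have hbd : ∀ s ∈ Icc a b, ∀ t ∈ Icc a b, s ≤ t →
      ‖X s t‖ + ‖Y s t‖ ≤ M * Real.exp (l * (t - s)) := by
    intro s hs t ht hst
    have h1 : N (s, t) ≤ M := hmax ⟨⟨hs, ht⟩, hst⟩
    have h2 : ‖X s t‖ + ‖Y s t‖ = N (s, t) * Real.exp (l * (t - s)) := by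
      simp only [N, Function.uncurry]
      rw [mul_right_comm, ← Real.exp_add]
      simp
    rw [h2]
    gcongr
  have hXs : ∀ s ∈ Icc a b, ∀ t ∈ Icc a b, s ≤ t →
      ‖X s t‖ ≤ K * M / l * Real.exp (l * (t - s)) := by
    intro s hs t ht hst
    have hsub : ∀ τ ∈ Icc s t, τ ∈ Icc a b := fun τ hτ => ⟨hs.1.trans hτ.1, hτ.2.trans ht.2⟩
    have hB : ∀ τ, HasDerivAt (fun τ => K * M / l * Real.exp (l * (τ - s)))
        (K * M * Real.exp (l * (τ - s))) τ := by
      intro τ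
      have := ((((hasDerivAt_id τ).sub_const s).const_mul l).exp).const_mul (K * M / l)
      refine this.congr_deriv ?_
      simp
      field_simp
    refine image_norm_le_of_norm_deriv_right_le_deriv_boundary (f := fun τ => X s τ)
      (f' := fun τ => X' s τ)
      (fun τ hτ => (hX s hs τ (hsub τ hτ)).continuousAt.continuousWithinAt)
      (fun τ hτ => (hX s hs τ (hsub τ (Ico_subset_Icc_self hτ))).hasDerivWithinAt)
      (by simp only [hX0 s hs, norm_zero]; positivity) hB ?_ (right_mem_Icc.2 hst)
    intro τ hτ
    have hτ' := hsub τ (Ico_subset_Icc_self hτ)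
    refine (hXb s hs τ hτ').trans ?_
    rw [mul_assoc]
    exact mul_le_mul_of_nonneg_left (hbd s hs τ hτ' hτ.1) hK
  have hYs : ∀ s ∈ Icc a b, ∀ t ∈ Icc a b, s ≤ t →
      ‖Y s t‖ ≤ K * M / l * Real.exp (l * (t - s)) := by
    intro s hs t ht hst
    -- `Y` is integrated from the diagonal point `(t, t)` down to `s`, so the variable is replaced
    -- by its negative.
    have hsub : ∀ τ ∈ Icc (-t) (-s), -τ ∈ Icc a b := fun τ hτ =>
      ⟨by linarith [hτ.2, hs.1], by linarith [hτ.1, ht.2]⟩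
    have hB : ∀ τ, HasDerivAt (fun τ => K * M / l * Real.exp (l * (t + τ)))
        (K * M * Real.exp (l * (t + τ))) τ := by
      intro τ
      have := ((((hasDerivAt_id τ).const_add t).const_mul l).exp).const_mul (K * M / l)
      refine this.congr_deriv ?_
      simp
      field_simp
    have hd : ∀ τ ∈ Icc (-t) (-s), HasDerivAt (fun τ => Y (-τ) t) (-Y' (-τ) t) τ := fun τ hτ => by
      simpa [Function.comp_def] using (hY (-τ) (hsub τ hτ) t ht).scomp τ (hasDerivAt_neg τ)
    have := image_norm_le_of_norm_deriv_right_le_deriv_boundary (f := fun τ => Y (-τ) t)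
      (f' := fun τ => -Y' (-τ) t)
      (fun τ hτ => (hd τ hτ).continuousAt.continuousWithinAt)
      (fun τ hτ => (hd τ (Ico_subset_Icc_self hτ)).hasDerivWithinAt)
      (by simp only [neg_neg, hY0 t ht, norm_zero]; positivity) hB ?_
      (right_mem_Icc.2 (neg_le_neg hst))
    · simpa [sub_eq_add_neg] using this
    intro τ hτ
    have hτ' := hsub τ (Ico_subset_Icc_self hτ)
    rw [norm_neg]
    refine (hYb (-τ) hτ' t ht).trans ?_
    rw [mul_assoc]
    have := hbd (-τ) hτ' t ht (by linarith [hτ.1])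
    rw [sub_neg_eq_add] at this
    exact mul_le_mul_of_nonneg_left this hK
  have hMle : M ≤ 0 := by
    obtain ⟨⟨h1, h2⟩, h3⟩ := hx₁
    have hx := hXs _ h1 _ h2 h3
    have hy := hYs _ h1 _ h2 h3
    have e : M = Real.exp (-(l * (x₁.2 - x₁.1))) * (‖X x₁.1 x₁.2‖ + ‖Y x₁.1 x₁.2‖) := rfl
    have h4 : M ≤ Real.exp (-(l * (x₁.2 - x₁.1))) *
        (2 * (K * M / l * Real.exp (l * (x₁.2 - x₁.1)))) := by
      rw [e]
      gcongr
      rw [← e]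
      linarith
    have h5 : Real.exp (-(l * (x₁.2 - x₁.1))) *
        (2 * (K * M / l * Real.exp (l * (x₁.2 - x₁.1)))) = 2 * K * M / l := by
      rw [Real.exp_neg]
      field_simp
    rw [h5, le_div_iff₀ hl0] at h4
    nlinarith
  have h := hbd s hs t ht hst
  have h0 : M * Real.exp (l * (t - s)) ≤ 0 := mul_nonpos_of_nonpos_of_nonneg hMle (by positivity)
  have hx := norm_nonneg (X s t)
  have hy := norm_nonneg (Y s t)
  exact ⟨norm_eq_zero.1 (by linarith), norm_eq_zero.1 (by linarith)⟩

/-- Uniqueness for linear hyperbolic inequalities on a square, with zero data on the diagonal. -/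
theorem eq_zero_of_hyperbolic_le {a b K : ℝ} {X X' : ℝ → ℝ → E} {Y Y' : ℝ → ℝ → F}
    (hXc : ContinuousOn (Function.uncurry X) (Icc a b ×ˢ Icc a b))
    (hYc : ContinuousOn (Function.uncurry Y) (Icc a b ×ˢ Icc a b))
    (hX : ∀ s ∈ Icc a b, ∀ t ∈ Icc a b, HasDerivAt (fun t => X s t) (X' s t) t)
    (hY : ∀ s ∈ Icc a b, ∀ t ∈ Icc a b, HasDerivAt (fun s => Y s t) (Y' s t) s)
    (hXb : ∀ s ∈ Icc a b, ∀ t ∈ Icc a b, ‖X' s t‖ ≤ K * (‖X s t‖ + ‖Y s t‖))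
    (hYb : ∀ s ∈ Icc a b, ∀ t ∈ Icc a b, ‖Y' s t‖ ≤ K * (‖X s t‖ + ‖Y s t‖))
    (hX0 : ∀ s ∈ Icc a b, X s s = 0) (hY0 : ∀ s ∈ Icc a b, Y s s = 0) (hK : 0 ≤ K) :
    ∀ s ∈ Icc a b, ∀ t ∈ Icc a b, X s t = 0 ∧ Y s t = 0 := by
  intro s hs t ht
  rcases le_total s t with hst | hst
  · exact eq_zero_of_hyperbolic_le_of_le hXc hYc hX hY hXb hYb hX0 hY0 hK s hs t ht hst
  -- The triangle `t ≤ s` is the image of the other one under `(s, t) ↦ (-s, -t)`.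
  have hm : ∀ τ ∈ Icc (-b) (-a), -τ ∈ Icc a b := fun τ hτ =>
    ⟨by linarith [hτ.2], by linarith [hτ.1]⟩
  have hcm : ContinuousOn (fun x : ℝ × ℝ => (-x.1, -x.2)) (Icc (-b) (-a) ×ˢ Icc (-b) (-a)) := by
    fun_prop
  have := eq_zero_of_hyperbolic_le_of_le (a := -b) (b := -a) (K := K)
    (X := fun s t => X (-s) (-t)) (X' := fun s t => -X' (-s) (-t))
    (Y := fun s t => Y (-s) (-t)) (Y' := fun s t => -Y' (-s) (-t))
    (hXc.comp hcm fun x hx => ⟨hm _ hx.1, hm _ hx.2⟩)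
    (hYc.comp hcm fun x hx => ⟨hm _ hx.1, hm _ hx.2⟩)
    (fun s hs t ht => by
      simpa [Function.comp_def] using
        (hX (-s) (hm s hs) (-t) (hm t ht)).scomp t (hasDerivAt_neg t))
    (fun s hs t ht => by
      simpa [Function.comp_def] using
        (hY (-s) (hm s hs) (-t) (hm t ht)).scomp s (hasDerivAt_neg s))
    (fun s hs t ht => by simpa using hXb (-s) (hm s hs) (-t) (hm t ht))
    (fun s hs t ht => by simpa using hYb (-s) (hm s hs) (-t) (hm t ht))
    (fun s hs => hX0 _ (hm s hs)) (fun s hs => hY0 _ (hm s hs)) hK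
    (-s) ⟨by linarith [hs.2], by linarith [hs.1]⟩ (-t) ⟨by linarith [ht.2], by linarith [ht.1]⟩
    (by linarith)
  simpa using this

end Hyperbolic

end WaveLie

namespace WaveLie

namespace CauchyData

variable (C : CauchyData)

/-! ### The one-jet along the curve -/

theorem hasDerivAt_p {t : ℝ} (ht : t ∈ C.I) : HasDerivAt C.p (deriv C.p t) t :=
  ((C.smooth_p.contDiffAt (C.isOpen_I.mem_nhds ht)).differentiableAt (by simp)).hasDerivAt

theorem hasDerivAt_q {t : ℝ} (ht : t ∈ C.I) : HasDerivAt C.q (deriv C.q t) t :=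
  ((C.smooth_q.contDiffAt (C.isOpen_I.mem_nhds ht)).differentiableAt (by simp)).hasDerivAt

theorem pt_mem_curve {t : ℝ} (ht : t ∈ C.I) : C.pt t ∈ C.curve := ⟨t, ht, rfl⟩

/-- A unit vector orthogonal to the nonzero tangent is independent of it, so value and normal
derivative determine the full one-jet along `γ`. -/
theorem lift_det_ne_zero {t : ℝ} (ht : t ∈ C.I) :
    deriv C.p t * C.n₂ t - deriv C.q t * C.n₁ t ≠ 0 := by
  intro h
  have h1 := C.unit_n t ht
  have h2 := C.normal_n t ht
  apply C.p_deriv t ht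
  linear_combination (-deriv C.p t) * h1 + C.n₂ t * h + C.n₁ t * h2

theorem lift_tangent (φ ψ : ℝ → ℝ) {t : ℝ} (ht : t ∈ C.I) :
    C.liftX φ ψ t * deriv C.p t + C.liftY φ ψ t * deriv C.q t = deriv φ t := by
  have := C.lift_det_ne_zero ht
  rw [liftX, liftY, div_mul_eq_mul_div, div_mul_eq_mul_div, ← add_div, div_eq_iff this]
  ring

theorem lift_normal (φ ψ : ℝ → ℝ) {t : ℝ} (ht : t ∈ C.I) :
    C.liftX φ ψ t * C.n₁ t + C.liftY φ ψ t * C.n₂ t = ψ t := by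
  have := C.lift_det_ne_zero ht
  rw [liftX, liftY, div_mul_eq_mul_div, div_mul_eq_mul_div, ← add_div, div_eq_iff this]
  ring

theorem Attains.partials {C : CauchyData} {W : Set (ℝ × ℝ)} (hW : IsOpen W) (hCW : C.curve ⊆ W)
    {f : ℝ × ℝ → ℝ} (hf : ContDiffOn ℝ ∞ f W) {φ ψ : ℝ → ℝ} (h : C.Attains f φ ψ) {t : ℝ}
    (ht : t ∈ C.I) : dx f (C.pt t) = C.liftX φ ψ t ∧ dy f (C.pt t) = C.liftY φ ψ t := by
  have hdet := C.lift_det_ne_zero ht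
  have h1 := hasDerivAt_comp_curve (differentiableAt_of_contDiffOn hW hf
    (hCW (C.pt_mem_curve ht))) (C.hasDerivAt_p ht) (C.hasDerivAt_q ht)
  have h2 : (fun t => f (C.p t, C.q t)) =ᶠ[nhds t] φ := by
    filter_upwards [C.isOpen_I.mem_nhds ht] with s hs
    exact (h s hs).1
  have h3 := h1.deriv
  rw [h2.deriv_eq] at h3
  have h4 := (h t ht).2
  rw [fderiv_apply_eq] at h4
  rw [liftX, liftY, eq_div_iff hdet, eq_div_iff hdet, h3, ← h4]
  simp only [pt]
  constructor <;> ring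

theorem attains_of_partials {f : ℝ × ℝ → ℝ} {φ ψ : ℝ → ℝ}
    (h : ∀ t ∈ C.I, f (C.pt t) = φ t ∧ dx f (C.pt t) = C.liftX φ ψ t ∧
      dy f (C.pt t) = C.liftY φ ψ t) : C.Attains f φ ψ := by
  intro t ht
  obtain ⟨h1, h2, h3⟩ := h t ht
  exact ⟨h1, by rw [fderiv_apply_eq, h2, h3, C.lift_normal φ ψ ht]⟩

end CauchyData

/-! ### Uniqueness for the Cauchy problem -/

/-- The right-hand side of each equation of the system, solved for the mixed derivative. -/
noncomputable def mixedRhs (z : ℝ × ℝ × ℝ × ℝ) : ℝ :=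
  -(z.2.2.1 * z.2.2.2) / (2 * (1 + Real.exp (z.1 / 2 + z.2.1 / 2)))

theorem contDiff_mixedRhs : ContDiff ℝ 1 mixedRhs := by
  unfold mixedRhs
  refine ContDiff.div (by fun_prop) (by fun_prop) fun z => ?_
  positivity

theorem SolvesSystem.mixed {W : Set (ℝ × ℝ)} {u v : ℝ × ℝ → ℝ} (h : SolvesSystem W u v)
    {r : ℝ × ℝ} (hr : r ∈ W) : dy (dx u) r = mixedRhs (u r, v r, dx u r, dy u r) ∧
      dy (dx v) r = mixedRhs (u r, v r, dx v r, dy v r) := by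
  obtain ⟨h1, h2⟩ := h r hr
  simp only [mixedRhs, neg_div]
  constructor <;> linarith

/-- In the parameters `(s, t)` the unknowns are split by transport direction: `u, v, u_x, v_x` are
propagated in `t`, and `u_y, v_y` in `s`. Local Lipschitz continuity of the right-hand side makes
the differences satisfy the inequality of `eq_zero_of_hyperbolic_le`. -/
theorem CauchyData.IsSolution.eq_of_square {C : CauchyData} {W : Set (ℝ × ℝ)} (hW : IsOpen W)
    (hCW : C.curve ⊆ W) {u v u' v' : ℝ × ℝ → ℝ} (h : C.IsSolution W u v)
    (h' : C.IsSolution W u' v') {a b : ℝ} (hab : Icc a b ⊆ C.I)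
    (hsq : ∀ s ∈ Icc a b, ∀ t ∈ Icc a b, (C.p s, C.q t) ∈ W) :
    ∀ s ∈ Icc a b, ∀ t ∈ Icc a b, u' (C.p s, C.q t) = u (C.p s, C.q t) ∧
      v' (C.p s, C.q t) = v (C.p s, C.q t) := by
  obtain ⟨hu, hv, hsys, hau, hav⟩ := h
  obtain ⟨hu', hv', hsys', hau', hav'⟩ := h'
  let Q : Set (ℝ × ℝ) := Icc a b ×ˢ Icc a b
  have hQ : IsCompact Q := isCompact_Icc.prod isCompact_Icc
  have hmap : ContinuousOn (fun x : ℝ × ℝ => (C.p x.1, C.q x.2)) Q :=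
    ((C.smooth_p.continuousOn.mono hab).comp continuousOn_fst fun x hx => hx.1).prodMk
      ((C.smooth_q.continuousOn.mono hab).comp continuousOn_snd fun x hx => hx.2)
  have hcont : ∀ {f : ℝ × ℝ → ℝ}, ContDiffOn ℝ ∞ f W →
      ContinuousOn (fun x : ℝ × ℝ => f (C.p x.1, C.q x.2)) Q := fun hf =>
    hf.continuousOn.comp hmap fun x hx => hsq _ hx.1 _ hx.2
  have hds : ∀ {f : ℝ × ℝ → ℝ}, ContDiffOn ℝ ∞ f W → ∀ s ∈ Icc a b, ∀ t ∈ Icc a b,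
      HasDerivAt (fun s => f (C.p s, C.q t)) (dx f (C.p s, C.q t) * deriv C.p s) s := by
    intro f hf s hs t ht
    simpa using hasDerivAt_comp_curve (b := fun _ => C.q t)
      (differentiableAt_of_contDiffOn hW hf (hsq s hs t ht)) (C.hasDerivAt_p (hab hs))
      (hasDerivAt_const s _)
  have hdt : ∀ {f : ℝ × ℝ → ℝ}, ContDiffOn ℝ ∞ f W → ∀ s ∈ Icc a b, ∀ t ∈ Icc a b,
      HasDerivAt (fun t => f (C.p s, C.q t)) (dy f (C.p s, C.q t) * deriv C.q t) t := by
    intro f hf s hs t ht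
    simpa using hasDerivAt_comp_curve (a := fun _ => C.p s)
      (differentiableAt_of_contDiffOn hW hf (hsq s hs t ht)) (hasDerivAt_const t _)
      (C.hasDerivAt_q (hab ht))
  have hx {f : ℝ × ℝ → ℝ} (hf : ContDiffOn ℝ ∞ f W) := contDiffOn_dx hW hf
  have hy {f : ℝ × ℝ → ℝ} (hf : ContDiffOn ℝ ∞ f W) := contDiffOn_dy hW hf
  obtain ⟨Kp, hKp⟩ := isCompact_Icc.exists_bound_of_continuousOn
    (f := deriv C.p) ((C.smooth_p.continuousOn_deriv_of_isOpen C.isOpen_I (by simp)).mono hab)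
  obtain ⟨Kq, hKq⟩ := isCompact_Icc.exists_bound_of_continuousOn
    (f := deriv C.q) ((C.smooth_q.continuousOn_deriv_of_isOpen C.isOpen_I (by simp)).mono hab)
  let J (u v f : ℝ × ℝ → ℝ) (x : ℝ × ℝ) : ℝ × ℝ × ℝ × ℝ := (u (C.p x.1, C.q x.2),
    v (C.p x.1, C.q x.2), dx f (C.p x.1, C.q x.2), dy f (C.p x.1, C.q x.2))
  have hJ : ∀ {u v f : ℝ × ℝ → ℝ}, ContDiffOn ℝ ∞ u W → ContDiffOn ℝ ∞ v W →
      ContDiffOn ℝ ∞ f W → ∃ R, ∀ x ∈ Q, ‖J u v f x‖ ≤ R := fun hu hv hf =>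
    hQ.exists_bound_of_continuousOn
      ((hcont hu).prodMk ((hcont hv).prodMk ((hcont (hx hf)).prodMk (hcont (hy hf)))))
  obtain ⟨R1, hR1⟩ := hJ hu hv hu
  obtain ⟨R2, hR2⟩ := hJ hu hv hv
  obtain ⟨R3, hR3⟩ := hJ hu' hv' hu'
  obtain ⟨R4, hR4⟩ := hJ hu' hv' hv'
  let R := max (max R1 R2) (max R3 R4)
  -- One ball containing the values of all four jets on the square; its convexity and compactness
  -- provide a common Lipschitz constant.
  obtain ⟨L, hL⟩ := contDiff_mixedRhs.contDiffOn.exists_lipschitzOnWith (by simp)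
    (convex_closedBall (0 : ℝ × ℝ × ℝ × ℝ) R) (isCompact_closedBall _ _)
  let X (s t : ℝ) : ℝ × ℝ × ℝ × ℝ := (u (C.p s, C.q t) - u' (C.p s, C.q t),
    v (C.p s, C.q t) - v' (C.p s, C.q t), dx u (C.p s, C.q t) - dx u' (C.p s, C.q t),
    dx v (C.p s, C.q t) - dx v' (C.p s, C.q t))
  let Y (s t : ℝ) : ℝ × ℝ := (dy u (C.p s, C.q t) - dy u' (C.p s, C.q t),
    dy v (C.p s, C.q t) - dy v' (C.p s, C.q t))
  let Du (s t : ℝ) := dy (dx u) (C.p s, C.q t) - dy (dx u') (C.p s, C.q t)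
  let Dv (s t : ℝ) := dy (dx v) (C.p s, C.q t) - dy (dx v') (C.p s, C.q t)
  let X' (s t : ℝ) : ℝ × ℝ × ℝ × ℝ := deriv C.q t • ((Y s t).1, (Y s t).2, Du s t, Dv s t)
  let Y' (s t : ℝ) : ℝ × ℝ := deriv C.p s • (Du s t, Dv s t)
  have hX1 : ∀ s t, |(X s t).1| ≤ ‖X s t‖ := fun s t => norm_fst_le (X s t)
  have hX2 : ∀ s t, |(X s t).2.1| ≤ ‖X s t‖ := fun s t =>
    (norm_fst_le (X s t).2).trans (norm_snd_le (X s t))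
  have hX3 : ∀ s t, |(X s t).2.2.1| ≤ ‖X s t‖ := fun s t =>
    (norm_fst_le (X s t).2.2).trans ((norm_snd_le (X s t).2).trans (norm_snd_le (X s t)))
  have hX4 : ∀ s t, |(X s t).2.2.2| ≤ ‖X s t‖ := fun s t =>
    (norm_snd_le (X s t).2.2).trans ((norm_snd_le (X s t).2).trans (norm_snd_le (X s t)))
  have hY1 : ∀ s t, |(Y s t).1| ≤ ‖Y s t‖ := fun s t => norm_fst_le (Y s t)
  have hY2 : ∀ s t, |(Y s t).2| ≤ ‖Y s t‖ := fun s t => norm_snd_le (Y s t)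
  have hDu : ∀ s ∈ Icc a b, ∀ t ∈ Icc a b, |Du s t| ≤ L * (‖X s t‖ + ‖Y s t‖) := by
    intro s hs t ht
    have e : Du s t = mixedRhs (J u v u (s, t)) - mixedRhs (J u' v' u' (s, t)) := by
      simp only [Du, J, (hsys.mixed (hsq s hs t ht)).1, (hsys'.mixed (hsq s hs t ht)).1]
    have hl := hL.norm_sub_le (x := J u v u (s, t)) (y := J u' v' u' (s, t))
      (mem_closedBall_zero_iff.2 ((hR1 (s, t) ⟨hs, ht⟩).trans
        ((le_max_left _ _).trans (le_max_left _ _))))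
      (mem_closedBall_zero_iff.2 ((hR3 (s, t) ⟨hs, ht⟩).trans
        ((le_max_left _ _).trans (le_max_right _ _))))
    rw [← e] at hl
    refine hl.trans (mul_le_mul_of_nonneg_left ?_ L.2)
    have a1 := hX1 s t
    have a2 := hX2 s t
    have a3 := hX3 s t
    have a4 := hY1 s t
    have n1 := norm_nonneg (X s t)
    have n2 := norm_nonneg (Y s t)
    exact norm_prod_le_iff.2 ⟨a1.trans (by linarith), norm_prod_le_iff.2 ⟨a2.trans (by linarith),
      norm_prod_le_iff.2 ⟨a3.trans (by linarith), a4.trans (by linarith)⟩⟩⟩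
  have hDv : ∀ s ∈ Icc a b, ∀ t ∈ Icc a b, |Dv s t| ≤ L * (‖X s t‖ + ‖Y s t‖) := by
    intro s hs t ht
    have e : Dv s t = mixedRhs (J u v v (s, t)) - mixedRhs (J u' v' v' (s, t)) := by
      simp only [Dv, J, (hsys.mixed (hsq s hs t ht)).2, (hsys'.mixed (hsq s hs t ht)).2]
    have hl := hL.norm_sub_le (x := J u v v (s, t)) (y := J u' v' v' (s, t))
      (mem_closedBall_zero_iff.2 ((hR2 (s, t) ⟨hs, ht⟩).trans
        ((le_max_right _ _).trans (le_max_left _ _))))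
      (mem_closedBall_zero_iff.2 ((hR4 (s, t) ⟨hs, ht⟩).trans
        ((le_max_right _ _).trans (le_max_right _ _))))
    rw [← e] at hl
    refine hl.trans (mul_le_mul_of_nonneg_left ?_ L.2)
    have a1 := hX1 s t
    have a2 := hX2 s t
    have a3 := hX4 s t
    have a4 := hY2 s t
    have n1 := norm_nonneg (X s t)
    have n2 := norm_nonneg (Y s t)
    exact norm_prod_le_iff.2 ⟨a1.trans (by linarith), norm_prod_le_iff.2 ⟨a2.trans (by linarith),
      norm_prod_le_iff.2 ⟨a3.trans (by linarith), a4.trans (by linarith)⟩⟩⟩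
  let K : ℝ := max 0 (max Kp Kq) * (L + 1)
  have hK0 : (0 : ℝ) ≤ max 0 (max Kp Kq) := le_max_left _ _
  -- On the diagonal both solutions have the one-jet dictated by the data.
  have hdiag : ∀ s ∈ Icc a b, X s s = 0 ∧ Y s s = 0 := by
    intro s hs
    have hsI := hab hs
    obtain ⟨ux, uy⟩ := hau.partials hW hCW hu hsI
    obtain ⟨vx, vy⟩ := hav.partials hW hCW hv hsI
    obtain ⟨ux', uy'⟩ := hau'.partials hW hCW hu' hsI
    obtain ⟨vx', vy'⟩ := hav'.partials hW hCW hv' hsI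
    have e1 := (hau s hsI).1
    have e2 := (hav s hsI).1
    have e3 := (hau' s hsI).1
    have e4 := (hav' s hsI).1
    simp only [CauchyData.pt] at *
    simp only [X, Y, ux, uy, vx, vy, ux', uy', vx', vy', e1, e2, e3, e4, sub_self]
    exact ⟨rfl, rfl⟩
  have main := eq_zero_of_hyperbolic_le (a := a) (b := b) (K := K) (X := X) (X' := X') (Y := Y)
    (Y' := Y')
    (((hcont hu).sub (hcont hu')).prodMk (((hcont hv).sub (hcont hv')).prodMk
      (((hcont (hx hu)).sub (hcont (hx hu'))).prodMk ((hcont (hx hv)).sub (hcont (hx hv'))))))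
    (((hcont (hy hu)).sub (hcont (hy hu'))).prodMk ((hcont (hy hv)).sub (hcont (hy hv'))))
    (by
      intro s hs t ht
      refine (((hdt hu s hs t ht).sub (hdt hu' s hs t ht)).prodMk
        (((hdt hv s hs t ht).sub (hdt hv' s hs t ht)).prodMk
        (((hdt (hx hu) s hs t ht).sub (hdt (hx hu') s hs t ht)).prodMk
        ((hdt (hx hv) s hs t ht).sub (hdt (hx hv') s hs t ht))))).congr_deriv ?_
      simp only [X', Y, Du, Dv, Prod.smul_mk, smul_eq_mul]
      refine Prod.ext ?_ (Prod.ext ?_ (Prod.ext ?_ ?_)) <;> simp only <;> ring)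
    (by
      intro s hs t ht
      refine (((hds (hy hu) s hs t ht).sub (hds (hy hu') s hs t ht)).prodMk
        ((hds (hy hv) s hs t ht).sub (hds (hy hv') s hs t ht))).congr_deriv ?_
      simp only [Y', Du, Dv, Prod.smul_mk, smul_eq_mul]
      have hm := hsq s hs t ht
      rw [dx_dy_comm hW hu hm, dx_dy_comm hW hu' hm, dx_dy_comm hW hv hm, dx_dy_comm hW hv' hm]
      refine Prod.ext ?_ ?_ <;> simp only <;> ring)
    (by
      intro s hs t ht
      have n1 := norm_nonneg (X s t)
      have n2 := norm_nonneg (Y s t)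
      have h1 := hDu s hs t ht
      have h2 := hDv s hs t ht
      have h3 : 0 ≤ (L : ℝ) * (‖X s t‖ + ‖Y s t‖) := mul_nonneg L.2 (by linarith)
      simp only [X', norm_smul, K, mul_assoc]
      refine mul_le_mul ((hKq t ht).trans ((le_max_right _ _).trans (le_max_right _ _))) ?_
        (norm_nonneg _) hK0
      have a1 := hY1 s t
      have a2 := hY2 s t
      exact norm_prod_le_iff.2 ⟨a1.trans (by linarith), norm_prod_le_iff.2 ⟨a2.trans (by linarith),
        norm_prod_le_iff.2 ⟨h1.trans (by linarith), h2.trans (by linarith)⟩⟩⟩)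
    (by
      intro s hs t ht
      have n1 := norm_nonneg (X s t)
      have n2 := norm_nonneg (Y s t)
      have h1 := hDu s hs t ht
      have h2 := hDv s hs t ht
      have h3 : 0 ≤ (L : ℝ) * (‖X s t‖ + ‖Y s t‖) := mul_nonneg L.2 (by linarith)
      simp only [Y', norm_smul, K, mul_assoc]
      refine mul_le_mul ((hKp s hs).trans ((le_max_left _ _).trans (le_max_right _ _))) ?_
        (norm_nonneg _) hK0
      exact norm_prod_le_iff.2 ⟨h1.trans (by linarith), h2.trans (by linarith)⟩)
    (fun s hs => (hdiag s hs).1) (fun s hs => (hdiag s hs).2)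
    (mul_nonneg hK0 (by positivity))
  intro s hs t ht
  have h0 := (main s hs t ht).1
  have h1 : (X s t).1 = 0 := by rw [h0]; rfl
  have h2 : (X s t).2.1 = 0 := by rw [h0]; rfl
  exact ⟨(sub_eq_zero.1 h1).symm, (sub_eq_zero.1 h2).symm⟩

end WaveLie

namespace WaveLie

/-! ### Solutions from products of one-variable matrices -/

theorem dx_eq_of_hasDerivAt {f : ℝ × ℝ → ℝ} {x y d : ℝ} (hf : DifferentiableAt ℝ f (x, y))
    (h : HasDerivAt (fun s => f (s, y)) d x) : dx f (x, y) = d :=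
  (hasDerivAt_fst hf).unique h

theorem dy_eq_of_hasDerivAt {f : ℝ × ℝ → ℝ} {x y d : ℝ} (hf : DifferentiableAt ℝ f (x, y))
    (h : HasDerivAt (fun s => f (x, s)) d y) : dy f (x, y) = d :=
  (hasDerivAt_snd hf).unique h

/-- The entries of `g = !![A, P; Q, B] ∈ SL(2, ℝ)` depend smoothly on `(x, y) ∈ S ×ˢ T`, and
`g_x = !![0, l₁; l₂, 0] * g`, `g_y = g * !![0, m₁; m₂, 0]`. -/
structure IsLoopSolution (S T : Set ℝ) (A P Q B : ℝ × ℝ → ℝ) (l₁ l₂ m₁ m₂ : ℝ → ℝ) : Prop where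
  smooth_A : ContDiffOn ℝ ∞ A (S ×ˢ T)
  smooth_P : ContDiffOn ℝ ∞ P (S ×ˢ T)
  smooth_Q : ContDiffOn ℝ ∞ Q (S ×ˢ T)
  smooth_B : ContDiffOn ℝ ∞ B (S ×ˢ T)
  smooth_m₁ : ContDiffOn ℝ ∞ m₁ T
  det : ∀ r ∈ S ×ˢ T, A r * B r = 1 + P r * Q r
  dx_A : ∀ r ∈ S ×ˢ T, dx A r = l₁ r.1 * Q r
  dx_P : ∀ r ∈ S ×ˢ T, dx P r = l₁ r.1 * B r
  dx_Q : ∀ r ∈ S ×ˢ T, dx Q r = l₂ r.1 * A r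
  dy_A : ∀ r ∈ S ×ˢ T, dy A r = m₂ r.2 * P r
  dy_P : ∀ r ∈ S ×ˢ T, dy P r = m₁ r.2 * A r
  dy_Q : ∀ r ∈ S ×ˢ T, dy Q r = m₂ r.2 * B r
  dy_B : ∀ r ∈ S ×ˢ T, dy B r = m₁ r.2 * Q r

theorem bilinear_partials {S T : Set ℝ} (hS : IsOpen S) (hT : IsOpen T) {a₁ a₂ α₁ α₂ : ℝ → ℝ}
    (ha₁ : ContDiffOn ℝ ∞ a₁ S) (ha₂ : ContDiffOn ℝ ∞ a₂ S) (hα₁ : ContDiffOn ℝ ∞ α₁ T)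
    (hα₂ : ContDiffOn ℝ ∞ α₂ T) :
    ContDiffOn ℝ ∞ (fun r : ℝ × ℝ => a₁ r.1 * α₁ r.2 + a₂ r.1 * α₂ r.2) (S ×ˢ T) ∧
    (∀ {c₁ c₂ : ℝ → ℝ}, (∀ x ∈ S, HasDerivAt a₁ (c₁ x) x) → (∀ x ∈ S, HasDerivAt a₂ (c₂ x) x) →
      ∀ r ∈ S ×ˢ T, dx (fun r : ℝ × ℝ => a₁ r.1 * α₁ r.2 + a₂ r.1 * α₂ r.2) r =
        c₁ r.1 * α₁ r.2 + c₂ r.1 * α₂ r.2) ∧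
    (∀ {γ₁ γ₂ : ℝ → ℝ}, (∀ y ∈ T, HasDerivAt α₁ (γ₁ y) y) → (∀ y ∈ T, HasDerivAt α₂ (γ₂ y) y) →
      ∀ r ∈ S ×ˢ T, dy (fun r : ℝ × ℝ => a₁ r.1 * α₁ r.2 + a₂ r.1 * α₂ r.2) r =
        a₁ r.1 * γ₁ r.2 + a₂ r.1 * γ₂ r.2) := by
  have h1 : MapsTo Prod.fst (S ×ˢ T) S := fun r hr => hr.1
  have h2 : MapsTo Prod.snd (S ×ˢ T) T := fun r hr => hr.2
  have hs : ContDiffOn ℝ ∞ (fun r : ℝ × ℝ => a₁ r.1 * α₁ r.2 + a₂ r.1 * α₂ r.2) (S ×ˢ T) :=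
    ((ha₁.comp contDiffOn_fst h1).mul (hα₁.comp contDiffOn_snd h2)).add
      ((ha₂.comp contDiffOn_fst h1).mul (hα₂.comp contDiffOn_snd h2))
  refine ⟨hs, fun hc₁ hc₂ => ?_, fun hγ₁ hγ₂ => ?_⟩ <;> rintro ⟨x, y⟩ ⟨hx, hy⟩
  · exact dx_eq_of_hasDerivAt (differentiableAt_of_contDiffOn (hS.prod hT) hs ⟨hx, hy⟩)
      (((hc₁ x hx).mul_const (α₁ y)).fun_add ((hc₂ x hx).mul_const (α₂ y)))
  · exact dy_eq_of_hasDerivAt (differentiableAt_of_contDiffOn (hS.prod hT) hs ⟨hx, hy⟩)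
      (((hγ₁ y hy).const_mul (a₁ x)).fun_add ((hγ₂ y hy).const_mul (a₂ x)))

theorem eq_of_hasDerivAt_zero {S : Set ℝ} (hc : S.OrdConnected) {f : ℝ → ℝ}
    (hf : ∀ x ∈ S, HasDerivAt f 0 x) {x₀ x : ℝ} (h₀ : x₀ ∈ S) (hx : x ∈ S) : f x = f x₀ := by
  have := eq_zero_of_norm_deriv_le (f := fun x => f x - f x₀) (f' := fun _ => 0) (K := fun _ => 0)
    (a := x₀) (b := x) (fun t ht => (hf t (hc.uIcc_subset h₀ hx ht)).sub_const _)
    continuousOn_const (by simp) (by simp)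
  exact sub_eq_zero.1 this

/-- Used to see that an integral of a smooth function is smooth. -/
theorem contDiffOn_infty_of_hasDerivAt {I : Set ℝ} (hI : IsOpen I) {f f' : ℝ → ℝ}
    (h : ∀ t ∈ I, HasDerivAt f (f' t) t) (hf' : ContDiffOn ℝ ∞ f' I) : ContDiffOn ℝ ∞ f I := by
  rw [contDiffOn_infty_iff_deriv_of_isOpen hI]
  exact ⟨fun t ht => (h t ht).differentiableAt.differentiableWithinAt,
    hf'.congr fun t ht => (h t ht).deriv⟩

/-! ### Smoothness of the lifted data and construction of the matrix from its values on the curve.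
-/

namespace CauchyData

variable (C : CauchyData)

theorem smooth_deriv {f : ℝ → ℝ} (hf : ContDiffOn ℝ ∞ f C.I) : ContDiffOn ℝ ∞ (deriv f) C.I :=
  ((contDiffOn_infty_iff_deriv_of_isOpen C.isOpen_I).1 hf).2

theorem smooth_liftX {φ ψ : ℝ → ℝ} (hφ : ContDiffOn ℝ ∞ φ C.I) (hψ : ContDiffOn ℝ ∞ ψ C.I) :
    ContDiffOn ℝ ∞ (C.liftX φ ψ) C.I :=
  (((C.smooth_deriv hφ).mul C.smooth_n₂).sub ((C.smooth_deriv C.smooth_q).mul hψ)).div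
    (((C.smooth_deriv C.smooth_p).mul C.smooth_n₂).sub ((C.smooth_deriv C.smooth_q).mul
      C.smooth_n₁)) fun _ ht => C.lift_det_ne_zero ht

theorem smooth_liftY {φ ψ : ℝ → ℝ} (hφ : ContDiffOn ℝ ∞ φ C.I) (hψ : ContDiffOn ℝ ∞ ψ C.I) :
    ContDiffOn ℝ ∞ (C.liftY φ ψ) C.I :=
  (((C.smooth_deriv C.smooth_p).mul hψ).sub (C.smooth_n₁.mul (C.smooth_deriv hφ))).div
    (((C.smooth_deriv C.smooth_p).mul C.smooth_n₂).sub ((C.smooth_deriv C.smooth_q).mul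
      C.smooth_n₁)) fun _ ht => C.lift_det_ne_zero ht

theorem hasDerivAt_of_smooth {f : ℝ → ℝ} (hf : ContDiffOn ℝ ∞ f C.I) {t : ℝ} (ht : t ∈ C.I) :
    HasDerivAt f (deriv f t) t :=
  ((hf.contDiffAt (C.isOpen_I.mem_nhds ht)).differentiableAt (by simp)).hasDerivAt

/-- With `P₀, Q₀` given on `γ`, the remaining freedom is the positive factor splitting `1 + P₀ Q₀ =
A₀ B₀`. The matrix equations force the logarithmic derivative of `A₀`, hence one quadrature. The
four jet values then define `l₁, l₂, m₁, m₂`, with `p` and `q` inverted to make them functions of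
`x` and `y`. The solution is `L(x) M(y)`. -/
theorem exists_loopSolution : ∃ (A P Q B : ℝ × ℝ → ℝ) (l₁ l₂ m₁ m₂ : ℝ → ℝ),
    IsLoopSolution (C.p '' C.I) (C.q '' C.I) A P Q B l₁ l₂ m₁ m₂ ∧
    ∀ t ∈ C.I, 0 < A (C.pt t) ∧ 0 < B (C.pt t) ∧ P (C.pt t) = Real.exp (C.φ₁ t / 2) ∧
      Q (C.pt t) = Real.exp (C.φ₂ t / 2) ∧
      l₁ (C.p t) * B (C.pt t) = P (C.pt t) * C.ux t / 2 ∧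
      m₁ (C.q t) * A (C.pt t) = P (C.pt t) * C.uy t / 2 ∧
      l₂ (C.p t) * A (C.pt t) = Q (C.pt t) * C.vx t / 2 ∧
      m₂ (C.q t) * B (C.pt t) = Q (C.pt t) * C.vy t / 2 := by
  rcases C.I.eq_empty_or_nonempty with hempty | ⟨t₀, ht₀⟩
  · refine ⟨0, 0, 0, 0, 0, 0, 0, 0, ?_, by simp [hempty]⟩
    constructor <;> simp [hempty]
  obtain ⟨hSo, hSc, π, hπ, hπp⟩ := exists_smooth_inverse C.isOpen_I C.interval_I C.smooth_p C.p_deriv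
  obtain ⟨hTo, hTc, σ, hσ, hσq⟩ := exists_smooth_inverse C.isOpen_I C.interval_I C.smooth_q C.q_deriv
  set S := C.p '' C.I
  set T := C.q '' C.I
  have hπI : MapsTo π S C.I := by rintro _ ⟨t, ht, rfl⟩; rw [hπp t ht]; exact ht
  have hσI : MapsTo σ T C.I := by rintro _ ⟨t, ht, rfl⟩; rw [hσq t ht]; exact ht
  have sux : ContDiffOn ℝ ∞ C.ux C.I := C.smooth_liftX C.smooth_φ₁ C.smooth_ψ₁
  have suy : ContDiffOn ℝ ∞ C.uy C.I := C.smooth_liftY C.smooth_φ₁ C.smooth_ψ₁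
  have svx : ContDiffOn ℝ ∞ C.vx C.I := C.smooth_liftX C.smooth_φ₂ C.smooth_ψ₂
  have svy : ContDiffOn ℝ ∞ C.vy C.I := C.smooth_liftY C.smooth_φ₂ C.smooth_ψ₂
  have sp := C.smooth_deriv C.smooth_p
  have sq := C.smooth_deriv C.smooth_q
  let P₀ : ℝ → ℝ := fun t => Real.exp (C.φ₁ t / 2)
  let Q₀ : ℝ → ℝ := fun t => Real.exp (C.φ₂ t / 2)
  have sP : ContDiffOn ℝ ∞ P₀ C.I := (C.smooth_φ₁.div_const 2).exp
  have sQ : ContDiffOn ℝ ∞ Q₀ C.I := (C.smooth_φ₂.div_const 2).exp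
  have hP₀ : ∀ t, 0 < P₀ t := fun t => Real.exp_pos _
  have hQ₀ : ∀ t, 0 < Q₀ t := fun t => Real.exp_pos _
  -- This is `A₀' / A₀`: substitute `l₁ = P₀ u_x / (2 B₀)` and `m₂ = Q₀ v_y / (2 B₀)` in `A₀' = l₁
  -- Q₀ p' + m₂ P₀ q'` and use `A₀ B₀ = 1 + P₀ Q₀`.
  let h : ℝ → ℝ := fun t => P₀ t * Q₀ t * (C.ux t * deriv C.p t + C.vy t * deriv C.q t) /
    (2 * (1 + P₀ t * Q₀ t))
  have hden : ∀ t, 0 < 1 + P₀ t * Q₀ t := fun t => by have := hP₀ t; have := hQ₀ t; positivity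
  have sh : ContDiffOn ℝ ∞ h C.I := ((sP.mul sQ).mul ((sux.mul sp).add (svy.mul sq))).div
    (contDiffOn_const.mul (contDiffOn_const.add (sP.mul sQ))) fun t _ => by
      have := hden t; positivity
  let a : ℝ → ℝ := fun t => ∫ s in t₀..t, h s
  have da : ∀ t ∈ C.I, HasDerivAt a (h t) t := fun t ht =>
    hasDerivAt_intervalIntegral_of_continuousOn C.isOpen_I C.interval_I sh.continuousOn ht₀ ht
  have sa : ContDiffOn ℝ ∞ a C.I := contDiffOn_infty_of_hasDerivAt C.isOpen_I da sh
  let A₀ : ℝ → ℝ := fun t => Real.exp (a t)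
  have sA : ContDiffOn ℝ ∞ A₀ C.I := sa.exp
  have hA₀ : ∀ t, 0 < A₀ t := fun t => Real.exp_pos _
  let B₀ : ℝ → ℝ := fun t => (1 + P₀ t * Q₀ t) / A₀ t
  have sB : ContDiffOn ℝ ∞ B₀ C.I := (contDiffOn_const.add (sP.mul sQ)).div sA fun t _ => (hA₀ t).ne'
  have hB₀ : ∀ t, 0 < B₀ t := fun t => div_pos (hden t) (hA₀ t)
  have hAB : ∀ t, A₀ t * B₀ t = 1 + P₀ t * Q₀ t := fun t => mul_div_cancel₀ _ (hA₀ t).ne'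
  let l₁ : ℝ → ℝ := fun x => P₀ (π x) * C.ux (π x) / 2 / B₀ (π x)
  let l₂ : ℝ → ℝ := fun x => Q₀ (π x) * C.vx (π x) / 2 / A₀ (π x)
  let m₁ : ℝ → ℝ := fun y => P₀ (σ y) * C.uy (σ y) / 2 / A₀ (σ y)
  let m₂ : ℝ → ℝ := fun y => Q₀ (σ y) * C.vy (σ y) / 2 / B₀ (σ y)
  have sl₁ : ContDiffOn ℝ ∞ l₁ S :=
    (((sP.mul sux).div_const 2).div sB fun t _ => (hB₀ t).ne').comp hπ hπI
  have sl₂ : ContDiffOn ℝ ∞ l₂ S :=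
    (((sQ.mul svx).div_const 2).div sA fun t _ => (hA₀ t).ne').comp hπ hπI
  have sm₁ : ContDiffOn ℝ ∞ m₁ T :=
    (((sP.mul suy).div_const 2).div sA fun t _ => (hA₀ t).ne').comp hσ hσI
  have sm₂ : ContDiffOn ℝ ∞ m₂ T :=
    (((sQ.mul svy).div_const 2).div sB fun t _ => (hB₀ t).ne').comp hσ hσI
  have el₁ : ∀ t ∈ C.I, l₁ (C.p t) * B₀ t = P₀ t * C.ux t / 2 := fun t ht => by
    simp only [l₁, hπp t ht]; exact div_mul_cancel₀ _ (hB₀ t).ne'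
  have el₂ : ∀ t ∈ C.I, l₂ (C.p t) * A₀ t = Q₀ t * C.vx t / 2 := fun t ht => by
    simp only [l₂, hπp t ht]; exact div_mul_cancel₀ _ (hA₀ t).ne'
  have em₁ : ∀ t ∈ C.I, m₁ (C.q t) * A₀ t = P₀ t * C.uy t / 2 := fun t ht => by
    simp only [m₁, hσq t ht]; exact div_mul_cancel₀ _ (hA₀ t).ne'
  have em₂ : ∀ t ∈ C.I, m₂ (C.q t) * B₀ t = Q₀ t * C.vy t / 2 := fun t ht => by
    simp only [m₂, hσq t ht]; exact div_mul_cancel₀ _ (hB₀ t).ne'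
  have hx₀ : C.p t₀ ∈ S := mem_image_of_mem _ ht₀
  have hy₀ : C.q t₀ ∈ T := mem_image_of_mem _ ht₀
  -- The columns `(a, c)` of `L`, starting from the identity; below, the rows `(α, β)` of `M`,
  -- starting from the prescribed matrix at `t₀`.
  obtain ⟨a₁, c₁, sa₁, sc₁, a₁0, c₁0, d₁⟩ := exists_offdiagonal_ode_solution hSo hSc sl₂ sl₁ hx₀ 1 0
  obtain ⟨a₂, c₂, sa₂, sc₂, a₂0, c₂0, d₂⟩ := exists_offdiagonal_ode_solution hSo hSc sl₂ sl₁ hx₀ 0 1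
  obtain ⟨α₁, β₁, sα₁, sβ₁, α₁0, β₁0, δ₁⟩ :=
    exists_offdiagonal_ode_solution hTo hTc sm₁ sm₂ hy₀ (A₀ t₀) (P₀ t₀)
  obtain ⟨α₂, β₂, sα₂, sβ₂, α₂0, β₂0, δ₂⟩ :=
    exists_offdiagonal_ode_solution hTo hTc sm₁ sm₂ hy₀ (Q₀ t₀) (B₀ t₀)
  -- The coefficient matrices are trace-free, so the determinants are constant.
  have detL : ∀ x ∈ S, a₁ x * c₂ x - a₂ x * c₁ x = 1 := by
    intro x hx
    rw [eq_of_hasDerivAt_zero (f := fun x => a₁ x * c₂ x - a₂ x * c₁ x) hSc (fun x hx => ?_) hx₀ hx]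
    · simp only [a₁0, a₂0, c₁0, c₂0]; ring
    · exact ((((d₁ x hx).1.mul (d₂ x hx).2)).sub ((d₂ x hx).1.mul (d₁ x hx).2)).congr_deriv (by ring)
  have detM : ∀ y ∈ T, α₁ y * β₂ y - α₂ y * β₁ y = 1 := by
    intro y hy
    rw [eq_of_hasDerivAt_zero (f := fun y => α₁ y * β₂ y - α₂ y * β₁ y) hTc (fun y hy => ?_) hy₀ hy]
    · simp only [α₁0, α₂0, β₁0, β₂0]; linear_combination hAB t₀
    · exact ((((δ₁ y hy).1.mul (δ₂ y hy).2)).sub ((δ₂ y hy).1.mul (δ₁ y hy).2)).congr_deriv (by ring)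
  obtain ⟨sA', xA, yA⟩ := bilinear_partials hSo hTo sa₁ sa₂ sα₁ sα₂
  obtain ⟨sP', xP, yP⟩ := bilinear_partials hSo hTo sa₁ sa₂ sβ₁ sβ₂
  obtain ⟨sQ', xQ, yQ⟩ := bilinear_partials hSo hTo sc₁ sc₂ sα₁ sα₂
  obtain ⟨sB', xB, yB⟩ := bilinear_partials hSo hTo sc₁ sc₂ sβ₁ sβ₂
  have xA := xA (fun x hx => (d₁ x hx).1) (fun x hx => (d₂ x hx).1)
  have xP := xP (fun x hx => (d₁ x hx).1) (fun x hx => (d₂ x hx).1)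
  have xQ := xQ (fun x hx => (d₁ x hx).2) (fun x hx => (d₂ x hx).2)
  have xB := xB (fun x hx => (d₁ x hx).2) (fun x hx => (d₂ x hx).2)
  have yA := yA (fun x hx => (δ₁ x hx).1) (fun x hx => (δ₂ x hx).1)
  have yP := yP (fun x hx => (δ₁ x hx).2) (fun x hx => (δ₂ x hx).2)
  have yQ := yQ (fun x hx => (δ₁ x hx).1) (fun x hx => (δ₂ x hx).1)
  have yB := yB (fun x hx => (δ₁ x hx).2) (fun x hx => (δ₂ x hx).2)
  set A : ℝ × ℝ → ℝ := fun r => a₁ r.1 * α₁ r.2 + a₂ r.1 * α₂ r.2 with hA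
  set P : ℝ × ℝ → ℝ := fun r => a₁ r.1 * β₁ r.2 + a₂ r.1 * β₂ r.2 with hP
  set Q : ℝ × ℝ → ℝ := fun r => c₁ r.1 * α₁ r.2 + c₂ r.1 * α₂ r.2 with hQ
  set B : ℝ × ℝ → ℝ := fun r => c₁ r.1 * β₁ r.2 + c₂ r.1 * β₂ r.2 with hB
  have sol : IsLoopSolution S T A P Q B l₁ l₂ m₁ m₂ :=
    { smooth_A := sA'
      smooth_P := sP'
      smooth_Q := sQ'
      smooth_B := sB'
      smooth_m₁ := sm₁
      det := fun r hr => by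
        have e1 := detL r.1 hr.1
        have e2 := detM r.2 hr.2
        simp only [hA, hP, hQ, hB]
        linear_combination (α₁ r.2 * β₂ r.2 - α₂ r.2 * β₁ r.2) * e1 + e2
      dx_A := fun r hr => (xA r hr).trans (by simp only [hQ]; ring)
      dx_P := fun r hr => (xP r hr).trans (by simp only [hB]; ring)
      dx_Q := fun r hr => (xQ r hr).trans (by simp only [hA]; ring)
      dy_A := fun r hr => (yA r hr).trans (by simp only [hP]; ring)
      dy_P := fun r hr => (yP r hr).trans (by simp only [hA]; ring)
      dy_Q := fun r hr => (yQ r hr).trans (by simp only [hB]; ring)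
      dy_B := fun r hr => (yB r hr).trans (by simp only [hQ]; ring) }
  have dx_B : ∀ r ∈ S ×ˢ T, dx B r = l₂ r.1 * P r := fun r hr =>
    (xB r hr).trans (by simp only [hP]; ring)
  have hpt : ∀ t ∈ C.I, (C.p t, C.q t) ∈ S ×ˢ T := fun t ht =>
    ⟨mem_image_of_mem _ ht, mem_image_of_mem _ ht⟩
  have dcurve : ∀ {f : ℝ × ℝ → ℝ}, ContDiffOn ℝ ∞ f (S ×ˢ T) → ∀ t ∈ C.I,
      HasDerivAt (fun t => f (C.p t, C.q t))
        (dx f (C.p t, C.q t) * deriv C.p t + dy f (C.p t, C.q t) * deriv C.q t) t := fun hf t ht =>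
    hasDerivAt_comp_curve (differentiableAt_of_contDiffOn (hSo.prod hTo) hf (hpt t ht))
      (C.hasDerivAt_p ht) (C.hasDerivAt_q ht)
  have dA₀ : ∀ t ∈ C.I, HasDerivAt A₀ (l₁ (C.p t) * Q₀ t * deriv C.p t +
      m₂ (C.q t) * P₀ t * deriv C.q t) t := by
    intro t ht
    refine (da t ht).exp.congr_deriv ?_
    have e1 : l₁ (C.p t) = P₀ t * C.ux t / 2 / B₀ t := eq_div_of_mul_eq (hB₀ t).ne' (el₁ t ht)
    have e2 : m₂ (C.q t) = Q₀ t * C.vy t / 2 / B₀ t := eq_div_of_mul_eq (hB₀ t).ne' (em₂ t ht)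
    have e4 : B₀ t = (1 + P₀ t * Q₀ t) / A₀ t := rfl
    have e5 := (hA₀ t).ne'
    change A₀ t * h t = _
    rw [e1, e2, e4]
    simp only [h]
    field_simp
  have dP₀ : ∀ t ∈ C.I, HasDerivAt P₀ (l₁ (C.p t) * B₀ t * deriv C.p t +
      m₁ (C.q t) * A₀ t * deriv C.q t) t := by
    intro t ht
    refine ((C.hasDerivAt_of_smooth C.smooth_φ₁ ht).div_const 2).exp.congr_deriv ?_
    rw [el₁ t ht, em₁ t ht, ← C.lift_tangent C.φ₁ C.ψ₁ ht]
    simp only [P₀, ux, uy]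
    ring
  have dQ₀ : ∀ t ∈ C.I, HasDerivAt Q₀ (l₂ (C.p t) * A₀ t * deriv C.p t +
      m₂ (C.q t) * B₀ t * deriv C.q t) t := by
    intro t ht
    refine ((C.hasDerivAt_of_smooth C.smooth_φ₂ ht).div_const 2).exp.congr_deriv ?_
    rw [el₂ t ht, em₂ t ht, ← C.lift_tangent C.φ₂ C.ψ₂ ht]
    simp only [Q₀, vx, vy]
    ring
  have dB₀ : ∀ t ∈ C.I, HasDerivAt B₀ (l₂ (C.p t) * P₀ t * deriv C.p t +
      m₁ (C.q t) * Q₀ t * deriv C.q t) t := by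
    intro t ht
    refine ((((dP₀ t ht).mul (dQ₀ t ht)).const_add 1).div (dA₀ t ht) (hA₀ t).ne').congr_deriv ?_
    have e := hAB t
    have e5 := (hA₀ t).ne'
    simp only [Pi.mul_apply]
    rw [← e]
    field_simp
    ring
  -- Along `γ` the product and the prescribed matrix obey the same linear equation and agree at
  -- `t₀`, so their difference `D` vanishes.
  have heq : ∀ t ∈ C.I, A (C.p t, C.q t) = A₀ t ∧ P (C.p t, C.q t) = P₀ t ∧
      Q (C.p t, C.q t) = Q₀ t ∧ B (C.p t, C.q t) = B₀ t := by
    intro t ht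
    have hsub := C.interval_I.uIcc_subset ht₀ ht
    let D : ℝ → ℝ × ℝ × ℝ × ℝ := fun t => (A (C.p t, C.q t) - A₀ t, P (C.p t, C.q t) - P₀ t,
      Q (C.p t, C.q t) - Q₀ t, B (C.p t, C.q t) - B₀ t)
    let κ₁ : ℝ → ℝ := fun t => l₁ (C.p t) * deriv C.p t
    let κ₂ : ℝ → ℝ := fun t => l₂ (C.p t) * deriv C.p t
    let μ₁ : ℝ → ℝ := fun t => m₁ (C.q t) * deriv C.q t
    let μ₂ : ℝ → ℝ := fun t => m₂ (C.q t) * deriv C.q t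
    have mp : MapsTo C.p C.I S := mapsTo_image _ _
    have mq : MapsTo C.q C.I T := mapsTo_image _ _
    have cκ₁ : ContinuousOn κ₁ C.I :=
      (sl₁.continuousOn.comp C.smooth_p.continuousOn mp).mul sp.continuousOn
    have cκ₂ : ContinuousOn κ₂ C.I :=
      (sl₂.continuousOn.comp C.smooth_p.continuousOn mp).mul sp.continuousOn
    have cμ₁ : ContinuousOn μ₁ C.I :=
      (sm₁.continuousOn.comp C.smooth_q.continuousOn mq).mul sq.continuousOn
    have cμ₂ : ContinuousOn μ₂ C.I :=
      (sm₂.continuousOn.comp C.smooth_q.continuousOn mq).mul sq.continuousOn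
    have hD : D t = 0 := by
      refine eq_zero_of_norm_deriv_le (a := t₀) (b := t) (f := D)
        (f' := fun t => (κ₁ t * (D t).2.2.1 + μ₂ t * (D t).2.1,
          κ₁ t * (D t).2.2.2 + μ₁ t * (D t).1, κ₂ t * (D t).1 + μ₂ t * (D t).2.2.2,
          κ₂ t * (D t).2.1 + μ₁ t * (D t).2.2.1))
        (K := fun t => |κ₁ t| + |κ₂ t| + |μ₁ t| + |μ₂ t|) ?_ ?_ ?_ ?_
      · intro s hs
        have hs := hsub hs
        refine HasDerivAt.congr_deriv (((dcurve sA' s hs).sub (dA₀ s hs)).prodMk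
          (((dcurve sP' s hs).sub (dP₀ s hs)).prodMk
          (((dcurve sQ' s hs).sub (dQ₀ s hs)).prodMk ((dcurve sB' s hs).sub (dB₀ s hs))))) ?_
        have hr := hpt s hs
        rw [sol.dx_A _ hr, sol.dx_P _ hr, sol.dx_Q _ hr, dx_B _ hr, sol.dy_A _ hr, sol.dy_P _ hr,
          sol.dy_Q _ hr, sol.dy_B _ hr]
        simp only [D, κ₁, κ₂, μ₁, μ₂]
        refine Prod.ext ?_ (Prod.ext ?_ (Prod.ext ?_ ?_)) <;> simp only <;> ring
      · exact (((cκ₁.abs.add cκ₂.abs).add cμ₁.abs).add cμ₂.abs).mono hsub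
      · intro s _
        have n1 : |(D s).1| ≤ ‖D s‖ := norm_fst_le (D s)
        have n2 : |(D s).2.1| ≤ ‖D s‖ := (norm_fst_le (D s).2).trans (norm_snd_le (D s))
        have n3 : |(D s).2.2.1| ≤ ‖D s‖ :=
          (norm_fst_le (D s).2.2).trans ((norm_snd_le (D s).2).trans (norm_snd_le (D s)))
        have n4 : |(D s).2.2.2| ≤ ‖D s‖ :=
          (norm_snd_le (D s).2.2).trans ((norm_snd_le (D s).2).trans (norm_snd_le (D s)))
        have key : ∀ x y d e : ℝ, |d| ≤ ‖D s‖ → |e| ≤ ‖D s‖ →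
            |x * d + y * e| ≤ (|x| + |y|) * ‖D s‖ := by
          intro x y d e hd he
          refine (abs_add_le _ _).trans ?_
          rw [abs_mul, abs_mul, add_mul]
          gcongr
        have hn := norm_nonneg (D s)
        have q1 := abs_nonneg (κ₁ s)
        have q2 := abs_nonneg (κ₂ s)
        have q3 := abs_nonneg (μ₁ s)
        have q4 := abs_nonneg (μ₂ s)
        refine norm_prod_le_iff.2 ⟨(key _ _ _ _ n3 n2).trans ?_, norm_prod_le_iff.2
          ⟨(key _ _ _ _ n4 n1).trans ?_, norm_prod_le_iff.2 ⟨(key _ _ _ _ n1 n4).trans ?_,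
          (key _ _ _ _ n2 n3).trans ?_⟩⟩⟩ <;>
        exact mul_le_mul_of_nonneg_right (by linarith) hn
      · simp only [D, hA, hP, hQ, hB, a₁0, a₂0, c₁0, c₂0, α₁0, α₂0, β₁0, β₂0]
        refine Prod.ext ?_ (Prod.ext ?_ (Prod.ext ?_ ?_)) <;> simp
    have h1 : (D t).1 = 0 := by rw [hD]; rfl
    have h2 : (D t).2.1 = 0 := by rw [hD]; rfl
    have h3 : (D t).2.2.1 = 0 := by rw [hD]; rfl
    have h4 : (D t).2.2.2 = 0 := by rw [hD]; rfl
    exact ⟨sub_eq_zero.1 h1, sub_eq_zero.1 h2, sub_eq_zero.1 h3, sub_eq_zero.1 h4⟩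
  refine ⟨A, P, Q, B, l₁, l₂, m₁, m₂, sol, fun t ht => ?_⟩
  obtain ⟨eA, eP, eQ, eB⟩ := heq t ht
  simp only [pt, eA, eP, eQ, eB]
  exact ⟨hA₀ t, hB₀ t, rfl, rfl, el₁ t ht, em₁ t ht, el₂ t ht, em₂ t ht⟩

end CauchyData

end WaveLie

namespace WaveLie

open MeasureTheory

/-! ### Wave maps and the Euler-Lagrange equations -/

/-- The conformal factor of the target metric. -/
noncomputable def conf (s : ℝ) : ℝ := 1 / (1 + Real.exp (-s))

/-- The derivative of the conformal factor. -/
noncomputable def confDeriv (s : ℝ) : ℝ := Real.exp (-s) / (1 + Real.exp (-s)) ^ 2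

theorem hasDerivAt_conf (s : ℝ) : HasDerivAt conf (confDeriv s) s := by
  have h0 : (1 + Real.exp (-s)) ≠ 0 := by positivity
  have h1 : HasDerivAt (fun s => 1 + Real.exp (-s)) (-Real.exp (-s)) s := by
    simpa using ((hasDerivAt_neg s).exp).const_add 1
  refine ((hasDerivAt_const s (1 : ℝ)).fun_div h1 h0).congr_deriv ?_
  rw [confDeriv]
  ring

theorem contDiff_conf : ContDiff ℝ ∞ conf :=
  contDiff_const.div (by fun_prop) fun s => by positivity

theorem continuous_confDeriv : Continuous confDeriv :=
  Continuous.div (by fun_prop) (by fun_prop) fun s => by positivity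

/-- In null coordinates the inverse metric is off-diagonal with entries `2` and the volume factor is
`1 / 2`, so all numerical constants cancel. -/
theorem energyDensity_eq (Φ : ℝ × ℝ → Fin 2 → ℝ) (r : ℝ × ℝ) :
    energyDensity minkowski targetMetric Φ r = conf (Φ r 0) *
      (dx (fun r => Φ r 0) r * dy (fun r => Φ r 0) r -
        dx (fun r => Φ r 1) r * dy (fun r => Φ r 1) r) := by
  have hinv : minkowski⁻¹ = !![0, 2; 2, 0] := by
    apply Matrix.inv_eq_right_inv
    ext i j
    fin_cases i <;> fin_cases j <;> simp [minkowski, Matrix.mul_apply]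
  have hdet : √|minkowski.det| = 1 / 2 := by
    rw [show |minkowski.det| = (1 / 2) ^ 2 by
      simp [minkowski, Matrix.det_fin_two]; norm_num [abs_of_pos]]
    exact Real.sqrt_sq (by norm_num)
  simp only [energyDensity, hinv, hdet, Fin.sum_univ_two, targetMetric, pd, conf]
  simp
  ring

/-- Dominated differentiation: on the compact set of `ε ∈ [-1, 1]` and `r ∈ K` the parameter
derivative has a constant bound. -/
theorem hasDerivAt_setIntegral_of_continuousOn {K : Set (ℝ × ℝ)} (hK : IsCompact K)
    {F F' : ℝ → ℝ × ℝ → ℝ} (hF : ∀ ε, ContinuousOn (F ε) K)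
    (hF' : ContinuousOn (Function.uncurry F') (univ ×ˢ K))
    (hd : ∀ r ∈ K, ∀ ε, HasDerivAt (fun ε => F ε r) (F' ε r) ε) :
    HasDerivAt (fun ε => ∫ r in K, F ε r) (∫ r in K, F' 0 r) 0 := by
  obtain ⟨M, hM⟩ := ((isCompact_closedBall (0 : ℝ) 1).prod hK).exists_bound_of_continuousOn
    (hF'.mono (prod_mono (subset_univ _) Subset.rfl))
  have hm := hK.measurableSet
  have hF0 : ContinuousOn (F' 0) K :=
    hF'.comp (continuousOn_const.prodMk continuousOn_id) fun r hr => ⟨mem_univ _, hr⟩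
  refine (hasDerivAt_integral_of_dominated_loc_of_deriv_le (bound := fun _ => M) (F' := F')
    (Metric.closedBall_mem_nhds (0 : ℝ) one_pos)
    (Filter.Eventually.of_forall fun ε => (hF ε).aestronglyMeasurable hm)
    ((hF 0).integrableOn_compact hK) (hF0.aestronglyMeasurable hm) ?_ ?_ ?_).2
  · exact (ae_restrict_mem hm).mono fun r hr ε hε => hM (ε, r) ⟨hε, hr⟩
  · exact integrableOn_const hK.measure_ne_top
  · exact (ae_restrict_mem hm).mono fun r hr ε _ => hd r hr ε

theorem integral_fderiv_eq_zero {f : ℝ × ℝ → ℝ} (hf : ContDiff ℝ ∞ f) (hc : HasCompactSupport f)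
    (v : ℝ × ℝ) : ∫ r, fderiv ℝ f r v = 0 := by
  have hc' : HasCompactSupport fun r => fderiv ℝ f r v := hc.fderiv_apply (𝕜 := ℝ) v
  have hcont : Continuous fun r => fderiv ℝ f r v :=
    (hf.continuous_fderiv (by simp)).clm_apply continuous_const
  have := integral_mul_fderiv_eq_neg_fderiv_mul_of_integrable (𝕜 := ℝ) (f := fun _ : ℝ × ℝ => (1 : ℝ))
    (g := f) (v := v) (μ := volume) (by simp)
    (by simpa using hcont.integrable_of_hasCompactSupport hc')
    (by simpa using hf.continuous.integrable_of_hasCompactSupport hc) (by fun_prop)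
    (fun x _ => hf.differentiable (by simp) x)
  simpa using this

theorem setIntegral_add_exact {K : Set (ℝ × ℝ)} {T J₁ J₂ J₃ J₄ : ℝ × ℝ → ℝ}
    (hT : IntegrableOn T K) (h₁ : IntegrableOn J₁ K) (h₂ : IntegrableOn J₂ K)
    (h₃ : IntegrableOn J₃ K) (h₄ : IntegrableOn J₄ K) (i₁ : ∫ r in K, J₁ r = 0)
    (i₂ : ∫ r in K, J₂ r = 0) (i₃ : ∫ r in K, J₃ r = 0) (i₄ : ∫ r in K, J₄ r = 0) :
    ∫ r in K, (T r + J₁ r + J₂ r - J₃ r - J₄ r) = ∫ r in K, T r := by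
  have e := integral_sub (((hT.add h₁).add h₂).sub h₃) h₄
  rw [integral_sub' ((hT.add h₁).add h₂) h₃, integral_add' (hT.add h₁) h₂, integral_add' hT h₁, i₁,
    i₂, i₃, i₄] at e
  simpa using e

/-! ### Integration by parts against a factor supported in a compact set. -/

section Cutoff

variable {W K : Set (ℝ × ℝ)} {α G : ℝ × ℝ → ℝ}

theorem contDiff_mul_of_tsupport (hW : IsOpen W) (hα : ContDiff ℝ ∞ α) (hs : tsupport α ⊆ W)
    (hG : ContDiffOn ℝ ∞ G W) : ContDiff ℝ ∞ fun r => α r * G r := by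
  rw [contDiff_iff_contDiffAt]
  intro r
  by_cases hr : r ∈ W
  · exact hα.contDiffAt.mul (hG.contDiffAt (hW.mem_nhds hr))
  · have h0 : α =ᶠ[nhds r] 0 := notMem_tsupport_iff_eventuallyEq.1 fun h => hr (hs h)
    refine (contDiffAt_const (c := (0 : ℝ))).congr_of_eventuallyEq ?_
    filter_upwards [h0] with x hx
    simp [hx]

/-- The integrand is the directional derivative of `α G`, which extends by zero to a smooth
compactly supported function on the plane. -/
theorem setIntegral_mul_fderiv (hW : IsOpen W) (hK : IsCompact K) (hKW : K ⊆ W)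
    (hα : ContDiff ℝ ∞ α) (hs : tsupport α ⊆ K) (hG : ContDiffOn ℝ ∞ G W) (v : ℝ × ℝ) :
    ∫ r in K, (fderiv ℝ α r v * G r + α r * fderiv ℝ G r v) = 0 := by
  have hsm := contDiff_mul_of_tsupport hW hα (hs.trans hKW) hG
  have hsupp : tsupport (fun r => α r * G r) ⊆ K := (tsupport_mul_subset_left (f := α)).trans hs
  have hc : HasCompactSupport fun r => α r * G r :=
    hK.of_isClosed_subset (isClosed_tsupport _) hsupp
  refine Eq.trans ?_ ((setIntegral_eq_integral_of_forall_compl_eq_zero (s := K) ?_).trans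
    (integral_fderiv_eq_zero hsm hc v))
  · refine setIntegral_congr_fun hK.measurableSet fun r hr => ?_
    have hα' : Differentiable ℝ α := hα.differentiable (by simp)
    have hd := ((hα' r).hasFDerivAt.mul
      (differentiableAt_of_contDiffOn hW hG (hKW hr)).hasFDerivAt).fderiv
    change _ = fderiv ℝ (α * G) r v
    rw [hd]
    simp
    ring
  · intro r hr
    have : fderiv ℝ (fun r => α r * G r) r = 0 :=
      Function.notMem_support.1 fun h => hr (hsupp (support_fderiv_subset ℝ h))
    rw [this]
    rfl

end Cutoff

/-- The first component of the wave-map operator. -/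
noncomputable def tension₁ (a b : ℝ × ℝ → ℝ) (r : ℝ × ℝ) : ℝ :=
  -(2 * conf (a r) * dy (dx a) r + confDeriv (a r) * (dx a r * dy a r + dx b r * dy b r))

/-- The second component of the wave-map operator. -/
noncomputable def tension₂ (a b : ℝ × ℝ → ℝ) (r : ℝ × ℝ) : ℝ :=
  2 * conf (a r) * dy (dx b) r + confDeriv (a r) * (dx a r * dy b r + dy a r * dx b r)

/-! ### First variation of the energy. -/

section Variation

variable {W K : Set (ℝ × ℝ)} {a b α β : ℝ × ℝ → ℝ}

theorem continuousOn_tension (hW : IsOpen W) (ha : ContDiffOn ℝ ∞ a W) (hb : ContDiffOn ℝ ∞ b W) :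
    ContinuousOn (tension₁ a b) W ∧ ContinuousOn (tension₂ a b) W := by
  have c0 := ha.continuousOn
  have c1 := (contDiffOn_dx hW ha).continuousOn
  have c2 := (contDiffOn_dy hW ha).continuousOn
  have c3 := (contDiffOn_dx hW hb).continuousOn
  have c4 := (contDiffOn_dy hW hb).continuousOn
  have c5 := (contDiffOn_dy hW (contDiffOn_dx hW ha)).continuousOn
  have c6 := (contDiffOn_dy hW (contDiffOn_dx hW hb)).continuousOn
  have e1 : ContinuousOn (fun r => conf (a r)) W := contDiff_conf.continuous.comp_continuousOn c0
  have e2 : ContinuousOn (fun r => confDeriv (a r)) W := continuous_confDeriv.comp_continuousOn c0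
  exact ⟨(((continuousOn_const.mul e1).mul c5).add (e2.mul ((c1.mul c2).add (c3.mul c4)))).neg,
    ((continuousOn_const.mul e1).mul c6).add (e2.mul ((c1.mul c4).add (c2.mul c3)))⟩

theorem fderiv_conf_comp_mul (hW : IsOpen W) (ha : ContDiffOn ℝ ∞ a W) {G : ℝ × ℝ → ℝ}
    (hG : ContDiffOn ℝ ∞ G W) {r : ℝ × ℝ} (hr : r ∈ W) (v : ℝ × ℝ) :
    fderiv ℝ (fun r => conf (a r) * G r) r v =
      confDeriv (a r) * fderiv ℝ a r v * G r + conf (a r) * fderiv ℝ G r v := by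
  have h1 := (hasDerivAt_conf (a r)).comp_hasFDerivAt r
    (differentiableAt_of_contDiffOn hW ha hr).hasFDerivAt
  have h2 := (h1.mul (differentiableAt_of_contDiffOn hW hG hr).hasFDerivAt).fderiv
  change fderiv ℝ ((conf ∘ a) * G) r v = _
  rw [h2]
  simp
  ring

/-- The first variation of the energy. -/
theorem hasDerivAt_energy (hW : IsOpen W) (hK : IsCompact K) (hKW : K ⊆ W)
    {Φ η : ℝ × ℝ → Fin 2 → ℝ} (hΦ : ContDiffOn ℝ ∞ Φ W) (hη : ContDiff ℝ ∞ η)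
    (hs : tsupport η ⊆ K) :
    HasDerivAt (fun ε : ℝ => energy minkowski targetMetric K (fun p => Φ p + ε • η p))
      (∫ r in K, (tension₁ (fun r => Φ r 0) (fun r => Φ r 1) r * η r 0 +
        tension₂ (fun r => Φ r 0) (fun r => Φ r 1) r * η r 1)) 0 := by
  set a : ℝ × ℝ → ℝ := fun r => Φ r 0 with ha_def
  set b : ℝ × ℝ → ℝ := fun r => Φ r 1 with hb_def
  set α : ℝ × ℝ → ℝ := fun r => η r 0 with hα_def
  set β : ℝ × ℝ → ℝ := fun r => η r 1 with hβ_def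
  have ha : ContDiffOn ℝ ∞ a W := contDiffOn_pi.1 hΦ 0
  have hb : ContDiffOn ℝ ∞ b W := contDiffOn_pi.1 hΦ 1
  have hα : ContDiff ℝ ∞ α := contDiff_pi.1 hη 0
  have hβ : ContDiff ℝ ∞ β := contDiff_pi.1 hη 1
  have hsupp : ∀ i, tsupport (fun r => η r i) ⊆ K := fun i =>
    (closure_mono (Function.support_subset_iff'.2 fun r hr => by
      rw [Function.notMem_support.1 hr]; rfl)).trans hs
  have cax := (contDiffOn_dx hW ha).continuousOn.mono hKW
  have cay := (contDiffOn_dy hW ha).continuousOn.mono hKW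
  have cbx := (contDiffOn_dx hW hb).continuousOn.mono hKW
  have cby := (contDiffOn_dy hW hb).continuousOn.mono hKW
  have ca := ha.continuousOn.mono hKW
  have cαx := (contDiffOn_dx isOpen_univ hα.contDiffOn).continuousOn.mono (subset_univ K)
  have cαy := (contDiffOn_dy isOpen_univ hα.contDiffOn).continuousOn.mono (subset_univ K)
  have cβx := (contDiffOn_dx isOpen_univ hβ.contDiffOn).continuousOn.mono (subset_univ K)
  have cβy := (contDiffOn_dy isOpen_univ hβ.contDiffOn).continuousOn.mono (subset_univ K)
  have cα := hα.continuous.continuousOn (s := K)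
  have cβ := hβ.continuous.continuousOn (s := K)
  -- The energy density of the varied map and, below, its `ε`-derivative, with the `ε`-dependence
  -- polynomial apart from the conformal factor.
  let F : ℝ → ℝ × ℝ → ℝ := fun ε r => conf (a r + ε * α r) *
    ((dx a r + ε * dx α r) * (dy a r + ε * dy α r) - (dx b r + ε * dx β r) * (dy b r + ε * dy β r))
  let F' : ℝ → ℝ × ℝ → ℝ := fun ε r => confDeriv (a r + ε * α r) * α r *
    ((dx a r + ε * dx α r) * (dy a r + ε * dy α r) - (dx b r + ε * dx β r) * (dy b r + ε * dy β r)) +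
    conf (a r + ε * α r) * ((dx α r * (dy a r + ε * dy α r) + (dx a r + ε * dx α r) * dy α r) -
      (dx β r * (dy b r + ε * dy β r) + (dx b r + ε * dx β r) * dy β r))
  have hmain : HasDerivAt (fun ε => ∫ r in K, F ε r) (∫ r in K, F' 0 r) 0 := by
    refine hasDerivAt_setIntegral_of_continuousOn hK (fun ε => ?_) ?_ (fun r _ ε => ?_)
    · exact (contDiff_conf.continuous.comp_continuousOn (ca.add (cα.const_mul ε))).mul
        (((cax.add (cαx.const_mul ε)).mul (cay.add (cαy.const_mul ε))).sub
          ((cbx.add (cβx.const_mul ε)).mul (cby.add (cβy.const_mul ε))))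
    · have lift : ∀ {f : ℝ × ℝ → ℝ}, ContinuousOn f K →
          ContinuousOn (fun x : ℝ × (ℝ × ℝ) => f x.2) (univ ×ˢ K) := fun hf =>
        hf.comp continuousOn_snd fun x hx => hx.2
      have hl : ∀ {f g : ℝ × ℝ → ℝ}, ContinuousOn f K → ContinuousOn g K →
          ContinuousOn (fun x : ℝ × (ℝ × ℝ) => f x.2 + x.1 * g x.2) (univ ×ˢ K) := fun hf hg =>
        (lift hf).add (continuousOn_fst.mul (lift hg))
      exact (((continuous_confDeriv.comp_continuousOn (hl ca cα)).mul (lift cα)).mul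
        (((hl cax cαx).mul (hl cay cαy)).sub ((hl cbx cβx).mul (hl cby cβy)))).add
        ((contDiff_conf.continuous.comp_continuousOn (hl ca cα)).mul
          ((((lift cαx).mul (hl cay cαy)).add ((hl cax cαx).mul (lift cαy))).sub
            (((lift cβx).mul (hl cby cβy)).add ((hl cbx cβx).mul (lift cβy)))))
    · have hl : ∀ c d : ℝ, HasDerivAt (fun ε : ℝ => c + ε * d) d ε := fun c d => by
        simpa using ((hasDerivAt_id ε).mul_const d).const_add c
      exact ((hasDerivAt_conf _).comp ε (hl (a r) (α r))).mul
        (((hl (dx a r) (dx α r)).mul (hl (dy a r) (dy α r))).sub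
          ((hl (dx b r) (dx β r)).mul (hl (dy b r) (dy β r))))
  have hlin : ∀ {f g : ℝ × ℝ → ℝ}, ContDiffOn ℝ ∞ f W → ContDiff ℝ ∞ g → ∀ r ∈ W, ∀ ε : ℝ,
      ∀ v, fderiv ℝ (fun r => f r + ε * g r) r v = fderiv ℝ f r v + ε * fderiv ℝ g r v := by
    intro f g hf hg r hr ε v
    have h := ((differentiableAt_of_contDiffOn hW hf hr).hasFDerivAt.add
      ((hg.differentiable (by simp) r).hasFDerivAt.const_smul ε)).fderiv
    change fderiv ℝ (f + ε • g) r v = _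
    rw [h]
    simp
  have henergy : ∀ ε, energy minkowski targetMetric K (fun p => Φ p + ε • η p) =
      ∫ r in K, F ε r := by
    intro ε
    refine setIntegral_congr_fun hK.measurableSet fun r hr => ?_
    have hr := hKW hr
    simp only [energyDensity_eq]
    change conf (a r + ε * α r) * (dx (fun r => a r + ε * α r) r * dy (fun r => a r + ε * α r) r -
      dx (fun r => b r + ε * β r) r * dy (fun r => b r + ε * β r) r) = F ε r
    simp only [F, dx, dy, hlin ha hα r hr, hlin hb hβ r hr]
  simp only [henergy]
  convert hmain using 1
  have sconf : ContDiffOn ℝ ∞ (fun r => conf (a r)) W := contDiff_conf.comp_contDiffOn ha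
  have sGx := sconf.mul (contDiffOn_dy hW ha)
  have sGy := sconf.mul (contDiffOn_dx hW ha)
  have sHx := sconf.mul (contDiffOn_dy hW hb)
  have sHy := sconf.mul (contDiffOn_dx hW hb)
  have i1 := setIntegral_mul_fderiv hW hK hKW hα (hsupp 0) sGx (1, 0)
  have i2 := setIntegral_mul_fderiv hW hK hKW hα (hsupp 0) sGy (0, 1)
  have i3 := setIntegral_mul_fderiv hW hK hKW hβ (hsupp 1) sHx (1, 0)
  have i4 := setIntegral_mul_fderiv hW hK hKW hβ (hsupp 1) sHy (0, 1)
  have hint : ∀ {γ G : ℝ × ℝ → ℝ}, ContDiff ℝ ∞ γ → ContDiffOn ℝ ∞ G W → ∀ v,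
      IntegrableOn (fun r => fderiv ℝ γ r v * G r + γ r * fderiv ℝ G r v) K := by
    intro γ G hγ hG v
    refine ContinuousOn.integrableOn_compact hK ?_
    have c1 : ContinuousOn (fun r => fderiv ℝ γ r v) K :=
      ((hγ.continuous_fderiv (by simp)).clm_apply continuous_const).continuousOn
    have c2 : ContinuousOn (fun r => fderiv ℝ G r v) K :=
      (((hG.fderiv_of_isOpen hW (m := ∞) (by simp)).clm_apply
        contDiffOn_const).continuousOn).mono hKW
    exact (c1.mul (hG.continuousOn.mono hKW)).add (hγ.continuous.continuousOn.mul c2)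
  obtain ⟨t1, t2⟩ := continuousOn_tension hW ha hb
  have it : IntegrableOn (fun r => tension₁ a b r * α r + tension₂ a b r * β r) K :=
    (((t1.mono hKW).mul cα).add ((t2.mono hKW).mul cβ)).integrableOn_compact hK
  have j1 := hint hα sGx (1, 0)
  have j2 := hint hα sGy (0, 1)
  have j3 := hint hβ sHx (1, 0)
  have j4 := hint hβ sHy (0, 1)
  -- The derivative at `ε = 0` is the tension paired with the variation plus four exact terms. Those
  -- for `β` enter with a minus sign because the target metric is negative in that direction.
  have hsplit : ∫ r in K, F' 0 r = ∫ r in K, (((((tension₁ a b r * α r + tension₂ a b r * β r) +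
      (fderiv ℝ α r (1, 0) * (conf (a r) * dy a r) +
        α r * fderiv ℝ (fun r => conf (a r) * dy a r) r (1, 0))) +
      (fderiv ℝ α r (0, 1) * (conf (a r) * dx a r) +
        α r * fderiv ℝ (fun r => conf (a r) * dx a r) r (0, 1))) -
      (fderiv ℝ β r (1, 0) * (conf (a r) * dy b r) +
        β r * fderiv ℝ (fun r => conf (a r) * dy b r) r (1, 0))) -
      (fderiv ℝ β r (0, 1) * (conf (a r) * dx b r) +
        β r * fderiv ℝ (fun r => conf (a r) * dx b r) r (0, 1))) := by
    refine setIntegral_congr_fun hK.measurableSet fun r hr => ?_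
    have hr := hKW hr
    have ca' := dx_dy_comm hW ha hr
    have cb' := dx_dy_comm hW hb hr
    rw [fderiv_conf_comp_mul hW ha (contDiffOn_dy hW ha) hr,
      fderiv_conf_comp_mul hW ha (contDiffOn_dx hW ha) hr,
      fderiv_conf_comp_mul hW ha (contDiffOn_dy hW hb) hr,
      fderiv_conf_comp_mul hW ha (contDiffOn_dx hW hb) hr]
    simp only [F', tension₁, tension₂, zero_mul, add_zero, ← dx.eq_1, ← dy.eq_1, ca', cb']
    ring
  exact (hsplit.trans (setIntegral_add_exact it j1 j2 j3 j4 i1 i2 i3 i4)).symm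

end Variation

/-- The fundamental lemma of the calculus of variations: testing gives vanishing almost everywhere,
and continuity on an open set upgrades it to everywhere. -/
theorem eq_zero_of_forall_integral {W : Set (ℝ × ℝ)} (hW : IsOpen W) {f : ℝ × ℝ → ℝ}
    (hf : ContinuousOn f W) (h : ∀ g : ℝ × ℝ → ℝ, ContDiff ℝ ∞ g → HasCompactSupport g →
      tsupport g ⊆ W → ∫ r in tsupport g, f r * g r = 0) : ∀ r ∈ W, f r = 0 := by
  have hae := hW.ae_eq_zero_of_integral_contDiff_smul_eq_zero (μ := volume)
    (hf.locallyIntegrableOn hW.measurableSet) (fun g hg hc hs => by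
      rw [← h g hg hc hs, ← setIntegral_eq_integral_of_forall_compl_eq_zero (s := tsupport g)]
      · simp only [smul_eq_mul, mul_comm]
      · intro r hr
        rw [image_eq_zero_of_notMem_tsupport hr, zero_smul])
  have hae' : f =ᵐ[volume.restrict W] 0 := (ae_restrict_iff' hW.measurableSet).2 hae
  exact Measure.eqOn_open_of_ae_eq hae' hW hf continuousOn_const

/-- The wave-map equations into the metric `(du₁² - du₂²) / (1 + e^{-u₁})` in null coordinates. -/
theorem isHarmonicOn_iff {W : Set (ℝ × ℝ)} (hW : IsOpen W) {Φ : ℝ × ℝ → Fin 2 → ℝ}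
    (hΦ : ContDiffOn ℝ ∞ Φ W) :
    IsHarmonicOn minkowski targetMetric W Φ ↔
      SolvesSystem W (fun r => Φ r 0 + Φ r 1) (fun r => Φ r 0 - Φ r 1) := by
  have ha : ContDiffOn ℝ ∞ (fun r => Φ r 0) W := contDiffOn_pi.1 hΦ 0
  have hb : ContDiffOn ℝ ∞ (fun r => Φ r 1) W := contDiffOn_pi.1 hΦ 1
  obtain ⟨t1, t2⟩ := continuousOn_tension hW ha hb
  have harmonic_iff : IsHarmonicOn minkowski targetMetric W Φ ↔
      ∀ r ∈ W, tension₁ (fun r => Φ r 0) (fun r => Φ r 1) r = 0 ∧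
        tension₂ (fun r => Φ r 0) (fun r => Φ r 1) r = 0 := by
    constructor
    · rintro ⟨-, h⟩
      -- A variation `g • c` with constant direction `c`, taken over `K = tsupport g`: the computed
      -- first variation must equal the zero derivative given by criticality.
      have test : ∀ g : ℝ × ℝ → ℝ, ContDiff ℝ ∞ g → HasCompactSupport g → tsupport g ⊆ W →
          ∀ c : Fin 2 → ℝ, ∫ r in tsupport g, (tension₁ (fun r => Φ r 0) (fun r => Φ r 1) r *
            (g r * c 0) + tension₂ (fun r => Φ r 0) (fun r => Φ r 1) r * (g r * c 1)) = 0 := by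
        intro g hg hc hs c
        have hη : ContDiff ℝ ∞ fun r => g r • c := hg.smul contDiff_const
        have hsη : tsupport (fun r => g r • c) ⊆ tsupport g := tsupport_smul_subset_left g _
        exact (hasDerivAt_energy hW hc hs hΦ hη hsη).unique (h _ hc hs _ hη hsη)
      have z1 := eq_zero_of_forall_integral hW t1 fun g hg hc hs => by
        simpa using test g hg hc hs ![1, 0]
      have z2 := eq_zero_of_forall_integral hW t2 fun g hg hc hs => by
        simpa using test g hg hc hs ![0, 1]
      exact fun r hr => ⟨z1 r hr, z2 r hr⟩
    · intro h
      refine ⟨hΦ, fun K hK hKW η hη hs => ?_⟩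
      refine (hasDerivAt_energy hW hK hKW hΦ hη hs).congr_deriv ?_
      rw [← integral_zero (ℝ × ℝ) ℝ (μ := volume.restrict K)]
      refine setIntegral_congr_fun hK.measurableSet fun r hr => ?_
      simp [h r (hKW hr)]
  rw [harmonic_iff]
  set a : ℝ × ℝ → ℝ := fun r => Φ r 0 with ha_def
  set b : ℝ × ℝ → ℝ := fun r => Φ r 1 with hb_def
  have hadd : ∀ {f g : ℝ × ℝ → ℝ}, ContDiffOn ℝ ∞ f W → ContDiffOn ℝ ∞ g W → ∀ r ∈ W, ∀ v,
      fderiv ℝ (fun r => f r + g r) r v = fderiv ℝ f r v + fderiv ℝ g r v := by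
    intro f g hf hg r hr v
    rw [fderiv_fun_add (differentiableAt_of_contDiffOn hW hf hr)
      (differentiableAt_of_contDiffOn hW hg hr)]
    rfl
  have hsub : ∀ {f g : ℝ × ℝ → ℝ}, ContDiffOn ℝ ∞ f W → ContDiffOn ℝ ∞ g W → ∀ r ∈ W, ∀ v,
      fderiv ℝ (fun r => f r - g r) r v = fderiv ℝ f r v - fderiv ℝ g r v := by
    intro f g hf hg r hr v
    rw [fderiv_fun_sub (differentiableAt_of_contDiffOn hW hf hr)
      (differentiableAt_of_contDiffOn hW hg hr)]
    rfl
  have sax := contDiffOn_dx hW ha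
  have sbx := contDiffOn_dx hW hb
  refine forall₂_congr fun r hr => ?_
  have e1 : dy (dx fun r => a r + b r) r = dy (dx a) r + dy (dx b) r := by
    rw [dy_congr hW (f := dx fun r => a r + b r) (g := fun r => dx a r + dx b r)
      (fun s hs => hadd ha hb s hs _) hr]
    exact hadd sax sbx r hr _
  have e2 : dy (dx fun r => a r - b r) r = dy (dx a) r - dy (dx b) r := by
    rw [dy_congr hW (f := dx fun r => a r - b r) (g := fun r => dx a r - dx b r)
      (fun s hs => hsub ha hb s hs _) hr]
    exact hsub sax sbx r hr _
  have e3 : dx (fun r => a r + b r) r = dx a r + dx b r := hadd ha hb r hr _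
  have e4 : dy (fun r => a r + b r) r = dy a r + dy b r := hadd ha hb r hr _
  have e5 : dx (fun r => a r - b r) r = dx a r - dx b r := hsub ha hb r hr _
  have e6 : dy (fun r => a r - b r) r = dy a r - dy b r := hsub ha hb r hr _
  have e7 : (a r + b r) / 2 + (a r - b r) / 2 = a r := by ring
  change _ ↔ dy (dx fun r => a r + b r) r + dx (fun r => a r + b r) r * dy (fun r => a r + b r) r /
      (2 * (1 + Real.exp ((a r + b r) / 2 + (a r - b r) / 2))) = 0 ∧
    dy (dx fun r => a r - b r) r + dx (fun r => a r - b r) r * dy (fun r => a r - b r) r /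
      (2 * (1 + Real.exp ((a r + b r) / 2 + (a r - b r) / 2))) = 0
  rw [e1, e2, e3, e4, e5, e6, e7]
  have hc : conf (a r) = Real.exp (a r) / (1 + Real.exp (a r)) := by
    rw [conf, Real.exp_neg]; field_simp; ring
  have hc' : confDeriv (a r) = Real.exp (a r) / (1 + Real.exp (a r)) * (1 / (1 + Real.exp (a r))) := by
    rw [confDeriv, Real.exp_neg]; field_simp; ring
  have hpos : Real.exp (a r) / (1 + Real.exp (a r)) ≠ 0 := by positivity
  -- Dividing by the positive conformal factor `e^a / (1 + e^a)` brings both components to the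
  -- normalization of the system; the equivalence is then sum and difference.
  have k1 : tension₁ a b r = -(2 * (Real.exp (a r) / (1 + Real.exp (a r)))) * (dy (dx a) r +
      (dx a r * dy a r + dx b r * dy b r) / (2 * (1 + Real.exp (a r)))) := by
    rw [tension₁, hc, hc']; field_simp
  have k2 : tension₂ a b r = (2 * (Real.exp (a r) / (1 + Real.exp (a r)))) * (dy (dx b) r +
      (dx a r * dy b r + dy a r * dx b r) / (2 * (1 + Real.exp (a r)))) := by
    rw [tension₂, hc, hc']; field_simp
  rw [k1, k2, mul_eq_zero_iff_left (neg_ne_zero.2 (mul_ne_zero two_ne_zero hpos)),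
    mul_eq_zero_iff_left (mul_ne_zero two_ne_zero hpos)]
  constructor
  · rintro ⟨h1, h2⟩
    exact ⟨by linear_combination h1 + h2, by linear_combination h1 - h2⟩
  · rintro ⟨h1, h2⟩
    exact ⟨by linear_combination (h1 + h2) / 2, by linear_combination (h1 - h2) / 2⟩

end WaveLie

namespace WaveLie

/-! ### Neighbourhoods of the curve that are unions of characteristic squares -/

/-- The witness is `s` clamped to the interval between `x₁` and `x₂`. -/
theorem exists_mem_uIcc_dist_lt {x₁ x₂ y₁ y₂ s δ : ℝ} (h₁ : |y₁ - x₁| < δ) (h₂ : |y₂ - x₂| < δ)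
    (hs : s ∈ uIcc y₁ y₂) : ∃ a ∈ uIcc x₁ x₂, |s - a| < δ := by
  rw [abs_lt] at h₁ h₂
  rw [mem_uIcc] at hs
  simp only [mem_uIcc, abs_lt]
  rcases le_total x₁ x₂ with h | h
  · by_cases c1 : s < x₁
    · exact ⟨x₁, Or.inl ⟨le_rfl, h⟩, by rcases hs with hs | hs <;> constructor <;> linarith⟩
    · by_cases c2 : x₂ < s
      · exact ⟨x₂, Or.inl ⟨h, le_rfl⟩, by rcases hs with hs | hs <;> constructor <;> linarith⟩
      · exact ⟨s, Or.inl ⟨not_lt.1 c1, not_lt.1 c2⟩, by constructor <;> linarith⟩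
  · by_cases c1 : s < x₂
    · exact ⟨x₂, Or.inr ⟨le_rfl, h⟩, by rcases hs with hs | hs <;> constructor <;> linarith⟩
    · by_cases c2 : x₁ < s
      · exact ⟨x₁, Or.inr ⟨h, le_rfl⟩, by rcases hs with hs | hs <;> constructor <;> linarith⟩
      · exact ⟨s, Or.inr ⟨not_lt.1 c1, not_lt.1 c2⟩, by constructor <;> linarith⟩

/-- A compact square inside `V` has a uniform margin `δ`, and moving its two parameters by less than
`δ` keeps the new square within that margin. -/
theorem isOpen_setOf_square_subset {V : Set (ℝ × ℝ)} (hV : IsOpen V) :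
    IsOpen {x : ℝ × ℝ | ∀ s ∈ uIcc x.1 x.2, ∀ t ∈ uIcc x.1 x.2, (s, t) ∈ V} := by
  rw [Metric.isOpen_iff]
  intro x hx
  have hK : IsCompact (uIcc x.1 x.2 ×ˢ uIcc x.1 x.2) := isCompact_uIcc.prod isCompact_uIcc
  obtain ⟨δ, hδ, hsub⟩ := hK.exists_thickening_subset_open hV fun y hy => hx _ hy.1 _ hy.2
  refine ⟨δ, hδ, fun y hy s hs t ht => hsub ?_⟩
  rw [Metric.mem_ball, Prod.dist_eq, max_lt_iff, Real.dist_eq, Real.dist_eq] at hy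
  obtain ⟨a, ha, has⟩ := exists_mem_uIcc_dist_lt hy.1 hy.2 hs
  obtain ⟨b, hb, hbt⟩ := exists_mem_uIcc_dist_lt hy.1 hy.2 ht
  rw [Metric.mem_thickening_iff]
  refine ⟨(a, b), ⟨ha, hb⟩, ?_⟩
  rw [Prod.dist_eq, max_lt_iff, Real.dist_eq, Real.dist_eq]
  exact ⟨has, hbt⟩

/-- `W` consists of the points `(p s, q t)` whose whole characteristic square, with parameters
between `s` and `t`, lies in `V`. Subsquares inherit the property, so each such square lies in `W`
itself; its side `x = p s` joins the point to `γ s`. -/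
theorem CauchyData.exists_nhds (C : CauchyData) {V : Set (ℝ × ℝ)} (hV : IsOpen V)
    (hCV : C.curve ⊆ V) : ∃ W : Set (ℝ × ℝ), IsOpen W ∧ C.curve ⊆ W ∧ W ⊆ V ∧
      C.VerticallyJoined W ∧ ∀ r ∈ W, ∃ s ∈ C.I, ∃ t ∈ C.I, r = (C.p s, C.q t) ∧
        ∀ s' ∈ uIcc s t, ∀ t' ∈ uIcc s t, (C.p s', C.q t') ∈ W := by
  obtain ⟨hSo, -, π, hπ, hπp⟩ := exists_smooth_inverse C.isOpen_I C.interval_I C.smooth_p C.p_deriv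
  obtain ⟨hTo, -, σ, hσ, hσq⟩ := exists_smooth_inverse C.isOpen_I C.interval_I C.smooth_q C.q_deriv
  let W : Set (ℝ × ℝ) := {r | ∃ s ∈ C.I, ∃ t ∈ C.I, r = (C.p s, C.q t) ∧
    ∀ s' ∈ uIcc s t, ∀ t' ∈ uIcc s t, (C.p s', C.q t') ∈ V}
  have hsq : ∀ s ∈ C.I, ∀ t ∈ C.I,
      (∀ s' ∈ uIcc s t, ∀ t' ∈ uIcc s t, (C.p s', C.q t') ∈ V) →
      ∀ s' ∈ uIcc s t, ∀ t' ∈ uIcc s t, (C.p s', C.q t') ∈ W := by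
    intro s hs t ht h s' hs' t' ht'
    have hI := C.interval_I.uIcc_subset hs ht
    exact ⟨s', hI hs', t', hI ht', rfl, fun a ha b hb =>
      h a (uIcc_subset_uIcc hs' ht' ha) b (uIcc_subset_uIcc hs' ht' hb)⟩
  let V' : Set (ℝ × ℝ) := (C.I ×ˢ C.I) ∩ (fun x : ℝ × ℝ => (C.p x.1, C.q x.2)) ⁻¹' V
  have hV' : IsOpen V' := by
    refine ContinuousOn.isOpen_inter_preimage ?_ (C.isOpen_I.prod C.isOpen_I) hV
    exact (C.smooth_p.continuousOn.comp continuousOn_fst fun x hx => hx.1).prodMk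
      (C.smooth_q.continuousOn.comp continuousOn_snd fun x hx => hx.2)
  have hWeq : W = ((C.p '' C.I) ×ˢ (C.q '' C.I)) ∩ (fun r : ℝ × ℝ => (π r.1, σ r.2)) ⁻¹'
      {x : ℝ × ℝ | ∀ s ∈ uIcc x.1 x.2, ∀ t ∈ uIcc x.1 x.2, (s, t) ∈ V'} := by
    ext r
    constructor
    · rintro ⟨s, hs, t, ht, rfl, h⟩
      refine ⟨⟨mem_image_of_mem _ hs, mem_image_of_mem _ ht⟩, ?_⟩
      simp only [mem_preimage, mem_ofPred_eq, hπp s hs, hσq t ht]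
      have hI := C.interval_I.uIcc_subset hs ht
      exact fun s' hs' t' ht' => ⟨⟨hI hs', hI ht'⟩, h s' hs' t' ht'⟩
    · obtain ⟨x, y⟩ := r
      rintro ⟨⟨⟨s, hs, hsx⟩, ⟨t, ht, hty⟩⟩, h⟩
      simp only at hsx hty
      subst hsx hty
      simp only [mem_preimage, mem_ofPred_eq, hπp s hs, hσq t ht] at h
      exact ⟨s, hs, t, ht, rfl, fun s' hs' t' ht' => (h s' hs' t' ht').2⟩
  refine ⟨W, ?_, ?_, ?_, ?_, ?_⟩
  · rw [hWeq]
    refine ContinuousOn.isOpen_inter_preimage ?_ (hSo.prod hTo) (isOpen_setOf_square_subset hV')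
    exact (hπ.continuousOn.comp continuousOn_fst fun x hx => hx.1).prodMk
      (hσ.continuousOn.comp continuousOn_snd fun x hx => hx.2)
  · rintro _ ⟨t, ht, rfl⟩
    refine ⟨t, ht, t, ht, rfl, fun s' hs' t' ht' => ?_⟩
    rw [uIcc_self, mem_singleton_iff] at hs' ht'
    rw [hs', ht']
    exact hCV (C.pt_mem_curve ht)
  · rintro _ ⟨s, hs, t, ht, rfl, h⟩
    exact h s left_mem_uIcc t right_mem_uIcc
  · rintro _ ⟨s, hs, t, ht, rfl, h⟩
    refine ⟨mem_image_of_mem _ ht, s, hs, rfl, fun y hy => ?_⟩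
    have hI := C.interval_I.uIcc_subset hs ht
    obtain ⟨t', ht', rfl⟩ := intermediate_value_uIcc (C.smooth_q.continuousOn.mono hI) hy
    exact hsq s hs t ht h s left_mem_uIcc t' ht'
  · rintro _ ⟨s, hs, t, ht, rfl, h⟩
    exact ⟨s, hs, t, ht, rfl, hsq s hs t ht h⟩

/-! ### From the matrix equation to the hyperbolic system -/

section Loop

variable {S T W : Set ℝ} {A P Q B : ℝ × ℝ → ℝ} {l₁ l₂ m₁ m₂ : ℝ → ℝ}

theorem dx_two_log {f : ℝ × ℝ → ℝ} {r : ℝ × ℝ} (hf : DifferentiableAt ℝ f r) (h0 : f r ≠ 0) :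
    dx (fun r => 2 * Real.log (f r)) r = 2 * dx f r / f r := by
  have hd : DifferentiableAt ℝ (fun r => 2 * Real.log (f r)) r := (hf.log h0).const_mul 2
  exact (dx_eq_of_hasDerivAt (x := r.1) (y := r.2) hd
    (((hasDerivAt_fst hf).log h0).const_mul 2)).trans (by ring)

theorem dy_two_log {f : ℝ × ℝ → ℝ} {r : ℝ × ℝ} (hf : DifferentiableAt ℝ f r) (h0 : f r ≠ 0) :
    dy (fun r => 2 * Real.log (f r)) r = 2 * dy f r / f r := by
  have hd : DifferentiableAt ℝ (fun r => 2 * Real.log (f r)) r := (hf.log h0).const_mul 2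
  exact (dy_eq_of_hasDerivAt (x := r.1) (y := r.2) hd
    (((hasDerivAt_snd hf).log h0).const_mul 2)).trans (by ring)

theorem exp_two_log_div_two {a : ℝ} (ha : 0 < a) : Real.exp (2 * Real.log a / 2) = a := by
  rw [mul_div_cancel_left₀ _ (two_ne_zero), Real.exp_log ha]

theorem dy_eq_of_eqOn {W : Set (ℝ × ℝ)} (hW : IsOpen W) {f g : ℝ × ℝ → ℝ}
    (hf : ContDiffOn ℝ ∞ f W) (h : EqOn f g W) {r : ℝ × ℝ} (hr : r ∈ W) {d : ℝ}
    (hd : HasDerivAt (fun s => g (r.1, s)) d r.2) : dy f r = d := by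
  refine dy_eq_of_hasDerivAt (x := r.1) (y := r.2) (differentiableAt_of_contDiffOn hW hf hr)
    (hd.congr_of_eventuallyEq ?_)
  have hc : Continuous fun s : ℝ => (r.1, s) := by fun_prop
  filter_upwards [(hW.preimage hc).mem_nhds hr] with s hs
  exact h hs

/-- The logarithms `u = 2 log P`, `v = 2 log Q` of the off-diagonal entries, with the partial
derivatives that the matrix equations give. -/
theorem IsLoopSolution.logs {S T : Set ℝ} (hS : IsOpen S) (hT : IsOpen T)
    (h : IsLoopSolution S T A P Q B l₁ l₂ m₁ m₂) {W : Set (ℝ × ℝ)} (hW : IsOpen W)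
    (hWS : W ⊆ S ×ˢ T) (hP : ∀ r ∈ W, 0 < P r) (hQ : ∀ r ∈ W, 0 < Q r) :
    let u : ℝ × ℝ → ℝ := fun r => 2 * Real.log (P r)
    let v : ℝ × ℝ → ℝ := fun r => 2 * Real.log (Q r)
    ContDiffOn ℝ ∞ u W ∧ ContDiffOn ℝ ∞ v W ∧ SolvesSystem W u v ∧
      ∀ r ∈ W, Real.exp (u r / 2) = P r ∧ Real.exp (v r / 2) = Q r ∧
        dx u r = 2 * l₁ r.1 * B r / P r ∧ dy u r = 2 * m₁ r.2 * A r / P r ∧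
        dx v r = 2 * l₂ r.1 * A r / Q r ∧ dy v r = 2 * m₂ r.2 * B r / Q r ∧
        HasDerivAt (fun s => dy u (r.1, s)) (2 * deriv m₁ r.2 * A r / P r + 2 * m₁ r.2 * m₂ r.2 -
          2 * m₁ r.2 ^ 2 * A r ^ 2 / P r ^ 2) r.2 ∧
        HasDerivAt (fun s => dx v (r.1, s)) (-(2 * l₂ r.1 * m₂ r.2) / Q r ^ 2) r.2 := by
  intro u v
  have hO := hS.prod hT
  have dA : ∀ r ∈ W, DifferentiableAt ℝ A r := fun r hr =>
    differentiableAt_of_contDiffOn hO h.smooth_A (hWS hr)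
  have dB : ∀ r ∈ W, DifferentiableAt ℝ B r := fun r hr =>
    differentiableAt_of_contDiffOn hO h.smooth_B (hWS hr)
  have dP : ∀ r ∈ W, DifferentiableAt ℝ P r := fun r hr =>
    differentiableAt_of_contDiffOn hO h.smooth_P (hWS hr)
  have dQ : ∀ r ∈ W, DifferentiableAt ℝ Q r := fun r hr =>
    differentiableAt_of_contDiffOn hO h.smooth_Q (hWS hr)
  have su : ContDiffOn ℝ ∞ u W :=
    contDiffOn_const.mul ((h.smooth_P.mono hWS).log fun r hr => (hP r hr).ne')
  have sv : ContDiffOn ℝ ∞ v W :=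
    contDiffOn_const.mul ((h.smooth_Q.mono hWS).log fun r hr => (hQ r hr).ne')
  have ux : ∀ r ∈ W, dx u r = 2 * l₁ r.1 * B r / P r := fun r hr => by
    rw [dx_two_log (dP r hr) (hP r hr).ne', h.dx_P r (hWS hr), mul_assoc]
  have uy : ∀ r ∈ W, dy u r = 2 * m₁ r.2 * A r / P r := fun r hr => by
    rw [dy_two_log (dP r hr) (hP r hr).ne', h.dy_P r (hWS hr), mul_assoc]
  have vx : ∀ r ∈ W, dx v r = 2 * l₂ r.1 * A r / Q r := fun r hr => by
    rw [dx_two_log (dQ r hr) (hQ r hr).ne', h.dx_Q r (hWS hr), mul_assoc]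
  have vy : ∀ r ∈ W, dy v r = 2 * m₂ r.2 * B r / Q r := fun r hr => by
    rw [dy_two_log (dQ r hr) (hQ r hr).ne', h.dy_Q r (hWS hr), mul_assoc]
  have eu : ∀ r ∈ W, Real.exp (u r / 2) = P r := fun r hr => exp_two_log_div_two (hP r hr)
  have ev : ∀ r ∈ W, Real.exp (v r / 2) = Q r := fun r hr => exp_two_log_div_two (hQ r hr)
  have yA : ∀ r ∈ W, HasDerivAt (fun s => A (r.1, s)) (m₂ r.2 * P r) r.2 := fun r hr =>
    (hasDerivAt_snd (dA r hr)).congr_deriv (h.dy_A r (hWS hr))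
  have yP : ∀ r ∈ W, HasDerivAt (fun s => P (r.1, s)) (m₁ r.2 * A r) r.2 := fun r hr =>
    (hasDerivAt_snd (dP r hr)).congr_deriv (h.dy_P r (hWS hr))
  have yQ : ∀ r ∈ W, HasDerivAt (fun s => Q (r.1, s)) (m₂ r.2 * B r) r.2 := fun r hr =>
    (hasDerivAt_snd (dQ r hr)).congr_deriv (h.dy_Q r (hWS hr))
  have yB : ∀ r ∈ W, HasDerivAt (fun s => B (r.1, s)) (m₁ r.2 * Q r) r.2 := fun r hr =>
    (hasDerivAt_snd (dB r hr)).congr_deriv (h.dy_B r (hWS hr))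
  have uxy : ∀ r ∈ W, dy (dx u) r = -(2 * l₁ r.1 * m₁ r.2) / P r ^ 2 := by
    intro r hr
    have hp := (hP r hr).ne'
    refine (dy_eq_of_eqOn hW (contDiffOn_dx hW su) ux hr
      (((yB r hr).const_mul (2 * l₁ r.1)).fun_div (yP r hr) hp)).trans ?_
    simp only [Prod.mk.eta]
    congr 1
    linear_combination (-(2 * l₁ r.1 * m₁ r.2)) * h.det r (hWS hr)
  have vxy' : ∀ r ∈ W, HasDerivAt (fun s => 2 * l₂ r.1 * A (r.1, s) / Q (r.1, s))
      (-(2 * l₂ r.1 * m₂ r.2) / Q r ^ 2) r.2 := by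
    intro r hr
    have hq := (hQ r hr).ne'
    refine (((yA r hr).const_mul (2 * l₂ r.1)).fun_div (yQ r hr) hq).congr_deriv ?_
    simp only [Prod.mk.eta]
    congr 1
    linear_combination (-(2 * l₂ r.1 * m₂ r.2)) * h.det r (hWS hr)
  have vxy : ∀ r ∈ W, dy (dx v) r = -(2 * l₂ r.1 * m₂ r.2) / Q r ^ 2 := fun r hr =>
    dy_eq_of_eqOn hW (contDiffOn_dx hW sv) vx hr (vxy' r hr)
  have uyy : ∀ r ∈ W, dy (dy u) r = 2 * deriv m₁ r.2 * A r / P r + 2 * m₁ r.2 * m₂ r.2 -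
      2 * m₁ r.2 ^ 2 * A r ^ 2 / P r ^ 2 := by
    intro r hr
    have hp := (hP r hr).ne'
    have dm : HasDerivAt m₁ (deriv m₁ r.2) r.2 :=
      ((h.smooth_m₁.contDiffAt (hT.mem_nhds (hWS hr).2)).differentiableAt (by simp)).hasDerivAt
    refine (dy_eq_of_eqOn hW (contDiffOn_dy hW su) uy hr
      (((dm.const_mul 2).fun_mul (yA r hr)).fun_div (yP r hr) hp)).trans ?_
    simp only [Prod.mk.eta]
    field_simp
  refine ⟨su, sv, fun r hr => ?_, fun r hr => ⟨eu r hr, ev r hr, ux r hr, uy r hr, vx r hr,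
    vy r hr, ?_, ?_⟩⟩
  · have hp := (hP r hr).ne'
    have hq := (hQ r hr).ne'
    have hpq : 1 + P r * Q r ≠ 0 := by have := hP r hr; have := hQ r hr; positivity
    have hdet := h.det r (hWS hr)
    rw [Real.exp_add, eu r hr, ev r hr, uxy r hr, vxy r hr, ux r hr, uy r hr, vx r hr, vy r hr]
    -- Replacing `1 + P Q` by `A B` makes the quadratic term cancel the mixed derivative.
    rw [← hdet] at hpq ⊢
    have hA := left_ne_zero_of_mul hpq
    have hB := right_ne_zero_of_mul hpq
    constructor <;> field_simp <;> ring
  · rw [← uyy r hr]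
    exact hasDerivAt_snd (differentiableAt_of_contDiffOn hW (contDiffOn_dy hW su) hr)
  · rw [← vxy r hr]
    exact hasDerivAt_snd (differentiableAt_of_contDiffOn hW (contDiffOn_dx hW sv) hr)

end Loop

/-! ### The Cauchy vector field -/

theorem cauchyField_apply (k₁ k₂ : ℝ → ℝ) (y : ℝ) (z : E4) : cauchyField k₁ k₂ y z =
    ![z 0 * z 2 / 2, k₁ y / 2 * ((1 + z 0 * z 1) / (z 0 * z 2)),
      k₂ y / 2 * z 2 + k₁ y / 2 - z 2 ^ 2 / 2, -(k₁ y / 2 * (z 3 / (z 0 * z 1 * z 2)))] := by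
  ext i
  fin_cases i <;> simp [cauchyField, R₁, R₂, R₃, R₄] <;> ring

theorem cauchyField_mem (k₁ k₂ : ℝ → ℝ) (y : ℝ) : cauchyField k₁ k₂ y ∈ vessiotAlgebra := by
  have h1 : R₁ ∈ vessiotAlgebra := Submodule.subset_span (by simp)
  have h2 : R₂ ∈ vessiotAlgebra := Submodule.subset_span (by simp)
  have h3 : R₃ ∈ vessiotAlgebra := Submodule.subset_span (by simp)
  have h4 : R₄ ∈ vessiotAlgebra := Submodule.subset_span (by simp)
  exact add_mem (add_mem (Submodule.smul_mem _ _ (add_mem h1 (Submodule.smul_mem _ _ h4)))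
    (Submodule.smul_mem _ _ h2)) (Submodule.smul_mem _ _ h3)

/-- The field is not linear, but it is triangular after a change of variables: `z₁` and `z₁ z₃`
solve a planar linear system with coefficients depending on `y` only. Given these, the equation for
`z₂` is affine and, given `z₂`, that for `z₄` is linear. A Gronwall estimate applies at each stage.
-/
theorem integralCurve_unique {k₁ k₂ : ℝ → ℝ} {a b : ℝ} (hk₁ : ContinuousOn k₁ (uIcc a b))
    (hk₂ : ContinuousOn k₂ (uIcc a b)) {f g : ℝ → E4}
    (hf : ∀ s ∈ uIcc a b, f s ∈ chart ∧ HasDerivAt f (cauchyField k₁ k₂ s (f s)) s)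
    (hg : ∀ s ∈ uIcc a b, g s ∈ chart ∧ HasDerivAt g (cauchyField k₁ k₂ s (g s)) s)
    (h0 : f a = g a) : f b = g b := by
  have hfd : ∀ s ∈ uIcc a b, ∀ i, HasDerivAt (fun s => f s i) (cauchyField k₁ k₂ s (f s) i) s :=
    fun s hs i => hasDerivAt_pi.1 (hf s hs).2 i
  have hgd : ∀ s ∈ uIcc a b, ∀ i, HasDerivAt (fun s => g s i) (cauchyField k₁ k₂ s (g s) i) s :=
    fun s hs i => hasDerivAt_pi.1 (hg s hs).2 i
  simp only [cauchyField_apply] at hfd hgd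
  have hsub : ∀ s ∈ uIcc a b, uIcc a s ⊆ uIcc a b := fun s hs => uIcc_subset_uIcc_left hs
  have hcf : ∀ i, ContinuousOn (fun s => f s i) (uIcc a b) := fun i s hs =>
    (hfd s hs i).continuousAt.continuousWithinAt
  have eq_fst_thd : ∀ s ∈ uIcc a b, f s 0 = g s 0 ∧ f s 2 = g s 2 := by
    intro b' hb'
    let D : ℝ → ℝ × ℝ := fun s => (f s 0 - g s 0, f s 0 * f s 2 - g s 0 * g s 2)
    have hD : D b' = 0 := by
      refine eq_zero_of_norm_deriv_le (a := a) (f := D)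
        (f' := fun s => ((D s).2 / 2, k₂ s / 2 * (D s).2 + k₁ s / 2 * (D s).1))
        (K := fun s => 1 + |k₂ s / 2| + |k₁ s / 2|) ?_ ?_ ?_ ?_
      · intro s hs
        have hs := hsub b' hb' hs
        have f0 := hfd s hs 0
        have f2 := hfd s hs 2
        have g0 := hgd s hs 0
        have g2 := hgd s hs 2
        refine ((f0.sub g0).prodMk ((f0.mul f2).sub (g0.mul g2))).congr_deriv ?_
        refine Prod.ext ?_ ?_ <;> simp [D] <;> ring
      · exact (((continuousOn_const.add (hk₂.div_const 2).abs).add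
          (hk₁.div_const 2).abs)).mono (hsub b' hb')
      · intro s _
        have n1 : |(D s).1| ≤ ‖D s‖ := norm_fst_le (D s)
        have n2 : |(D s).2| ≤ ‖D s‖ := norm_snd_le (D s)
        have hn := norm_nonneg (D s)
        have q1 := mul_nonneg (abs_nonneg (k₁ s / 2)) hn
        have q2 := mul_nonneg (abs_nonneg (k₂ s / 2)) hn
        refine norm_prod_le_iff.2 ⟨?_, ?_⟩
        · change |(D s).2 / 2| ≤ _
          rw [abs_div, abs_two]
          linarith
        · change |k₂ s / 2 * (D s).2 + k₁ s / 2 * (D s).1| ≤ _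
          refine (abs_add_le _ _).trans ?_
          rw [abs_mul, abs_mul]
          have p1 := mul_le_mul_of_nonneg_left n1 (abs_nonneg (k₁ s / 2))
          have p2 := mul_le_mul_of_nonneg_left n2 (abs_nonneg (k₂ s / 2))
          linarith
      · simp [D, h0]
    have h1 : (D b').1 = 0 := by rw [hD]; rfl
    have h2 : (D b').2 = 0 := by rw [hD]; rfl
    have e1 : f b' 0 = g b' 0 := sub_eq_zero.1 h1
    have e2 : f b' 0 * f b' 2 = g b' 0 * g b' 2 := sub_eq_zero.1 h2
    rw [← e1] at e2
    exact ⟨e1, mul_left_cancel₀ (hf b' hb').1.1.ne' e2⟩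
  have eq_snd : ∀ s ∈ uIcc a b, f s 1 = g s 1 := by
    intro b' hb'
    refine sub_eq_zero.1 (eq_zero_of_norm_deriv_le (a := a) (f := fun s => f s 1 - g s 1)
      (f' := fun s => k₁ s / 2 / f s 2 * (f s 1 - g s 1)) (K := fun s => |k₁ s / 2 / f s 2|)
      ?_ ?_ ?_ ?_)
    · intro s hs
      have hs := hsub b' hb' hs
      obtain ⟨e0, e2⟩ := eq_fst_thd s hs
      obtain ⟨c0, c1, c2⟩ := (hf s hs).1
      refine ((hfd s hs 1).sub (hgd s hs 1)).congr_deriv ?_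
      simp [← e0, ← e2]
      field_simp
      ring
    · exact (((hk₁.div_const 2).div (hcf 2) fun s hs => (hf s hs).1.2.2).abs).mono (hsub b' hb')
    · intro s _
      rw [norm_mul]
      rfl
    · simp [h0]
  have eq_fth : f b 3 = g b 3 := by
    refine sub_eq_zero.1 (eq_zero_of_norm_deriv_le (a := a) (f := fun s => f s 3 - g s 3)
      (f' := fun s => -(k₁ s / 2 / (f s 0 * f s 1 * f s 2)) * (f s 3 - g s 3))
      (K := fun s => |-(k₁ s / 2 / (f s 0 * f s 1 * f s 2))|) ?_ ?_ ?_ ?_)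
    · intro s hs
      obtain ⟨e0, e2⟩ := eq_fst_thd s hs
      have e1 := eq_snd s hs
      obtain ⟨c0, c1, c2⟩ := (hf s hs).1
      refine ((hfd s hs 3).sub (hgd s hs 3)).congr_deriv ?_
      simp [← e0, ← e2, ← e1]
      field_simp
      ring
    · exact ((hk₁.div_const 2).div (((hcf 0).mul (hcf 1)).mul (hcf 2)) fun s hs =>
        mul_ne_zero (mul_ne_zero (hf s hs).1.1.ne' (hf s hs).1.2.1.ne') (hf s hs).1.2.2).neg.abs
    · intro s _
      rw [norm_mul]
      rfl
    · simp [h0]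
  ext i
  fin_cases i
  exacts [(eq_fst_thd b right_mem_uIcc).1, eq_snd b right_mem_uIcc, (eq_fst_thd b right_mem_uIcc).2, eq_fth]

theorem rescale_mem_chart {z : E4} (hz : z ∈ chart) (s : ℝ) : rescale s z ∈ chart :=
  ⟨mul_pos (Real.exp_pos _) hz.1, mul_pos (Real.exp_pos _) hz.2.1, hz.2.2⟩

/-- Since `R₄` is central, the rescaling, which is its flow, preserves `R₁, R₂, R₃`. The choice `g'
= -k₂ / 4` contributes `k₂ R₄` and cancels the `R₄` term of the Cauchy field. -/
theorem hasDerivAt_rescale {k₁ k₂ g : ℝ → ℝ} {Z : ℝ → E4} {y : ℝ} (hz : Z y ∈ chart)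
    (hZ : HasDerivAt Z (cauchyField k₁ k₂ y (Z y)) y) (hg : HasDerivAt g (-(k₂ y / 4)) y) :
    HasDerivAt (fun s => rescale (g s) (Z s))
      (fieldOf (lieCurve k₁ k₂ y) (rescale (g y) (Z y))) y := by
  have hd : ∀ i, HasDerivAt (fun s => Z s i) (cauchyField k₁ k₂ y (Z y) i) y :=
    fun i => hasDerivAt_pi.1 hZ i
  simp only [cauchyField_apply] at hd
  obtain ⟨h0, h1, h2⟩ := hz
  rw [hasDerivAt_pi]
  intro i
  fin_cases i
  · refine (hg.exp.mul (hd 0)).congr_deriv ?_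
    simp [fieldOf, lieCurve, rescale, R₁, R₂, R₃]
    ring
  · refine (hg.neg.exp.mul (hd 1)).congr_deriv ?_
    simp [fieldOf, lieCurve, rescale, R₁, R₂, R₃, Real.exp_neg]
    field_simp
    ring
  · refine (hd 2).congr_deriv ?_
    simp [fieldOf, lieCurve, rescale, R₁, R₂, R₃]
    ring
  · refine (hd 3).congr_deriv ?_
    simp [fieldOf, lieCurve, rescale, R₁, R₂, R₃, Real.exp_neg]
    field_simp
    simp

theorem contDiffOn_lieCurve {k₁ k₂ : ℝ → ℝ} {J : Set ℝ} (hk₁ : ContDiffOn ℝ ∞ k₁ J)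
    (hk₂ : ContDiffOn ℝ ∞ k₂ J) :
    ContDiffOn ℝ ∞ (fun y i j => (lieCurve k₁ k₂ y).1 i j : ℝ → Fin 2 → Fin 2 → ℝ) J := by
  rw [contDiffOn_pi]
  intro i
  rw [contDiffOn_pi]
  intro j
  fin_cases i <;> fin_cases j <;> simp [lieCurve]
  · exact hk₂.div_const 4
  · exact hk₁.div_const 2
  · exact contDiffOn_const
  · exact (hk₂.div_const 4).neg

end WaveLie

namespace WaveLie

namespace CauchyData

variable {C : CauchyData}

/-! ### The coefficients determined by the data -/

theorem Nondegenerate.exists_coefficients (hC : C.Nondegenerate) :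
    ∃ k₁ k₂ : ℝ → ℝ, C.AreCoefficients k₁ k₂ := by
  obtain ⟨-, -, σ, hσ, hσq⟩ := exists_smooth_inverse C.isOpen_I C.interval_I C.smooth_q C.q_deriv
  have hσI : MapsTo σ (C.q '' C.I) C.I := by rintro _ ⟨t, ht, rfl⟩; rw [hσq t ht]; exact ht
  have sux : ContDiffOn ℝ ∞ C.ux C.I := C.smooth_liftX C.smooth_φ₁ C.smooth_ψ₁
  have suy : ContDiffOn ℝ ∞ C.uy C.I := C.smooth_liftY C.smooth_φ₁ C.smooth_ψ₁
  have svy : ContDiffOn ℝ ∞ C.vy C.I := C.smooth_liftY C.smooth_φ₂ C.smooth_ψ₂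
  have s1 : ContDiffOn ℝ ∞ C.inv₁ C.I := (suy.mul svy).div
    (contDiffOn_const.add (((C.smooth_φ₁.add C.smooth_φ₂).div_const 2).neg.exp)) fun t _ => by
      positivity
  have suxy : ContDiffOn ℝ ∞ C.uxy C.I := (sux.mul suy).neg.div
    (contDiffOn_const.mul (contDiffOn_const.add
      (((C.smooth_φ₁.div_const 2).add (C.smooth_φ₂.div_const 2)).exp))) fun t _ => by positivity
  have suyy : ContDiffOn ℝ ∞ C.uyy C.I := ((C.smooth_deriv suy).sub
    (suxy.mul (C.smooth_deriv C.smooth_p))).div (C.smooth_deriv C.smooth_q) C.q_deriv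
  have s2 : ContDiffOn ℝ ∞ C.inv₂ C.I :=
    (((contDiffOn_const.mul suyy).add (suy.pow 2)).sub s1).div suy hC
  exact ⟨C.inv₁ ∘ σ, C.inv₂ ∘ σ, s1.comp hσ hσI, s2.comp hσ hσI, fun t ht => by
    simp only [Function.comp_apply, hσq t ht, and_self]⟩

/-- Differentiating `u_y` along `γ` yields `u_xy p' + u_yy q'`; the equation supplies `u_xy`, and
`q' ≠ 0` allows solving for `u_yy`. -/
theorem IsSolution.uyy_eq {W : Set (ℝ × ℝ)} (hW : IsOpen W) (hCW : C.curve ⊆ W)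
    {u v : ℝ × ℝ → ℝ} (h : C.IsSolution W u v) {t : ℝ} (ht : t ∈ C.I) :
    C.uyy t = dy (dy u) (C.pt t) := by
  obtain ⟨hu, hv, hsys, hau, hav⟩ := h
  have hm := hCW (C.pt_mem_curve ht)
  have h1 : (fun t => dy u (C.p t, C.q t)) =ᶠ[nhds t] C.uy := by
    filter_upwards [C.isOpen_I.mem_nhds ht] with s hs
    exact (hau.partials hW hCW hu hs).2
  have h2 := (hasDerivAt_comp_curve (differentiableAt_of_contDiffOn hW (contDiffOn_dy hW hu) hm)
    (C.hasDerivAt_p ht) (C.hasDerivAt_q ht)).deriv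
  rw [h1.deriv_eq] at h2
  have h3 : C.uxy t = dy (dx u) (C.pt t) := by
    obtain ⟨e1, e2⟩ := hau.partials hW hCW hu ht
    rw [(hsys.mixed hm).1, mixedRhs, e1, e2, (hau t ht).1, (hav t ht).1]
    rfl
  rw [uyy, h2, h3, div_eq_iff (C.q_deriv t ht)]
  change dx (dy u) (C.pt t) * _ + _ - _ = _
  rw [dx_dy_comm hW hu hm]
  change _ + dy (dy u) (C.pt t) * _ - _ = _
  ring

theorem Attains.lincomb {W : Set (ℝ × ℝ)} (hW : IsOpen W) (hCW : C.curve ⊆ W)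
    {f₁ f₂ : ℝ × ℝ → ℝ} (hf₁ : ContDiffOn ℝ ∞ f₁ W) (hf₂ : ContDiffOn ℝ ∞ f₂ W)
    {φ₁ φ₂ ψ₁ ψ₂ : ℝ → ℝ} (h₁ : C.Attains f₁ φ₁ ψ₁) (h₂ : C.Attains f₂ φ₂ ψ₂) (a b : ℝ) :
    C.Attains (fun r => a * f₁ r + b * f₂ r) (fun t => a * φ₁ t + b * φ₂ t)
      (fun t => a * ψ₁ t + b * ψ₂ t) := by
  intro t ht
  have hm := hCW (C.pt_mem_curve ht)
  have d₁ := differentiableAt_of_contDiffOn hW hf₁ hm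
  have d₂ := differentiableAt_of_contDiffOn hW hf₂ hm
  refine ⟨by simp only [(h₁ t ht).1, (h₂ t ht).1], ?_⟩
  rw [fderiv_fun_add (d₁.const_mul a) (d₂.const_mul b), fderiv_const_mul d₁, fderiv_const_mul d₂]
  simp [(h₁ t ht).2, (h₂ t ht).2]

/-! ### The wave-map Cauchy problem -/

theorem IsSolution.isWaveMapSolution {W : Set (ℝ × ℝ)} (hW : IsOpen W) (hCW : C.curve ⊆ W)
    {u v : ℝ × ℝ → ℝ} (h : C.IsSolution W u v) :
    C.IsWaveMapSolution W (fun r => ![(u r + v r) / 2, (u r - v r) / 2]) := by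
  obtain ⟨hu, hv, hsys, hau, hav⟩ := h
  have hΦ : ContDiffOn ℝ ∞ (fun r => ![(u r + v r) / 2, (u r - v r) / 2]) W := by
    rw [contDiffOn_pi]
    intro i
    fin_cases i
    · exact (hu.add hv).div_const 2
    · exact (hu.sub hv).div_const 2
  refine ⟨(isHarmonicOn_iff hW hΦ).2 ?_, ?_, ?_⟩
  · convert hsys using 2 with r r
    · simp only [Matrix.cons_val_zero, Matrix.cons_val_one]
      ring
    · simp only [Matrix.cons_val_zero, Matrix.cons_val_one]
      ring
  · convert hau.lincomb hW hCW hu hv hav (1 / 2) (1 / 2) using 2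
    · simp only [Matrix.cons_val_zero]
      ring
    · ring
    · ring
  · convert hau.lincomb hW hCW hu hv hav (1 / 2) (-(1 / 2)) using 2
    · simp only [Matrix.cons_val_one, Matrix.cons_val_zero]
      ring
    · ring
    · ring

theorem IsWaveMapSolution.isSolution {W : Set (ℝ × ℝ)} (hW : IsOpen W) (hCW : C.curve ⊆ W)
    {Φ : ℝ × ℝ → Fin 2 → ℝ} (h : C.IsWaveMapSolution W Φ) :
    C.IsSolution W (fun r => Φ r 0 + Φ r 1) (fun r => Φ r 0 - Φ r 1) := by
  obtain ⟨hh, ha, hb⟩ := h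
  have hΦ := hh.1
  have h0 : ContDiffOn ℝ ∞ (fun r => Φ r 0) W := contDiffOn_pi.1 hΦ 0
  have h1 : ContDiffOn ℝ ∞ (fun r => Φ r 1) W := contDiffOn_pi.1 hΦ 1
  refine ⟨h0.add h1, h0.sub h1, (isHarmonicOn_iff hW hΦ).1 hh, ?_, ?_⟩
  · convert ha.lincomb hW hCW h0 h1 hb 1 1 using 2 <;> ring
  · convert ha.lincomb hW hCW h0 h1 hb 1 (-1) using 2 <;> ring

theorem IsSolution.unique {W : Set (ℝ × ℝ)} (hW : IsOpen W) (hCW : C.curve ⊆ W)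
    (hsq : ∀ r ∈ W, ∃ s ∈ C.I, ∃ t ∈ C.I, r = (C.p s, C.q t) ∧
      ∀ s' ∈ uIcc s t, ∀ t' ∈ uIcc s t, (C.p s', C.q t') ∈ W)
    {u v u' v' : ℝ × ℝ → ℝ} (h : C.IsSolution W u v) (h' : C.IsSolution W u' v') :
    EqOn u' u W ∧ EqOn v' v W := by
  have key : ∀ r ∈ W, u' r = u r ∧ v' r = v r := by
    intro r hr
    obtain ⟨s, hs, t, ht, rfl, hst⟩ := hsq r hr
    exact h.eq_of_square hW hCW h' (C.interval_I.uIcc_subset hs ht) hst s left_mem_uIcc t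
      right_mem_uIcc
  exact ⟨fun r hr => (key r hr).1, fun r hr => (key r hr).2⟩

theorem IsWaveMapSolution.unique {W : Set (ℝ × ℝ)} (hW : IsOpen W) (hCW : C.curve ⊆ W)
    (hsq : ∀ r ∈ W, ∃ s ∈ C.I, ∃ t ∈ C.I, r = (C.p s, C.q t) ∧
      ∀ s' ∈ uIcc s t, ∀ t' ∈ uIcc s t, (C.p s', C.q t') ∈ W)
    {u v : ℝ × ℝ → ℝ} (h : C.IsSolution W u v) {Φ : ℝ × ℝ → Fin 2 → ℝ}
    (hΦ : C.IsWaveMapSolution W Φ) :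
    EqOn Φ (fun r => ![(u r + v r) / 2, (u r - v r) / 2]) W := by
  obtain ⟨e1, e2⟩ := h.unique hW hCW hsq (hΦ.isSolution hW hCW)
  intro r hr
  have h1 : Φ r 0 + Φ r 1 = u r := e1 hr
  have h2 : Φ r 0 - Φ r 1 = v r := e2 hr
  ext i
  fin_cases i
  · change Φ r 0 = (u r + v r) / 2
    linarith
  · change Φ r 1 = (u r - v r) / 2
    linarith

/-! ### Flows of the Cauchy vector field -/

/-- Each point of `W` is reached from `γ` along a vertical segment in `W`, on which uniqueness of
integral curves applies. -/
theorem IsFlow.unique {W : Set (ℝ × ℝ)} (hW : C.VerticallyJoined W) {k₁ k₂ : ℝ → ℝ}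
    (hk₁ : ContinuousOn k₁ (C.q '' C.I)) (hk₂ : ContinuousOn k₂ (C.q '' C.I))
    {Z Z' : ℝ × ℝ → E4} (h : C.IsFlow k₁ k₂ W Z) (h' : C.IsFlow k₁ k₂ W Z') : EqOn Z' Z W := by
  rintro ⟨x, y⟩ hr
  obtain ⟨-, t, ht, hx, hseg⟩ := hW _ hr
  simp only at hx hseg
  have hsub : uIcc (C.q t) y ⊆ C.q '' C.I := fun s hs => (hW _ (hseg s hs)).1
  refine integralCurve_unique (hk₁.mono hsub) (hk₂.mono hsub) (f := fun s => Z' (x, s))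
    (g := fun s => Z (x, s)) (fun s hs => h'.1 _ (hseg s hs)) (fun s hs => h.1 _ (hseg s hs)) ?_
  have e1 := h.2 t ht
  have e2 := h'.2 t ht
  rw [← e1, pt, hx] at e2
  exact e2

theorem exists_antideriv_coefficient {k₂ : ℝ → ℝ} (hk₂ : ContinuousOn k₂ (C.q '' C.I)) :
    ∃ g : ℝ → ℝ, ∀ y ∈ C.q '' C.I, HasDerivAt g (-(k₂ y / 4)) y := by
  obtain ⟨hTo, hTc, -⟩ := exists_smooth_inverse C.isOpen_I C.interval_I C.smooth_q C.q_deriv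
  rcases (C.q '' C.I).eq_empty_or_nonempty with he | ⟨y₀, hy₀⟩
  · exact ⟨0, by simp [he]⟩
  · exact ⟨fun y => ∫ s in y₀..y, -(k₂ s / 4), fun y hy =>
      hasDerivAt_intervalIntegral_of_continuousOn hTo hTc (hk₂.div_const 4).neg hy₀ hy⟩

theorem IsFlow.solvesLieEquation {W : Set (ℝ × ℝ)} (hW : C.VerticallyJoined W) {k₁ k₂ : ℝ → ℝ}
    (hk : C.AreCoefficients k₁ k₂) {Z : ℝ × ℝ → E4} (h : C.IsFlow k₁ k₂ W Z) {g : ℝ → ℝ}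
    (hg : ∀ y ∈ C.q '' C.I, HasDerivAt g (-(k₂ y / 4)) y) :
    SolvesLieEquation chart slAct (lieCurve k₁ k₂) (C.q '' C.I) W
      (fun r => rescale (g r.2) (Z r)) := by
  refine ⟨contDiffOn_lieCurve hk.1 hk.2.1, fun r hr => ?_⟩
  obtain ⟨hz, hd⟩ := h.1 r hr
  have hy := (hW r hr).1
  exact ⟨hy, rescale_mem_chart hz _, _, isGenerator_fieldOf _, hasDerivAt_rescale hz hd (hg _ hy)⟩

/-- Existence for the Cauchy problem near the curve, with the flow property of the lift. -/
theorem exists_solution (C : CauchyData) {V : Set (ℝ × ℝ)} (hV : IsOpen V) (hCV : C.curve ⊆ V) :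
    ∃ W : Set (ℝ × ℝ), IsOpen W ∧ C.curve ⊆ W ∧ W ⊆ V ∧ C.VerticallyJoined W ∧
      (∀ r ∈ W, ∃ s ∈ C.I, ∃ t ∈ C.I, r = (C.p s, C.q t) ∧
        ∀ s' ∈ uIcc s t, ∀ t' ∈ uIcc s t, (C.p s', C.q t') ∈ W) ∧
      ∃ u v : ℝ × ℝ → ℝ, C.IsSolution W u v ∧ (C.Nondegenerate → ∀ k₁ k₂ : ℝ → ℝ,
        C.AreCoefficients k₁ k₂ → C.IsFlow k₁ k₂ W (lift u v)) := by
  obtain ⟨hSo, -⟩ := exists_smooth_inverse C.isOpen_I C.interval_I C.smooth_p C.p_deriv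
  obtain ⟨hTo, -⟩ := exists_smooth_inverse C.isOpen_I C.interval_I C.smooth_q C.q_deriv
  obtain ⟨A, P, Q, B, l₁, l₂, m₁, m₂, hloop, hcurve⟩ := C.exists_loopSolution
  set O : Set (ℝ × ℝ) := (C.p '' C.I) ×ˢ (C.q '' C.I) with hO
  have hOo : IsOpen O := hSo.prod hTo
  have hpre : ∀ {f : ℝ × ℝ → ℝ}, ContDiffOn ℝ ∞ f O → IsOpen (O ∩ f ⁻¹' Ioi 0) := fun hf =>
    hf.continuousOn.isOpen_inter_preimage hOo isOpen_Ioi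
  have hptO : ∀ t ∈ C.I, C.pt t ∈ O := fun t ht =>
    ⟨mem_image_of_mem _ ht, mem_image_of_mem _ ht⟩
  -- Positivity of `P` and `Q` makes the logarithms smooth; positivity of `A` keeps `u_y = 2 m₁ A /
  -- P` nonzero where `m₁` is.
  obtain ⟨W, hW, hCW, hWV, hvert, hsq⟩ := C.exists_nhds
    (hV.inter ((hpre hloop.smooth_A).inter ((hpre hloop.smooth_P).inter (hpre hloop.smooth_Q)))) (by
      rintro _ ⟨t, ht, rfl⟩
      obtain ⟨a1, -, a2, a3, -⟩ := hcurve t ht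
      refine ⟨hCV (C.pt_mem_curve ht), ⟨hptO t ht, a1⟩, ⟨hptO t ht, ?_⟩, ⟨hptO t ht, ?_⟩⟩
      · simp only [mem_preimage, a2]
        exact Real.exp_pos _
      · simp only [mem_preimage, a3]
        exact Real.exp_pos _)
  have hWO : W ⊆ O := fun r hr => (hWV hr).2.1.1
  have hA : ∀ r ∈ W, 0 < A r := fun r hr => (hWV hr).2.1.2
  have hP : ∀ r ∈ W, 0 < P r := fun r hr => (hWV hr).2.2.1.2
  have hQ : ∀ r ∈ W, 0 < Q r := fun r hr => (hWV hr).2.2.2.2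
  obtain ⟨su, sv, hsys, hjet⟩ := hloop.logs hSo hTo hW hWO hP hQ
  set u : ℝ × ℝ → ℝ := fun r => 2 * Real.log (P r) with hu
  set v : ℝ × ℝ → ℝ := fun r => 2 * Real.log (Q r) with hv
  have hjetγ : ∀ t ∈ C.I, u (C.pt t) = C.φ₁ t ∧ v (C.pt t) = C.φ₂ t ∧ dx u (C.pt t) = C.ux t ∧
      dy u (C.pt t) = C.uy t ∧ dx v (C.pt t) = C.vx t ∧ dy v (C.pt t) = C.vy t := by
    intro t ht
    have hm := hCW (C.pt_mem_curve ht)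
    have p1 := (hP _ hm).ne'
    have p2 := (hQ _ hm).ne'
    obtain ⟨-, -, e1, e2, e3, e4, e5, e6⟩ := hcurve t ht
    obtain ⟨-, -, d1, d2, d3, d4, -, -⟩ := hjet _ hm
    refine ⟨?_, ?_, ?_, ?_, ?_, ?_⟩
    · simp only [hu, e1, Real.log_exp]
      ring
    · simp only [hv, e2, Real.log_exp]
      ring
    · rw [d1, div_eq_iff p1]
      change 2 * l₁ (C.p t) * _ = _
      linear_combination 2 * e3
    · rw [d2, div_eq_iff p1]
      change 2 * m₁ (C.q t) * _ = _
      linear_combination 2 * e4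
    · rw [d3, div_eq_iff p2]
      change 2 * l₂ (C.p t) * _ = _
      linear_combination 2 * e5
    · rw [d4, div_eq_iff p2]
      change 2 * m₂ (C.q t) * _ = _
      linear_combination 2 * e6
  have hsol : C.IsSolution W u v := by
    refine ⟨su, sv, hsys, C.attains_of_partials fun t ht => ?_, C.attains_of_partials fun t ht => ?_⟩
    · obtain ⟨a1, a2, a3, a4, a5, a6⟩ := hjetγ t ht
      exact ⟨a1, a3, a4⟩
    · obtain ⟨a1, a2, a3, a4, a5, a6⟩ := hjetγ t ht
      exact ⟨a2, a5, a6⟩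
  refine ⟨W, hW, hCW, fun r hr => (hWV hr).1, hvert, hsq, u, v, hsol, ?_⟩
  intro hnd k₁ k₂ hk
  -- Each `y` is attained on `γ`, so the relations can be verified there from the data; as they
  -- involve `y` only, they hold over all of `W`. Nondegeneracy gives `m₁ ≠ 0`.
  have hcoef : ∀ y ∈ C.q '' C.I, m₁ y ≠ 0 ∧ k₁ y = 4 * m₁ y * m₂ y ∧
      k₂ y = 2 * deriv m₁ y / m₁ y := by
    rintro _ ⟨t, ht, rfl⟩
    have hm := hCW (C.pt_mem_curve ht)
    have p0 := (hA _ hm).ne'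
    have p1 := (hP _ hm).ne'
    have p2 := (hQ _ hm).ne'
    obtain ⟨a1, a2, a3, a4, a5, a6⟩ := hjetγ t ht
    obtain ⟨d1, d2, d3, d4, d5, d6, d7, -⟩ := hjet _ hm
    have hdet := hloop.det _ (hWO hm)
    have huy := hnd t ht
    have hpq : 1 + P (C.pt t) * Q (C.pt t) ≠ 0 := by
      have := hP _ hm; have := hQ _ hm; positivity
    rw [a4] at d4
    rw [a6] at d6
    change C.uy t = 2 * m₁ (C.q t) * A (C.pt t) / P (C.pt t) at d4
    change C.vy t = 2 * m₂ (C.q t) * B (C.pt t) / Q (C.pt t) at d6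
    have hm₁ : m₁ (C.q t) ≠ 0 := by
      intro h0
      rw [h0] at d4
      exact huy (by rw [d4]; simp)
    have hexp : Real.exp (-((C.φ₁ t + C.φ₂ t) / 2)) = 1 / (P (C.pt t) * Q (C.pt t)) := by
      rw [Real.exp_neg, add_div, Real.exp_add, ← a1, ← a2, d1, d2, one_div]
    have hB : B (C.pt t) ≠ 0 := by
      rw [← hdet] at hpq
      exact right_ne_zero_of_mul hpq
    have hi₁ : C.inv₁ t = 4 * m₁ (C.q t) * m₂ (C.q t) := by
      have : 1 + 1 / (P (C.pt t) * Q (C.pt t)) =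
          A (C.pt t) * B (C.pt t) / (P (C.pt t) * Q (C.pt t)) := by
        rw [hdet]
        field_simp
        ring
      rw [inv₁, hexp, d4, d6, this]
      field_simp
      ring
    have hyy : C.uyy t = _ := (hsol.uyy_eq hW hCW ht).trans
      ((hasDerivAt_snd (differentiableAt_of_contDiffOn hW (contDiffOn_dy hW su) hm)).unique d7)
    refine ⟨hm₁, (hk.2.2 t ht).1.trans hi₁, (hk.2.2 t ht).2.trans ?_⟩
    rw [inv₂, hi₁, hyy, d4]
    change (2 * (2 * deriv m₁ (C.q t) * A (C.pt t) / P (C.pt t) + 2 * m₁ (C.q t) * m₂ (C.q t) -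
      2 * m₁ (C.q t) ^ 2 * A (C.pt t) ^ 2 / P (C.pt t) ^ 2) + _ - _) / _ = _
    field_simp
    ring
  refine ⟨fun r hr => ?_, fun t ht => ?_⟩
  · have hy : r.2 ∈ C.q '' C.I := (hWO hr).2
    obtain ⟨hm₁, e1, e2⟩ := hcoef _ hy
    have p0 := hA r hr
    have p1 := hP r hr
    have p2 := hQ r hr
    obtain ⟨d1, d2, d3, d4, d5, d6, d7, d8⟩ := hjet r hr
    have hdet := hloop.det r (hWO hr)
    have hlift : lift u v r = ![P r, Q r, 2 * m₁ r.2 * A r / P r, 2 * l₂ r.1 * A r / Q r] := by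
      rw [lift, d1, d2, d4, d5]
    have hz3 : 2 * m₁ r.2 * A r / P r ≠ 0 := by positivity
    refine ⟨?_, ?_⟩
    · rw [hlift]
      exact ⟨p1, p2, hz3⟩
    · rw [cauchyField_apply, hlift, e1, e2, hasDerivAt_pi]
      have du := ((hasDerivAt_snd (differentiableAt_of_contDiffOn hW su hr)).div_const 2).exp
      have dv := ((hasDerivAt_snd (differentiableAt_of_contDiffOn hW sv hr)).div_const 2).exp
      simp only [Prod.mk.eta, d1, d2, d4, d6] at du dv
      intro i
      fin_cases i
      · refine du.congr_deriv ?_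
        simp
        ring
      · refine dv.congr_deriv ?_
        -- With `1 + P Q = A B`, the coefficient of `R₂` along `∂₂` reduces to a multiple of `B`.
        have : (1 + P r * Q r) / (P r * (2 * m₁ r.2 * A r / P r)) = B r / (2 * m₁ r.2) := by
          rw [← hdet]
          field_simp
        simp only [Matrix.cons_val_zero, Matrix.cons_val_one, Matrix.cons_val, this]
        field_simp
        simp
        field_simp
        norm_num
      · refine d7.congr_deriv ?_
        simp
        field_simp
        ring
      · refine d8.congr_deriv ?_
        simp
        field_simp
        ring
  · obtain ⟨a1, a2, a3, a4, a5, a6⟩ := hjetγ t ht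
    rw [lift, initial, a1, a2, a4, a5]

end CauchyData

end WaveLie

/-! ### Assembly of the main theorem. -/

theorem theorem1 :
    WaveLie.VessiotStructure ∧
    ∃ (D : Set (WaveLie.SL2 × WaveLie.E4)) (μ : WaveLie.SL2 → WaveLie.E4 → WaveLie.E4),
      WaveLie.IsLocalAction WaveLie.chart D μ ∧
      (∀ A : WaveLie.sl2, WaveLie.IsGenerator WaveLie.chart μ A (WaveLie.fieldOf A)) ∧
      ∀ C : WaveLie.CauchyData,
        (C.Nondegenerate → ∃ k₁ k₂ : ℝ → ℝ, C.AreCoefficients k₁ k₂) ∧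
        ∀ V : Set (ℝ × ℝ), IsOpen V → C.curve ⊆ V →
          ∃ W : Set (ℝ × ℝ), IsOpen W ∧ C.curve ⊆ W ∧ W ⊆ V ∧ C.VerticallyJoined W ∧
            ∃ u v : ℝ × ℝ → ℝ,
              -- existence and uniqueness for the Cauchy problem
              C.IsSolution W u v ∧
              (∀ u' v' : ℝ × ℝ → ℝ, C.IsSolution W u' v' → EqOn u' u W ∧ EqOn v' v W) ∧
              -- the solution is the flow of the Cauchy vector field, and an equation of Lie type
              (C.Nondegenerate → ∀ k₁ k₂ : ℝ → ℝ, C.AreCoefficients k₁ k₂ →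
                (∀ y, WaveLie.cauchyField k₁ k₂ y ∈ WaveLie.vessiotAlgebra) ∧
                C.IsFlow k₁ k₂ W (WaveLie.lift u v) ∧
                (∀ Z : ℝ × ℝ → WaveLie.E4, C.IsFlow k₁ k₂ W Z → EqOn Z (WaveLie.lift u v) W) ∧
                ∃ g : ℝ → ℝ, (∀ y ∈ C.q '' C.I, HasDerivAt g (-(k₂ y / 4)) y) ∧
                  WaveLie.SolvesLieEquation WaveLie.chart μ (WaveLie.lieCurve k₁ k₂) (C.q '' C.I) W
                    (fun r => WaveLie.rescale (g r.2) (WaveLie.lift u v r))) ∧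
              -- the Cauchy problem for wave maps
              C.IsWaveMapSolution W (fun r => ![(u r + v r) / 2, (u r - v r) / 2]) ∧
              (∀ Φ : ℝ × ℝ → Fin 2 → ℝ, C.IsWaveMapSolution W Φ →
                EqOn Φ (fun r => ![(u r + v r) / 2, (u r - v r) / 2]) W) := by
  refine ⟨WaveLie.vessiotStructure, WaveLie.slDomain, WaveLie.slAct, WaveLie.isLocalAction_slAct,
    WaveLie.isGenerator_fieldOf, fun C => ⟨fun h => h.exists_coefficients, fun V hV hCV => ?_⟩⟩
  obtain ⟨W, hW, hCW, hWV, hvert, hsq, u, v, hsol, hflow⟩ := C.exists_solution hV hCV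
  refine ⟨W, hW, hCW, hWV, hvert, u, v, hsol, fun u' v' h => hsol.unique hW hCW hsq h, ?_,
    hsol.isWaveMapSolution hW hCW, fun Φ hΦ => hΦ.unique hW hCW hsq hsol⟩
  intro hnd k₁ k₂ hk
  have hF := hflow hnd k₁ k₂ hk
  obtain ⟨g, hg⟩ := C.exists_antideriv_coefficient hk.2.1.continuousOn
  exact ⟨WaveLie.cauchyField_mem k₁ k₂, hF, fun Z hZ =>
    hF.unique hvert hk.1.continuousOn hk.2.1.continuousOn hZ, g, hg,
    hF.solvesLieEquation hvert hk hg⟩
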